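/- Let $p$ be a prime, let $k$ be a perfect field of characteristic $p$, and let $W_2(k)$ be the ring of Witt vectors of length two, with projection $W_2(k)\to k$, $(a_0,a_1)\mapsto a_0$, and Frobenius $F_{W_2(k)}(a_0,a_1)=(a_0^p,a_1^p)$. Let $X$ be a smooth scheme over $k$, and let $D=\sum_i D_i$ be a finite sum of closed subschemes of $X$ that is a simple normal crossing divisor: $X$ is covered by affine opens $U$ with an étale morphism $(t_1,\dots,t_n):U\to\mathbb A^n_k$ such that the non-empty $D_i\cap U$ are the zero schemes of pairwise different coordinates $t_j$. Assume that $(X,D)$ has a lifting $(\widetilde X,\widetilde D)$ over $W_2(k)$: a scheme $\widetilde X$ and closed subschemes $\widetilde D_i\subset\widetilde X$, all flat over $W_2(k)$, with $X=\widetilde X\times_{\operatorname{Spec}W_2(k)}\operatorname{Spec}k$ and $D_i=\widetilde D_i\times_{\operatorname{Spec}W_2(k)}\operatorname{Spec}k$; $\widetilde D=\sum_i\widetilde D_i$. Let $X'$ and $D'_i$ be the base changes of $X$ and $D_i$ along the Frobenius of $k$, let $F:X\to X'$ be the relative Frobenius morphism, and let $\widetilde X'$ and $\widetilde D'_i$ be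 the base changes of $\widetilde X$ and $\widetilde D_i$ along $F_{W_2(k)}$. Assume that $F$ has a lifting $\widetilde F:\widetilde X\to\widetilde X'$, that is, a morphism over $W_2(k)$ that restricts to $F$ on $X$, and that $\widetilde F$ is compatible with $\widetilde D$, i.e. $\widetilde F^*\mathcal O_{\widetilde X'}(-\widetilde D')=\mathcal O_{\widetilde X}(-p\widetilde D)$ as ideal sheaves. Here $\Omega^i_X(\log D)$ is the sheaf of logarithmic differential $i$-forms on $X/k$, i.e. the subsheaf of $\mathcal O_X$-modules, inside the sheaf of $i$-forms on the complement of $D$, that is locally generated by the $i$-fold products of the forms $db$ ($b$ a function) and $dt/t$ ($t$ a local equation of some $D_j$); similarly for $X'/k$, and for $\widetilde X$ and $\widetilde X'$ over $W_2(k)$. Then there is a quasi-isomorphism of complexes of $\mathcal O_{X'}$-modules $$\varphi:\bigoplus_i\Omega^i_{X'}(\log D')[-i]\longrightarrow F_*\Omega^\bullet_X(\log D)$$ (with zero differentials on the left and the exterior derivative on the right) such that * $\varphi^0:\mathcal O_{X'}\to F_*\mathcal O_X$ is the Frobenius homomorphism $F^\#$; * $\varphi^1=p^{-1}\widetilde F^*$,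 that is, $p\,\widetilde\eta=\widetilde F^*\widetilde\omega$ whenever $\widetilde\omega$ and $\widetilde\eta$ are local sections of $\Omega^1_{\widetilde X'/W_2(k)}(\log\widetilde D')$ and $\Omega^1_{\widetilde X/W_2(k)}(\log\widetilde D)$ that reduce to $\omega$ and to $\varphi^1(\omega)$; * $\varphi^{i+j}(\alpha\wedge\beta)=\varphi^i(\alpha)\wedge\varphi^j(\beta)$, so that $\varphi^i=\bigwedge^i\varphi^1$ for $i\ge 1$. -/

import Mathlib

open scoped KaehlerDifferential

universe u

noncomputable section

namespace LogDR

section deRham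

variable (R A : Type*) [CommRing R] [CommRing A] [Algebra R A]

/-- The exterior algebra `⋀ Ω_{A/R}`: the graded algebra underlying the de Rham complex. -/
abbrev Forms : Type _ := ExteriorAlgebra A (Ω[A⁄R])

variable {A} in
/-- The exact one-form `d a`, in the exterior algebra. -/
def dOne (a : A) : Forms R A := ExteriorAlgebra.ι A (KaehlerDifferential.D R A a)

theorem dOne_add (a b : A) : dOne R (a + b) = dOne R a + dOne R b := by
  simp [dOne]

theorem dOne_mul (a b : A) : dOne R (a * b) = a • dOne R b + b • dOne R a := by
  simp [dOne]

theorem dOne_anticomm (a b : A) : dOne R a * dOne R b = - (dOne R b * dOne R a) :=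
  eq_neg_of_add_eq_zero_left (ExteriorAlgebra.ι_add_mul_swap _ _)

/-- Auxiliary: the upper triangular matrix `(x, y; 0, z)`. -/
def ut {E : Type*} [Ring E] (x y z : E) : Matrix (Fin 2) (Fin 2) E := !![x, y; 0, z]

theorem ut_mul {E : Type*} [Ring E] (x y z x' y' z' : E) :
    ut x y z * ut x' y' z' = ut (x * x') (x * y' + y * z') (z * z') := by
  ext i j
  fin_cases i <;> fin_cases j <;> simp [ut]

theorem ut_add {E : Type*} [Ring E] (x y z x' y' z' : E) :
    ut x y z + ut x' y' z' = ut (x + x') (y + y') (z + z') := by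
  ext i j
  fin_cases i <;> fin_cases j <;> simp [ut]

theorem ut_zero {E : Type*} [Ring E] : ut (0 : E) 0 0 = 0 := by
  ext i j
  fin_cases i <;> fin_cases j <;> simp [ut]

theorem ut_one {E : Type*} [Ring E] : ut (1 : E) 0 1 = 1 := by
  ext i j
  fin_cases i <;> fin_cases j <;> simp [ut]

theorem dOne_one : dOne R (1 : A) = 0 := by simp [dOne]

theorem dOne_zero : dOne R (0 : A) = 0 := by simp [dOne]

/-- Auxiliary: `a ↦ (a, da; 0, a)`. The exterior derivative is obtained below as the off-diagonal
entry of a ring homomorphism `ω ↦ (± ω, dω; 0, ω)` extending this one. -/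
def scal : A →+* Matrix (Fin 2) (Fin 2) (Forms R A) where
  toFun a := ut (algebraMap _ _ a) (dOne R a) (algebraMap _ _ a)
  map_one' := by rw [map_one, dOne_one, ut_one]
  map_zero' := by rw [map_zero, dOne_zero, ut_zero]
  map_add' a b := by rw [map_add, dOne_add, ut_add]
  map_mul' a b := by
    rw [map_mul, dOne_mul, ut_mul, Algebra.smul_def, Algebra.smul_def, Algebra.commutes b]

theorem scal_apply (a : A) :
    scal R A a = ut (algebraMap _ _ a) (dOne R a) (algebraMap _ _ a) := rfl

/-- Auxiliary: the matrices that commute with all `(a, da; 0, a)`. -/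
abbrev Twist : Type _ := Subring.centralizer (Set.range (scal R A))

/-- Auxiliary: the algebra structure `a ↦ (a, da; 0, a)`. -/
def scalTwist : A →+* Twist R A :=
  (scal R A).codRestrict (Subring.centralizer (Set.range (scal R A))) (fun a => by
    rw [Subring.mem_centralizer_iff]
    rintro _ ⟨b, rfl⟩
    rw [← map_mul, ← map_mul, mul_comm])

instance twistAlgebra : Algebra A (Twist R A) :=
  (scalTwist R A).toAlgebra' (fun c x => by
    apply Subtype.ext
    exact (Subring.mem_centralizer_iff.mp x.2 _ ⟨c, rfl⟩))

instance twistAlgebraBase : Algebra R (Twist R A) :=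
  ((scalTwist R A).comp (algebraMap R A)).toAlgebra' (fun c x => by
    apply Subtype.ext
    exact (Subring.mem_centralizer_iff.mp x.2 _ ⟨_, rfl⟩))

instance : IsScalarTower R A (Twist R A) := IsScalarTower.of_algebraMap_eq fun _ => rfl

theorem twist_smul_val (a : A) (x : Twist R A) :
    (a • x).1 = scal R A a * x.1 := by
  rw [Algebra.smul_def]; rfl

/-- Auxiliary: the matrix `(-db, 0; 0, db)`. -/
def twistD (b : A) : Twist R A :=
  ⟨ut (-dOne R b) 0 (dOne R b), by
    rw [Subring.mem_centralizer_iff]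
    rintro _ ⟨a, rfl⟩
    rw [scal_apply, ut_mul, ut_mul, mul_neg, neg_mul, ← Algebra.commutes a, neg_mul,
      ← dOne_anticomm, mul_zero, zero_mul, zero_add, add_zero]⟩

theorem twistD_val (b : A) : (twistD R A b).1 = ut (-dOne R b) 0 (dOne R b) := rfl

/-- Auxiliary: the derivation `b ↦ (-db, 0; 0, db)`. -/
def twistDer : Derivation R A (Twist R A) :=
  Derivation.mk'
    { toFun := twistD R A
      map_add' := fun a b => Subtype.ext (by
        rw [Subring.coe_add, twistD_val, twistD_val, twistD_val, ut_add, dOne_add, neg_add,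
          add_zero])
      map_smul' := fun r b => Subtype.ext (by
        have h : dOne R (r • b) = algebraMap A (Forms R A) (algebraMap R A r) * dOne R b := by
          rw [dOne, dOne, Derivation.map_smul, ← IsScalarTower.algebraMap_smul A r, map_smul,
            Algebra.smul_def]
        have h0 : dOne R (algebraMap R A r) = 0 := by simp [dOne]
        rw [RingHom.id_apply, ← IsScalarTower.algebraMap_smul A r (twistD R A b),
          twist_smul_val, twistD_val, twistD_val, scal_apply, ut_mul, h, h0, mul_neg, mul_zero,
          zero_mul, add_zero]) }
    (fun a b => Subtype.ext (by
      change (twistD R A (a * b)).1 = (a • twistD R A b).1 + (b • twistD R A a).1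
      rw [twist_smul_val, twist_smul_val, twistD_val, twistD_val, twistD_val, scal_apply,
        scal_apply, ut_mul, ut_mul, ut_add, dOne_mul, mul_zero, mul_zero, zero_add, zero_add,
        dOne_anticomm R A a b, neg_add_cancel, mul_neg, mul_neg, Algebra.smul_def,
        Algebra.smul_def, neg_add]))

theorem twistDer_apply (b : A) : twistDer R A b = twistD R A b := rfl

/-- Auxiliary: the `A`-linear extension of `twistDer` to one-forms. -/
def twistLin : Ω[A⁄R] →ₗ[A] Twist R A := (twistDer R A).liftKaehlerDifferential

theorem twistLin_anticomm (x y : Ω[A⁄R]) :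
    twistLin R A x * twistLin R A y + twistLin R A y * twistLin R A x = 0 := by
  have hx : x ∈ Submodule.span A (Set.range (KaehlerDifferential.D R A)) := by
    rw [KaehlerDifferential.span_range_derivation]; trivial
  have hy : y ∈ Submodule.span A (Set.range (KaehlerDifferential.D R A)) := by
    rw [KaehlerDifferential.span_range_derivation]; trivial
  induction hx using Submodule.span_induction with
  | zero => simp
  | add u v _ _ hu hv =>
    have := congrArg₂ (· + ·) hu hv
    simp only [map_add, add_mul, mul_add] at this ⊢
    rw [← add_zero (0 : Twist R A), ← this]; abel
  | smul a u _ hu => simp only [map_smul, smul_mul_assoc, mul_smul_comm, ← smul_add, hu, smul_zero]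
  | mem u hu =>
    obtain ⟨a, rfl⟩ := hu
    induction hy using Submodule.span_induction with
    | zero => simp
    | add u v _ _ hu hv =>
      have := congrArg₂ (· + ·) hu hv
      simp only [map_add, add_mul, mul_add] at this ⊢
      rw [← add_zero (0 : Twist R A), ← this]; abel
    | smul a u _ hu =>
      simp only [map_smul, smul_mul_assoc, mul_smul_comm, ← smul_add, hu, smul_zero]
    | mem v hv =>
      obtain ⟨b, rfl⟩ := hv
      apply Subtype.ext
      simp only [twistLin, Derivation.liftKaehlerDifferential_comp_D, twistDer_apply]
      rw [Subring.coe_add, Subring.coe_mul, Subring.coe_mul, twistD_val, twistD_val, ut_mul,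
        ut_mul, ut_add, neg_mul_neg, neg_mul_neg, dOne_anticomm R A a b]
      simp only [mul_zero, zero_mul, add_zero, neg_add_cancel]
      exact ut_zero

theorem twistLin_sq (x : Ω[A⁄R]) : twistLin R A x * twistLin R A x = 0 := by
  have hx : x ∈ Submodule.span A (Set.range (KaehlerDifferential.D R A)) := by
    rw [KaehlerDifferential.span_range_derivation]; trivial
  induction hx using Submodule.span_induction with
  | zero => simp
  | add u v _ _ hu hv =>
    have := twistLin_anticomm R A u v
    simp only [map_add, add_mul, mul_add, hu, hv, zero_add, add_zero]
    rw [← this]; abel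
  | smul a u _ hu => simp only [map_smul, smul_mul_assoc, mul_smul_comm, hu, smul_zero]
  | mem u hu =>
    obtain ⟨a, rfl⟩ := hu
    apply Subtype.ext
    simp only [twistLin, Derivation.liftKaehlerDifferential_comp_D, twistDer_apply]
    have h : dOne R a * dOne R a = 0 := ExteriorAlgebra.ι_sq_zero _
    rw [Subring.coe_mul, twistD_val, ut_mul, neg_mul_neg, h, mul_zero, zero_mul, add_zero]
    exact ut_zero

/-- Auxiliary: the ring homomorphism `ω ↦ (± ω, dω; 0, ω)`. -/
def twistHom : Forms R A →ₐ[A] Twist R A :=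
  ExteriorAlgebra.lift A ⟨twistLin R A, twistLin_sq R A⟩

/-- The exterior derivative on `⋀ Ω_{A/R}`. -/
def extD : Forms R A →+ Forms R A where
  toFun x := (twistHom R A x).1 0 1
  map_zero' := by simp
  map_add' x y := by simp

theorem twistHom_algebraMap (a : A) :
    (twistHom R A (algebraMap _ _ a)).1 = scal R A a := by
  rw [AlgHom.commutes]; rfl

theorem twistLin_entries (x : Ω[A⁄R]) :
    (twistLin R A x).1 0 0 = - ExteriorAlgebra.ι A x ∧ (twistLin R A x).1 1 0 = 0 ∧
      (twistLin R A x).1 1 1 = ExteriorAlgebra.ι A x := by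
  have hx : x ∈ Submodule.span A (Set.range (KaehlerDifferential.D R A)) := by
    rw [KaehlerDifferential.span_range_derivation]; trivial
  induction hx using Submodule.span_induction with
  | zero => simp
  | add u v _ _ hu hv => simp [hu, hv, add_comm]
  | smul a u _ hu =>
    rw [map_smul, twist_smul_val, scal_apply, map_smul, Algebra.smul_def]
    simp only [Matrix.mul_apply, Fin.sum_univ_two, hu, mul_zero, add_zero, mul_neg]
    simp [ut]
  | mem u hu =>
    obtain ⟨a, rfl⟩ := hu
    simp only [twistLin, Derivation.liftKaehlerDifferential_comp_D]
    rw [twistDer_apply, twistD_val]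
    exact ⟨rfl, rfl, rfl⟩

theorem twistHom_entries (x : Forms R A) :
    (twistHom R A x).1 1 0 = 0 ∧ (twistHom R A x).1 1 1 = x := by
  induction x using ExteriorAlgebra.induction with
  | algebraMap a => rw [twistHom_algebraMap]; exact ⟨rfl, rfl⟩
  | ι x =>
    rw [show twistHom R A (ExteriorAlgebra.ι A x) = twistLin R A x from
      ExteriorAlgebra.lift_ι_apply _ _ _ _]
    exact (twistLin_entries R A x).2
  | mul a b ha hb => simp [Matrix.mul_apply, ha, hb]
  | add a b ha hb => simp [ha, hb]

theorem extD_algebraMap (a : A) : extD R A (algebraMap _ _ a) = dOne R a := by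
  change (twistHom R A _).1 0 1 = _
  rw [twistHom_algebraMap]; rfl

theorem extD_dOne (a : A) : extD R A (dOne R a) = 0 := by
  change (twistHom R A (ExteriorAlgebra.ι A _)).1 0 1 = _
  rw [show twistHom R A (ExteriorAlgebra.ι A _) = twistLin R A _ from
      ExteriorAlgebra.lift_ι_apply _ _ _ _]
  simp only [twistLin, Derivation.liftKaehlerDifferential_comp_D]
  rfl

/-- The Leibniz rule in degree zero. -/
theorem extD_smul (a : A) (x : Forms R A) : extD R A (a • x) = dOne R a * x + a • extD R A x := by
  change (twistHom R A _).1 0 1 = _ + _ • (twistHom R A _).1 0 1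
  rw [Algebra.smul_def, map_mul, Subring.coe_mul, twistHom_algebraMap]
  simp only [Matrix.mul_apply, Fin.sum_univ_two, (twistHom_entries R A x).2, scal_apply,
    Algebra.smul_def]
  exact add_comm _ _

/-- The Leibniz rule in degree one. -/
theorem extD_ι_mul (w : Ω[A⁄R]) (x : Forms R A) :
    extD R A (ExteriorAlgebra.ι A w * x) =
      extD R A (ExteriorAlgebra.ι A w) * x - ExteriorAlgebra.ι A w * extD R A x := by
  change (twistHom R A _).1 0 1 = (twistHom R A _).1 0 1 * x - _ * (twistHom R A _).1 0 1
  rw [map_mul, Subring.coe_mul]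
  rw [show twistHom R A (ExteriorAlgebra.ι A w) = twistLin R A _ from
      ExteriorAlgebra.lift_ι_apply _ _ _ _]
  simp [Matrix.mul_apply, twistHom_entries R A x, twistLin_entries R A w]
  abel

/-- The logarithmic one-form `d t / t` (it is zero when `t` is not invertible). -/
def dlog {A : Type*} [CommRing A] [Algebra R A] (t : A) : Forms R A := Ring.inverse t • dOne R t

theorem dlog_eq_ι (t : A) :
    dlog R t = ExteriorAlgebra.ι A (Ring.inverse t • KaehlerDifferential.D R A t) := by
  rw [dlog, dOne, map_smul]

theorem extD_dlog (t : A) : extD R A (dlog R t) = 0 := by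
  rw [dlog, extD_smul, extD_dOne, smul_zero, add_zero]
  by_cases ht : IsUnit t
  · have h1 : Ring.inverse t * t = 1 := Ring.inverse_mul_cancel t ht
    have h2 : Ring.inverse t • dOne R t + t • dOne R (Ring.inverse t) = 0 := by
      rw [← dOne_mul, h1, dOne_one]
    have h3 : dOne R t * dOne R t = 0 := ExteriorAlgebra.ι_sq_zero _
    have h4 : t • (dOne R (Ring.inverse t) * dOne R t) = 0 := by
      rw [← smul_mul_assoc, eq_neg_of_add_eq_zero_right h2, neg_mul, smul_mul_assoc, h3,
        smul_zero, neg_zero]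
    have h5 := congrArg (fun z => Ring.inverse t • z) h4
    simpa only [smul_smul, h1, one_smul, smul_zero] using h5
  · rw [Ring.inverse_non_unit t ht, dOne_zero, zero_mul]

theorem extD_list_prod (l : List (Forms R A))
    (hl : ∀ w ∈ l, extD R A w = 0 ∧ ∃ v, w = ExteriorAlgebra.ι A v) : extD R A l.prod = 0 := by
  induction l with
  | nil =>
    rw [List.prod_nil, ← map_one (algebraMap A (Forms R A)), extD_algebraMap, dOne_one]
  | cons w l ih =>
    obtain ⟨h, v, rfl⟩ := hl w List.mem_cons_self
    rw [List.prod_cons, extD_ι_mul, h, ih fun w hw => hl w (List.mem_cons_of_mem _ hw), zero_mul,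
      mul_zero, sub_zero]

theorem dOne_pow_char (p : ℕ) (h : (p : A) = 0) (a : A) : dOne R (a ^ p) = 0 := by
  rw [dOne, Derivation.leibniz_pow, ← Nat.cast_smul_eq_nsmul A, h, zero_smul, map_zero]

section formsMap

variable {R A} {S B : Type*} [CommRing S] [CommRing B] [Algebra S B]

/-- Pullback of forms along a commutative square of ring homomorphisms. -/
def formsMap (b : R →+* S) (g : A →+* B)
    (h : ∀ r, g (algebraMap R A r) = algebraMap S B (b r)) : Forms R A →+* Forms S B :=
  letI := g.toAlgebra
  letI := b.toAlgebra
  letI : Algebra R B := (g.comp (algebraMap R A)).toAlgebra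
  haveI : IsScalarTower R A B := IsScalarTower.of_algebraMap_eq fun _ => rfl
  haveI : IsScalarTower R S B := IsScalarTower.of_algebraMap_eq fun r => h r
  (ExteriorAlgebra.lift A
    ⟨(ExteriorAlgebra.ι B).restrictScalars A ∘ₗ KaehlerDifferential.map R S A B,
      fun _ => ExteriorAlgebra.ι_sq_zero _⟩ : Forms R A →ₐ[A] Forms S B).toRingHom

theorem formsMap_algebraMap (b : R →+* S) (g : A →+* B)
    (h : ∀ r, g (algebraMap R A r) = algebraMap S B (b r)) (a : A) :
    formsMap b g h (algebraMap A _ a) = algebraMap B _ (g a) := by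
  let := g.toAlgebra
  let := b.toAlgebra
  let : Algebra R B := (g.comp (algebraMap R A)).toAlgebra
  have : IsScalarTower R A B := IsScalarTower.of_algebraMap_eq fun _ => rfl
  have : IsScalarTower R S B := IsScalarTower.of_algebraMap_eq fun r => h r
  exact (AlgHom.commutes _ a).trans (IsScalarTower.algebraMap_apply A B (Forms S B) a)

theorem formsMap_dOne (b : R →+* S) (g : A →+* B)
    (h : ∀ r, g (algebraMap R A r) = algebraMap S B (b r)) (a : A) :
    formsMap b g h (dOne R a) = dOne S (g a) := by
  let := g.toAlgebra
  let := b.toAlgebra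
  let : Algebra R B := (g.comp (algebraMap R A)).toAlgebra
  have : IsScalarTower R A B := IsScalarTower.of_algebraMap_eq fun _ => rfl
  have : IsScalarTower R S B := IsScalarTower.of_algebraMap_eq fun r => h r
  refine (ExteriorAlgebra.lift_ι_apply _ _ _ _).trans ?_
  simp [dOne]
  rfl

end formsMap

end deRham

open AlgebraicGeometry CategoryTheory Limits TopologicalSpace Opposite

section stalks

variable {R : Type u} [CommRing R] {X : Scheme.{u}} (f : X ⟶ Spec (CommRingCat.of R))

/-- The structure homomorphism `R → 𝒪_{X,x}` of a scheme over `Spec R`. -/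
def baseToStalk (x : X) : R →+* X.presheaf.stalk x :=
  (X.presheaf.germ ⊤ x trivial).hom.comp
    (f.appTop.hom.comp (Scheme.ΓSpecIso (CommRingCat.of R)).inv.hom)

/-- The `R`-algebra structure on `𝒪_{X,x}`. -/
abbrev stalkAlgebra (x : X) : Algebra R (X.presheaf.stalk x) := (baseToStalk f x).toAlgebra

/-- The exterior algebra `⋀ Ω_{𝒪_{X,x}/R}`, i.e. the stalk at `x` of `⋀ Ω_{X/R}`. -/
def StalkForms (x : X) : Type u := @Forms R (X.presheaf.stalk x) _ _ (stalkAlgebra f x)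

instance (x : X) : Ring (StalkForms f x) :=
  inferInstanceAs (Ring (@Forms R (X.presheaf.stalk x) _ _ (stalkAlgebra f x)))

instance (x : X) : Algebra (X.presheaf.stalk x) (StalkForms f x) :=
  inferInstanceAs (Algebra (X.presheaf.stalk x)
    (@Forms R (X.presheaf.stalk x) _ _ (stalkAlgebra f x)))

/-- The exact one-form `d a` at `x`. -/
def stalkD (x : X) (a : X.presheaf.stalk x) : StalkForms f x :=
  @dOne R (X.presheaf.stalk x) _ _ (stalkAlgebra f x) a

/-- The logarithmic one-form `d t / t` at `x`. -/
def stalkDlog (x : X) (t : X.presheaf.stalk x) : StalkForms f x :=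
  @dlog R _ (X.presheaf.stalk x) _ (stalkAlgebra f x) t

/-- The exterior derivative at `x`. -/
def stalkExtD (x : X) : StalkForms f x →+ StalkForms f x :=
  @extD R (X.presheaf.stalk x) _ _ (stalkAlgebra f x)

theorem stalkExtD_smul (x : X) (a : X.presheaf.stalk x) (w : StalkForms f x) :
    stalkExtD f x (a • w) = stalkD f x a * w + a • stalkExtD f x w :=
  @extD_smul R (X.presheaf.stalk x) _ _ (stalkAlgebra f x) a w

theorem stalkExtD_list_prod (x : X) (l : List (StalkForms f x))
    (hl : ∀ w ∈ l, (∃ a, w = stalkD f x a) ∨ (∃ t, w = stalkDlog f x t)) :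
    stalkExtD f x l.prod = 0 :=
  @extD_list_prod R (X.presheaf.stalk x) _ _ (stalkAlgebra f x) l (fun w hw => by
    rcases hl w hw with ⟨a, rfl⟩ | ⟨t, rfl⟩
    · exact ⟨@extD_dOne R _ _ _ (stalkAlgebra f x) a, _, rfl⟩
    · exact ⟨@extD_dlog R _ _ _ (stalkAlgebra f x) t, _,
        @dlog_eq_ι R _ _ _ (stalkAlgebra f x) t⟩)

variable {f} in
theorem baseToStalk_comp {S : Type u} [CommRing S] {Y : Scheme.{u}}
    {f' : Y ⟶ Spec (CommRingCat.of S)} {b : R →+* S} {g : Y ⟶ X}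
    (h : g ≫ f = f' ≫ Spec.map (CommRingCat.ofHom b)) (y : Y) (r : R) :
    (g.stalkMap y).hom (baseToStalk f (g y) r) = baseToStalk f' y (b r) := by
  have h1 := congr($(congrArg Scheme.Hom.appTop h).hom
    ((Scheme.ΓSpecIso (CommRingCat.of R)).inv.hom r))
  have h2 := congr(($(Scheme.ΓSpecIso_inv_naturality (CommRingCat.ofHom b))).hom r)
  simp only [Scheme.Hom.comp_appTop, CommRingCat.hom_comp, RingHom.comp_apply,
    CommRingCat.hom_ofHom] at h1 h2
  change (g.stalkMap y).hom ((X.presheaf.germ ⊤ (g y) trivial).hom _) =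
    (Y.presheaf.germ ⊤ y trivial).hom (f'.appTop.hom _)
  rw [h2, ← h1]
  exact Scheme.Hom.germ_stalkMap_apply g ⊤ y trivial _

variable {f} in
/-- Pullback of forms on stalks along a morphism `g : Y ⟶ X` over `Spec S ⟶ Spec R`. -/
def stalkPullback {S : Type u} [CommRing S] {Y : Scheme.{u}} {f' : Y ⟶ Spec (CommRingCat.of S)}
    {b : R →+* S} {g : Y ⟶ X} (h : g ≫ f = f' ≫ Spec.map (CommRingCat.ofHom b)) (y : Y) :
    StalkForms f (g y) →+* StalkForms f' y :=
  @formsMap R _ _ _ (stalkAlgebra f (g y)) S _ _ _ (stalkAlgebra f' y) b (g.stalkMap y).hom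
    (baseToStalk_comp h y)

end stalks

section logForms

/-- The germ of a function at a point. -/
def germAt {X : Scheme.{u}} {V : X.Opens} (x : V) : Γ(X, V) →+* X.presheaf.stalk x.1 :=
  (X.presheaf.germ V x.1 x.2).hom

/-- Restriction of functions. -/
def res {X : Scheme.{u}} {V W : X.Opens} (h : W ≤ V) : Γ(X, V) →+* Γ(X, W) :=
  (X.presheaf.map (homOfLE h).op).hom

theorem germAt_res {X : Scheme.{u}} {V W : X.Opens} (h : W ≤ V) (x : W) (c : Γ(X, V)) :
    germAt x (res h c) = germAt ⟨x.1, h x.2⟩ c :=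
  X.presheaf.germ_res_apply (homOfLE h) x.1 x.2 c

variable {R : Type u} [CommRing R] {X : Scheme.{u}} (f : X ⟶ Spec (CommRingCat.of R))
  {ι : Type*} (D : ι → X.IdealSheafData)

/-- `x` lies on none of the `D i`. -/
def OffDivisor (x : X) : Prop := ∀ i, x ∉ (D i).support

/-- Families of germs of forms at the points of `V` that lie off the divisor. -/
abbrev PreSection (V : X.Opens) : Type u := (x : V) → PLift (OffDivisor D x.1) → StalkForms f x.1

/-- Restriction of families of germs. -/
def preRestrict {V W : X.Opens} (h : W ≤ V) : PreSection f D V →+ PreSection f D W where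
  toFun s x := s ⟨x.1, h x.2⟩
  map_zero' := rfl
  map_add' _ _ := rfl

/-- The family of germs of the form `d b`. -/
def exactForm {V : X.Opens} (b : Γ(X, V)) : PreSection f D V :=
  fun x _ => stalkD f x.1 (germAt x b)

/-- The family of germs of the form `d t / t`. -/
def dlogForm {V : X.Opens} (t : Γ(X, V)) : PreSection f D V :=
  fun x _ => stalkDlog f x.1 (germAt x t)

/-- The generators of the module of logarithmic one-forms on an affine open `W`: the `d b` for
regular functions `b`, and the `d t / t` for local equations `t` of components of the divisor. -/
def IsLogOne (W : X.affineOpens) (s : PreSection f D W.1) : Prop :=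
  (∃ b : Γ(X, W.1), s = exactForm f D b) ∨
  (∃ (i : ι) (t : Γ(X, W.1)), (D i).ideal W = Ideal.span {t} ∧
    s = dlogForm f D t)

/-- The forms `a • γ₁ ∧ ⋯ ∧ γₙ` on `W` with `a` a function and the `γⱼ` generators as above. -/
def logMonomials (n : ℕ) (W : X.affineOpens) : Set (PreSection f D W.1) :=
  {s | ∃ (a : Γ(X, W.1)) (γ : Fin n → PreSection f D W.1), (∀ j, IsLogOne f D W (γ j)) ∧
    s = fun x h => germAt x a • (List.ofFn fun j => γ j x h).prod}

/-- A family of germs of forms off the divisor is a logarithmic `n`-form if locally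
(around every point of `V`, also on the divisor) it is a sum of monomials as above. -/
def IsLogForm (n : ℕ) {V : X.Opens} (s : PreSection f D V) : Prop :=
  ∀ x ∈ V, ∃ (W : X.affineOpens) (_ : x ∈ W.1) (hW : W.1 ≤ V),
    preRestrict f D hW s ∈ AddSubgroup.closure (logMonomials f D n W)

variable {f D}

theorem IsLogOne.restrict {W W' : X.affineOpens} (h : W'.1 ≤ W.1) {s : PreSection f D W.1}
    (hs : IsLogOne f D W s) : IsLogOne f D W' (preRestrict f D h s) := by
  rcases hs with ⟨b, rfl⟩ | ⟨i, t, ht, rfl⟩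
  · refine Or.inl ⟨res h b, ?_⟩
    ext x hx
    change stalkD f _ _ = stalkD f _ _
    congr 1
    exact (germAt_res h x b).symm
  · refine Or.inr ⟨i, res h t, ?_, ?_⟩
    · rw [← (D i).map_ideal h, ht, Ideal.map_span, Set.image_singleton]
      rfl
    · ext x hx
      change stalkDlog f _ _ = stalkDlog f _ _
      congr 1
      exact (germAt_res h x t).symm

theorem closure_restrict {n : ℕ} {W W' : X.affineOpens} (h : W'.1 ≤ W.1)
    {s : PreSection f D W.1} (hs : s ∈ AddSubgroup.closure (logMonomials f D n W)) :
    preRestrict f D h s ∈ AddSubgroup.closure (logMonomials f D n W') := by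
  have : AddSubgroup.closure (logMonomials f D n W) ≤
      (AddSubgroup.closure (logMonomials f D n W')).comap (preRestrict f D h) := by
    rw [AddSubgroup.closure_le]
    rintro _ ⟨a, γ, hγ, rfl⟩
    refine AddSubgroup.subset_closure ⟨res h a,
      fun j => preRestrict f D h (γ j), fun j => (hγ j).restrict h, ?_⟩
    ext x hx
    rw [germAt_res]
    rfl
  exact this hs

theorem exists_affine_le {x : X} {V : X.Opens} (hx : x ∈ V) :
    ∃ W : X.affineOpens, x ∈ W.1 ∧ W.1 ≤ V := by
  obtain ⟨_, ⟨W, hW, rfl⟩, hxW, hWV⟩ :=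
    X.isBasis_affineOpens.exists_subset_of_mem_open hx V.isOpen
  exact ⟨⟨W, hW⟩, hxW, hWV⟩

theorem IsLogForm.restrict {n : ℕ} {V V' : X.Opens} (h : V' ≤ V) {s : PreSection f D V}
    (hs : IsLogForm f D n s) : IsLogForm f D n (preRestrict f D h s) := by
  intro x hx
  obtain ⟨W, hxW, hW, hm⟩ := hs x (h hx)
  obtain ⟨W', hxW', hW'⟩ := exists_affine_le (V := W.1 ⊓ V') ⟨hxW, hx⟩
  exact ⟨W', hxW', hW'.trans inf_le_right, closure_restrict (hW'.trans inf_le_left) hm⟩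

theorem IsLogForm.add {n : ℕ} {V : X.Opens} {s t : PreSection f D V}
    (hs : IsLogForm f D n s) (ht : IsLogForm f D n t) : IsLogForm f D n (s + t) := by
  intro x hx
  obtain ⟨W₁, hx₁, hW₁, h₁⟩ := hs x hx
  obtain ⟨W₂, hx₂, hW₂, h₂⟩ := ht x hx
  obtain ⟨W, hxW, hW⟩ := exists_affine_le (V := W₁.1 ⊓ W₂.1) ⟨hx₁, hx₂⟩
  refine ⟨W, hxW, (hW.trans inf_le_left).trans hW₁, ?_⟩
  rw [map_add]
  exact add_mem (closure_restrict (hW.trans inf_le_left) h₁)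
    (closure_restrict (hW.trans inf_le_right) h₂)

theorem IsLogForm.neg {n : ℕ} {V : X.Opens} {s : PreSection f D V}
    (hs : IsLogForm f D n s) : IsLogForm f D n (-s) := by
  intro x hx
  obtain ⟨W, hxW, hW, h⟩ := hs x hx
  exact ⟨W, hxW, hW, by rw [map_neg]; exact neg_mem h⟩

theorem IsLogForm.zero {n : ℕ} {V : X.Opens} : IsLogForm f D n (0 : PreSection f D V) := by
  intro x hx
  obtain ⟨W, hxW, hW⟩ := exists_affine_le hx
  exact ⟨W, hxW, hW, by rw [map_zero]; exact zero_mem _⟩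

variable (f D) in
/-- `Γ(V, Ωⁿ_X(log D))`. -/
def LogForms (n : ℕ) (V : X.Opens) : AddSubgroup (PreSection f D V) where
  carrier := {s | IsLogForm f D n s}
  zero_mem' := IsLogForm.zero
  add_mem' := IsLogForm.add
  neg_mem' := IsLogForm.neg

variable (f D) in
/-- Multiplication of a family of germs of forms by a function. -/
def preSmul {V : X.Opens} (c : Γ(X, V)) : PreSection f D V →+ PreSection f D V where
  toFun s x h := germAt x c • s x h
  map_zero' := by ext; exact smul_zero _
  map_add' _ _ := by ext; exact smul_add _ _ _

theorem preSmul_apply {V : X.Opens} (c : Γ(X, V)) (s : PreSection f D V) (x : V)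
    (h : PLift (OffDivisor D x.1)) : preSmul f D c s x h = germAt x c • s x h := rfl

theorem IsLogForm.smul {n : ℕ} {V : X.Opens} {s : PreSection f D V}
    (hs : IsLogForm f D n s) (c : Γ(X, V)) : IsLogForm f D n (preSmul f D c s) := by
  intro x hx
  obtain ⟨W, hxW, hW, h⟩ := hs x hx
  refine ⟨W, hxW, hW, ?_⟩
  have key : AddSubgroup.closure (logMonomials f D n W) ≤
      (AddSubgroup.closure (logMonomials f D n W)).comap
        (preSmul f D (res hW c)) := by
    rw [AddSubgroup.closure_le]
    rintro _ ⟨a, γ, hγ, rfl⟩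
    refine AddSubgroup.subset_closure ⟨res hW c * a, γ, hγ, ?_⟩
    ext x hx
    rw [preSmul_apply, map_mul, mul_smul]
  have h2 := key h
  suffices h3 : preRestrict f D hW (preSmul f D c s) =
    preSmul f D (res hW c) (preRestrict f D hW s) by
    rw [h3]; exact h2
  ext x hx
  rw [preSmul_apply, germAt_res]
  rfl

instance (n : ℕ) (V : X.Opens) : Module Γ(X, V) (LogForms f D n V) where
  smul c s := ⟨preSmul f D c s.1, s.2.smul c⟩
  one_smul s := Subtype.ext <| by
    change preSmul f D 1 s.1 = s.1
    ext x h
    rw [preSmul_apply, map_one, one_smul]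
  mul_smul c c' s := Subtype.ext <| by
    change preSmul f D (c * c') s.1 = preSmul f D c (preSmul f D c' s.1)
    ext x h
    rw [preSmul_apply, preSmul_apply, preSmul_apply, map_mul, mul_smul]
  smul_zero c := Subtype.ext (map_zero (preSmul f D c))
  smul_add c s t := Subtype.ext (map_add (preSmul f D c) s.1 t.1)
  add_smul c c' s := Subtype.ext <| by
    change preSmul f D (c + c') s.1 = preSmul f D c s.1 + preSmul f D c' s.1
    ext x h
    rw [Pi.add_apply, Pi.add_apply, preSmul_apply, preSmul_apply, preSmul_apply, map_add, add_smul]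
  zero_smul s := Subtype.ext <| by
    change preSmul f D 0 s.1 = 0
    ext x h
    rw [preSmul_apply, map_zero, zero_smul, Pi.zero_apply, Pi.zero_apply]

theorem LogForms.smul_val {n : ℕ} {V : X.Opens} (c : Γ(X, V)) (s : LogForms f D n V) :
    (c • s).1 = preSmul f D c s.1 := rfl


variable (f D) in
/-- The exterior derivative on families of germs. -/
def preD {V : X.Opens} : PreSection f D V →+ PreSection f D V where
  toFun s x h := stalkExtD f x.1 (s x h)
  map_zero' := by ext x h; exact map_zero (stalkExtD f x.1)
  map_add' s t := by ext x h; exact map_add (stalkExtD f x.1) _ _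

theorem preD_apply {V : X.Opens} (s : PreSection f D V) (x : V)
    (h : PLift (OffDivisor D x.1)) : preD f D s x h = stalkExtD f x.1 (s x h) := rfl

theorem IsLogOne.cases {W : X.affineOpens} {γ : PreSection f D W.1} (hγ : IsLogOne f D W γ)
    (x : W.1) (h : PLift (OffDivisor D x.1)) :
    (∃ a, γ x h = stalkD f x.1 a) ∨ (∃ t, γ x h = stalkDlog f x.1 t) := by
  rcases hγ with ⟨b, rfl⟩ | ⟨i, t, -, rfl⟩
  · exact Or.inl ⟨_, rfl⟩
  · exact Or.inr ⟨_, rfl⟩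

/-- `d (a γ₁ ∧ ⋯ ∧ γₙ) = da ∧ γ₁ ∧ ⋯ ∧ γₙ`, as the generators `γⱼ` are closed. -/
theorem preD_monomial {n : ℕ} {W : X.affineOpens} (a : Γ(X, W.1))
    {γ : Fin n → PreSection f D W.1} (hγ : ∀ j, IsLogOne f D W (γ j)) :
    preD f D (fun x h => germAt x a • (List.ofFn fun j => γ j x h).prod) =
      fun x h => stalkD f x.1 (germAt x a) * (List.ofFn fun j => γ j x h).prod := by
  ext x h
  rw [preD_apply, stalkExtD_smul, stalkExtD_list_prod, smul_zero, add_zero]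
  intro w hw
  obtain ⟨j, rfl⟩ := (List.mem_ofFn' _ _).mp hw
  exact (hγ j).cases x h

theorem IsLogForm.preD {n : ℕ} {V : X.Opens} {s : PreSection f D V}
    (hs : IsLogForm f D n s) : IsLogForm f D (n + 1) (preD f D s) := by
  intro x hx
  obtain ⟨W, hxW, hW, h⟩ := hs x hx
  refine ⟨W, hxW, hW, ?_⟩
  have key : AddSubgroup.closure (logMonomials f D n W) ≤
      (AddSubgroup.closure (logMonomials f D (n + 1) W)).comap (LogDR.preD f D) := by
    rw [AddSubgroup.closure_le]
    rintro _ ⟨a, γ, hγ, rfl⟩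
    refine AddSubgroup.subset_closure ⟨1, Fin.cons (exactForm f D a) γ, ?_, ?_⟩
    · intro j
      refine Fin.cases ?_ (fun j => ?_) j
      · exact Or.inl ⟨a, rfl⟩
      · exact hγ j
    · rw [preD_monomial a hγ]
      ext x h
      rw [map_one, one_smul, List.ofFn_succ, List.prod_cons]
      rfl
  exact key h

theorem preD_preD {n : ℕ} {V : X.Opens} {s : PreSection f D V}
    (hs : IsLogForm f D n s) : preD f D (preD f D s) = 0 := by
  ext x hx
  obtain ⟨W, hxW, hW, h⟩ := hs x.1 x.2
  have key : AddSubgroup.closure (logMonomials f D n W) ≤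
      ((preD f D).comp (preD f D)).ker := by
    rw [AddSubgroup.closure_le]
    rintro _ ⟨a, γ, hγ, rfl⟩
    change preD f D (preD f D _) = 0
    rw [preD_monomial a hγ]
    ext x h
    have h1 : stalkD f x.1 (germAt x a) * (List.ofFn fun j => γ j x h).prod =
        (stalkD f x.1 (germAt x a) :: List.ofFn fun j => γ j x h).prod := by
      rw [List.prod_cons]
    rw [preD_apply, h1, stalkExtD_list_prod]
    · rfl
    intro w hw
    rcases List.mem_cons.mp hw with rfl | hw
    · exact Or.inl ⟨_, rfl⟩
    obtain ⟨j, rfl⟩ := (List.mem_ofFn' _ _).mp hw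
    exact (hγ j).cases x h
  exact congrFun (congrFun (key h) ⟨x.1, hxW⟩) hx

variable (f D) in
/-- The exterior derivative `Γ(V, Ωⁿ_X(log D)) → Γ(V, Ωⁿ⁺¹_X(log D))`. -/
def logD (n : ℕ) (V : X.Opens) : LogForms f D n V →+ LogForms f D (n + 1) V :=
  ((preD f D).comp (LogForms f D n V).subtype).codRestrict _ fun s => s.2.preD

variable (f D) in
/-- Restriction of logarithmic forms. -/
def logRes (n : ℕ) {V W : X.Opens} (h : W ≤ V) : LogForms f D n V →+ LogForms f D n W :=
  ((preRestrict f D h).comp (LogForms f D n V).subtype).codRestrict _ fun s => s.2.restrict h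

theorem logRes_smul {n : ℕ} {V W : X.Opens} (h : W ≤ V) (c : Γ(X, V)) (s : LogForms f D n V) :
    logRes f D n h (c • s) = res h c • logRes f D n h s := by
  apply Subtype.ext
  ext x hx
  rw [LogForms.smul_val, preSmul_apply, germAt_res]
  rfl

variable (f D) in
/-- The abelian presheaf underlying `Ωⁿ_X(log D)`. -/
def logPresheaf (n : ℕ) : TopCat.Presheaf Ab.{u} X where
  obj V := AddCommGrpCat.of (LogForms f D n V.unop)
  map i := AddCommGrpCat.ofHom (logRes f D n i.unop.le)

variable (f D) in
/-- The local predicate that cuts out `Ωⁿ_X(log D)`. -/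
def logPredicate (n : ℕ) :
    TopCat.LocalPredicate (X := X.toTopCat)
      (fun x : X => PLift (OffDivisor D x) → StalkForms f x) where
  pred {V} s := IsLogForm f D n (V := V) s
  res i s hs := IsLogForm.restrict (leOfHom i) hs
  locality {V} s hs := by
    intro x hx
    obtain ⟨V', hxV', i, h⟩ := hs ⟨x, hx⟩
    obtain ⟨W, hxW, hW, hm⟩ := h x hxV'
    exact ⟨W, hxW, hW.trans (leOfHom i), hm⟩

theorem logPresheaf_isSheaf (n : ℕ) : (logPresheaf f D n).IsSheaf := by
  rw [TopCat.Presheaf.isSheaf_iff_isSheaf_comp (forget Ab)]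
  exact TopCat.subpresheafToTypes.isSheaf (logPredicate f D n)

variable (f D) in
/-- The sheaf of `𝒪_X`-modules `Ωⁿ_X(log D)`. -/
def logSheaf (n : ℕ) : X.Modules where
  val :=
    letI (V : (TopologicalSpace.Opens X)ᵒᵖ) :
      Module (X.ringCatSheaf.obj.obj V) ((logPresheaf f D n).obj V) :=
        inferInstanceAs (Module Γ(X, V.unop) (LogForms f D n V.unop))
    .ofPresheaf (logPresheaf f D n) fun _ _ i r m => logRes_smul i.unop.le r m
  isSheaf := logPresheaf_isSheaf n

theorem IsLogForm.mul {m n : ℕ} {V : X.Opens} {s t : PreSection f D V}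
    (hs : IsLogForm f D m s) (ht : IsLogForm f D n t) :
    IsLogForm f D (m + n) (fun x h => s x h * t x h : PreSection f D V) := by
  intro x hx
  obtain ⟨W₁, hx₁, hW₁, h₁⟩ := hs x hx
  obtain ⟨W₂, hx₂, hW₂, h₂⟩ := ht x hx
  obtain ⟨W, hxW, hW⟩ := exists_affine_le (V := W₁.1 ⊓ W₂.1) ⟨hx₁, hx₂⟩
  refine ⟨W, hxW, (hW.trans inf_le_left).trans hW₁, ?_⟩
  have h₁' := closure_restrict (hW.trans inf_le_left) h₁
  have h₂' := closure_restrict (hW.trans inf_le_right) h₂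
  have key : ∀ u ∈ AddSubgroup.closure (logMonomials f D m W),
      ∀ v ∈ AddSubgroup.closure (logMonomials f D n W),
      (u * v : PreSection f D W.1) ∈ AddSubgroup.closure (logMonomials f D (m + n) W) := by
    intro u hu v hv
    induction hu using AddSubgroup.closure_induction with
    | zero => rw [zero_mul]; exact zero_mem _
    | add u u' _ _ h h' => rw [add_mul]; exact add_mem h h'
    | neg u _ h => rw [neg_mul]; exact neg_mem h
    | mem u hu =>
      induction hv using AddSubgroup.closure_induction with
      | zero => rw [mul_zero]; exact zero_mem _
      | add v v' _ _ h h' => rw [mul_add]; exact add_mem h h'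
      | neg v _ h => rw [mul_neg]; exact neg_mem h
      | mem v hv =>
        obtain ⟨a, γ, hγ, rfl⟩ := hu
        obtain ⟨b, δ, hδ, rfl⟩ := hv
        refine AddSubgroup.subset_closure ⟨a * b, Fin.append γ δ, ?_, ?_⟩
        · intro j
          refine Fin.addCases (fun i => ?_) (fun i => ?_) j
          · rw [Fin.append_left]; exact hγ i
          · rw [Fin.append_right]; exact hδ i
        · ext x h
          have h3 : (List.ofFn fun j => Fin.append γ δ j x h) =
              (List.ofFn fun j => γ j x h) ++ List.ofFn fun j => δ j x h := by
            rw [← List.ofFn_fin_append]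
            congr 1
            ext j
            refine Fin.addCases (fun i => ?_) (fun i => ?_) j
            · rw [Fin.append_left, Fin.append_left]
            · rw [Fin.append_right, Fin.append_right]
          rw [h3, List.prod_append, map_mul, mul_smul]
          rw [Pi.mul_apply, Pi.mul_apply, smul_mul_assoc, mul_smul_comm]
  exact key _ h₁' _ h₂'

/-- The wedge product of logarithmic forms. -/
def LogForms.wedge {m n : ℕ} {V : X.Opens} (s : LogForms f D m V) (t : LogForms f D n V) :
    LogForms f D (m + n) V := ⟨_, s.2.mul t.2⟩

variable (f D) in
/-- A regular function, as a logarithmic form of degree zero. -/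
def functionForm {V : X.Opens} (c : Γ(X, V)) : LogForms f D 0 V :=
  ⟨fun x _ => algebraMap _ _ (germAt x c), by
    intro x hx
    obtain ⟨W, hxW, hW⟩ := exists_affine_le hx
    refine ⟨W, hxW, hW, AddSubgroup.subset_closure ⟨res hW c, Fin.elim0, fun j => j.elim0, ?_⟩⟩
    ext x h
    rw [germAt_res, List.ofFn_zero, List.prod_nil, Algebra.smul_def, mul_one]
    rfl⟩

theorem logD_smul_of_stalkD_eq_zero {n : ℕ} {V : X.Opens} (c : Γ(X, V))
    (hc : ∀ x : V, stalkD f x.1 (germAt x c) = 0) (s : LogForms f D n V) :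
    logD f D n V (c • s) = c • logD f D n V s := by
  apply Subtype.ext
  ext x h
  refine (stalkExtD_smul f x.1 _ _).trans ?_
  rw [hc, zero_mul, zero_add]
  rfl

end logForms

section complexes

variable {R : Type u} [CommRing R] {X : Scheme.{u}} (f : X ⟶ Spec (CommRingCat.of R))
  {ι : Type*} (D : ι → X.IdealSheafData)

/-- The complex `⨁ᵢ Ωⁱ_X(log D)[-i]` of `𝒪_X`-modules: the term in degree `i` is `Ωⁱ_X(log D)`,
and all differentials are zero. -/
def hodgeComplex : CochainComplex X.Modules ℕ where
  X n := logSheaf f D n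
  d _ _ := 0

variable {f D}

/-- The exterior derivative as a morphism `F_* Ωⁿ_X(log D) ⟶ F_* Ωⁿ⁺¹_X(log D)` of
`𝒪_{X'}`-modules, for a morphism `F : X ⟶ X'` such that `d` kills all functions coming
from `X'`. -/
def pushforwardD {X' : Scheme.{u}} (F : X ⟶ X')
    (hF : ∀ (V : X'.Opens) (c : Γ(X', V)) (x : ↥(F ⁻¹ᵁ V)),
      stalkD f x.1 (germAt x ((F.app V).hom c)) = 0) (n : ℕ) :
    (Scheme.Modules.pushforward F).obj (logSheaf f D n) ⟶
      (Scheme.Modules.pushforward F).obj (logSheaf f D (n + 1)) where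
  val := PresheafOfModules.homMk
    { app := fun V => AddCommGrpCat.ofHom (logD f D n (F ⁻¹ᵁ V.unop))
      naturality := fun _ _ _ => rfl }
    (fun V c s => logD_smul_of_stalkD_eq_zero (V := F ⁻¹ᵁ V.unop) _ (hF V.unop c) s)

/-- The complex `F_* Ω^•_X(log D)` of `𝒪_{X'}`-modules. -/
def pushforwardComplex {X' : Scheme.{u}} (F : X ⟶ X')
    (hF : ∀ (V : X'.Opens) (c : Γ(X', V)) (x : ↥(F ⁻¹ᵁ V)),
      stalkD f x.1 (germAt x ((F.app V).hom c)) = 0) : CochainComplex X'.Modules ℕ :=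
  CochainComplex.of (fun n => (Scheme.Modules.pushforward F).obj (logSheaf f D n))
    (pushforwardD F hF) (fun n => by
      ext V s
      exact Subtype.ext (preD_preD (s : LogForms f D n _).2))

end complexes

section frobenius

/-- The `p`-th power map of a commutative ring of characteristic `p` (possibly zero). -/
def powHom (p : ℕ) [hp : Fact p.Prime] (A : Type*) [CommRing A] (h : (p : A) = 0) : A →+* A where
  toFun a := a ^ p
  map_one' := one_pow p
  map_mul' a b := mul_pow a b p
  map_zero' := zero_pow hp.out.ne_zero
  map_add' a b := by
    obtain ⟨r, hr⟩ := exists_add_pow_prime_eq hp.out a b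
    rw [hr, h]; ring

theorem natCast_eq_zero_of_top {p : ℕ} {X : Scheme.{u}} (h : (p : Γ(X, ⊤)) = 0) (V : X.Opens) :
    (p : Γ(X, V)) = 0 := by
  rw [← map_natCast (res (le_top : V ≤ ⊤)) p, h, map_zero]

/-- The absolute Frobenius morphism of a scheme of characteristic `p`: the identity on the
underlying space and the `p`-th power map on functions. -/
def absFrobenius (p : ℕ) [Fact p.Prime] (X : Scheme.{u}) (h : (p : Γ(X, ⊤)) = 0) : X ⟶ X where
  base := 𝟙 _
  c :=
    { app := fun V => CommRingCat.ofHom (powHom p Γ(X, V.unop) (natCast_eq_zero_of_top h V.unop))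
      naturality := fun V W i => by
        ext a
        exact (map_pow (X.presheaf.map i).hom a p).symm }
  prop x := by
    constructor
    intro s hs
    obtain ⟨U, hxU, a, rfl⟩ := TopCat.Presheaf.exists_germ_eq (x := x) X.presheaf s
    erw [PresheafedSpace.stalkMap_germ_apply] at hs
    have h2 : IsUnit ((X.presheaf.germ U x hxU).hom (a ^ p)) := hs
    rw [map_pow] at h2
    exact (isUnit_pow_iff (Fact.out : p.Prime).ne_zero).mp h2

theorem natCast_eq_zero_of_over (p : ℕ) {k : Type u} [Field k] [CharP k p] {X : Scheme.{u}}
    (f : X ⟶ Spec (CommRingCat.of k)) : (p : Γ(X, ⊤)) = 0 := by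
  rw [← map_natCast (f.appTop.hom.comp (Scheme.ΓSpecIso (CommRingCat.of k)).inv.hom) p]
  rw [show ((p : ℕ) : (CommRingCat.of k)) = 0 from CharP.cast_eq_zero k p, map_zero]

/-- The base change of `X → Spec R` along an endomorphism `φ` of `R`. -/
abbrev twist {R : Type u} [CommRing R] (φ : R →+* R) {X : Scheme.{u}}
    (f : X ⟶ Spec (CommRingCat.of R)) : Scheme.{u} :=
  pullback f (Spec.map (CommRingCat.ofHom φ))

/-- The structure morphism of the twist. -/
abbrev twistStr {R : Type u} [CommRing R] (φ : R →+* R) {X : Scheme.{u}}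
    (f : X ⟶ Spec (CommRingCat.of R)) : twist φ f ⟶ Spec (CommRingCat.of R) :=
  pullback.snd f (Spec.map (CommRingCat.ofHom φ))

/-- The inverse image of a family of closed subschemes in the twist. -/
abbrev twistDiv {R : Type u} [CommRing R] (φ : R →+* R) {X : Scheme.{u}}
    (f : X ⟶ Spec (CommRingCat.of R)) {ι : Type*} (D : ι → X.IdealSheafData) :
    ι → (twist φ f).IdealSheafData :=
  fun i => (D i).comap (pullback.fst f (Spec.map (CommRingCat.ofHom φ)))

variable (p : ℕ) [Fact p.Prime] {k : Type u} [Field k] [CharP k p] {X : Scheme.{u}}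
  (f : X ⟶ Spec (CommRingCat.of k))

theorem absFrobenius_comp :
    absFrobenius p X (natCast_eq_zero_of_over p f) ≫ f =
      f ≫ Spec.map (CommRingCat.ofHom (frobenius k p)) := by
  apply ext_of_isAffine
  ext s
  obtain ⟨r, rfl⟩ := (ConcreteCategory.bijective_of_isIso
    (Scheme.ΓSpecIso (CommRingCat.of k)).inv).surjective s
  have h2 := congr(($(Scheme.ΓSpecIso_inv_naturality
    (CommRingCat.ofHom (frobenius k p)))).hom r)
  simp only [CommRingCat.hom_comp, RingHom.comp_apply, CommRingCat.hom_ofHom] at h2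
  simp only [Scheme.Hom.comp_appTop, CommRingCat.hom_comp, RingHom.comp_apply]
  refine Eq.trans ?_ (congrArg f.appTop.hom h2)
  rw [frobenius_def, map_pow, map_pow]
  rfl

/-- The relative Frobenius morphism `X ⟶ X'`. -/
def relFrobenius : X ⟶ twist (frobenius k p) f :=
  pullback.lift (absFrobenius p X (natCast_eq_zero_of_over p f)) f (absFrobenius_comp p f)

theorem exists_pow_of_factor {X' : Scheme.{u}} (h : (p : Γ(X, ⊤)) = 0) (e : X ⟶ X') (F : X ⟶ X')
    (hF : F = absFrobenius p X h ≫ e) (V : X'.Opens) (c : Γ(X', V)) :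
    ∃ a : Γ(X, F ⁻¹ᵁ V), (F.app V).hom c = a ^ p := by
  subst hF
  exact ⟨(e.app V).hom c, rfl⟩

theorem relFrobenius_closed [PerfectRing k p] (V : (twist (frobenius k p) f).Opens)
    (c : Γ(twist (frobenius k p) f, V)) (x : ↥(relFrobenius p f ⁻¹ᵁ V)) :
    stalkD f x.1 (germAt x (((relFrobenius p f).app V).hom c)) = 0 := by
  have : IsIso (CommRingCat.ofHom (frobenius k p)) :=
    (RingEquiv.toCommRingCatIso (frobeniusEquiv k p)).isIso_hom
  let pr := pullback.fst f (Spec.map (CommRingCat.ofHom (frobenius k p)))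
  obtain ⟨a, ha⟩ := exists_pow_of_factor p (natCast_eq_zero_of_over p f) (inv pr)
    (relFrobenius p f) (by rw [IsIso.eq_comp_inv]; exact pullback.lift_fst _ _ _) V c
  rw [ha, map_pow]
  refine @dOne_pow_char k _ _ _ (stalkAlgebra f x.1) p ?_ _
  rw [← map_natCast (germAt x), natCast_eq_zero_of_top (natCast_eq_zero_of_over p f), map_zero]

end frobenius

section witt

variable (p : ℕ) [Fact p.Prime] (k : Type u) [Field k] [CharP k p]

/-- The ring `W₂(k)` of Witt vectors of length two. -/
abbrev W2 : Type u := TruncatedWittVector p 2 k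

/-- The projection `W₂(k) → k`, `(a₀, a₁) ↦ a₀`. -/
def w2Proj : W2 p k →+* k where
  toFun x := x.coeff 0
  map_one' := by
    rw [← map_one (WittVector.truncate (p := p) 2), WittVector.coeff_truncate]
    exact WittVector.one_coeff_zero p k
  map_zero' := TruncatedWittVector.coeff_zero p 2 k 0
  map_add' x y := by
    obtain ⟨a, rfl⟩ := WittVector.truncate_surjective p 2 k x
    obtain ⟨b, rfl⟩ := WittVector.truncate_surjective p 2 k y
    rw [← map_add, WittVector.coeff_truncate, WittVector.coeff_truncate, WittVector.coeff_truncate]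
    exact map_add WittVector.constantCoeff a b
  map_mul' x y := by
    obtain ⟨a, rfl⟩ := WittVector.truncate_surjective p 2 k x
    obtain ⟨b, rfl⟩ := WittVector.truncate_surjective p 2 k y
    rw [← map_mul, WittVector.coeff_truncate, WittVector.coeff_truncate, WittVector.coeff_truncate]
    exact map_mul WittVector.constantCoeff a b

theorem w2_pow_truncate (a : WittVector p k) :
    (TruncatedWittVector.mk p fun i => ((WittVector.truncate 2 a).coeff i) ^ p : W2 p k) =
      WittVector.truncate 2 (WittVector.map (frobenius k p) a) := by
  ext i
  rw [TruncatedWittVector.coeff_mk, WittVector.coeff_truncate, WittVector.coeff_truncate,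
    WittVector.map_coeff, frobenius_def]

/-- The Frobenius endomorphism `(a₀, a₁) ↦ (a₀ᵖ, a₁ᵖ)` of `W₂(k)`. -/
def w2Frob : W2 p k →+* W2 p k where
  toFun x := TruncatedWittVector.mk p fun i => x.coeff i ^ p
  map_one' := by
    rw [← map_one (WittVector.truncate (p := p) 2), w2_pow_truncate, map_one]
  map_zero' := by
    rw [← map_zero (WittVector.truncate (p := p) 2), w2_pow_truncate, map_zero]
  map_add' x y := by
    obtain ⟨a, rfl⟩ := WittVector.truncate_surjective p 2 k x
    obtain ⟨b, rfl⟩ := WittVector.truncate_surjective p 2 k y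
    rw [← map_add, w2_pow_truncate, w2_pow_truncate, w2_pow_truncate, map_add, map_add]
  map_mul' x y := by
    obtain ⟨a, rfl⟩ := WittVector.truncate_surjective p 2 k x
    obtain ⟨b, rfl⟩ := WittVector.truncate_surjective p 2 k y
    rw [← map_mul, w2_pow_truncate, w2_pow_truncate, w2_pow_truncate, map_mul, map_mul]

theorem w2Proj_comp_w2Frob :
    (w2Proj p k).comp (w2Frob p k) = (frobenius k p).comp (w2Proj p k) := by
  ext x
  exact TruncatedWittVector.coeff_mk (p := p) (fun i => x.coeff i ^ p) 0

end witt

section snc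

variable {R : Type u} [CommRing R] {X : Scheme.{u}} (f : X ⟶ Spec (CommRingCat.of R))
  {ι : Type*} (D : ι → X.IdealSheafData)

/-- The structure homomorphism `R → Γ(V, 𝒪_X)` of a scheme over `Spec R`. -/
def baseToSections (V : X.Opens) : R →+* Γ(X, V) :=
  (res (le_top : V ≤ ⊤)).comp
    (f.appTop.hom.comp (Scheme.ΓSpecIso (CommRingCat.of R)).inv.hom)

/-- `∑ᵢ Dᵢ` is a (relative) simple normal crossing divisor with components `Dᵢ`: locally `X` is
étale over an affine space, via coordinates `t₁, …, tₙ`, such that those `Dᵢ` that are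
not empty are the zero loci of pairwise different coordinates. -/
def IsSNC : Prop :=
  ∀ x : X, ∃ (W : X.affineOpens) (_ : x ∈ W.1) (n : ℕ) (t : Fin n → Γ(X, W.1))
    (s : Set ι) (e : s ↪ Fin n),
    (MvPolynomial.eval₂Hom (baseToSections f W.1) t).Etale ∧
    (∀ i : s, (D i.1).ideal W = Ideal.span {t (e i)}) ∧
    (∀ i ∉ s, (D i).ideal W = ⊤)

end snc

section pullback

variable {R S : Type u} [CommRing R] [CommRing S] {X Y : Scheme.{u}}
  {f : X ⟶ Spec (CommRingCat.of R)} {f' : Y ⟶ Spec (CommRingCat.of S)} {b : R →+* S} {g : Y ⟶ X}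
  {ι κ : Type*} {D : ι → X.IdealSheafData} {E : κ → Y.IdealSheafData}

/-- `η = g^* ω` on `W`, for logarithmic forms `ω` on `V ⊆ X` and `η` on `W ⊆ g⁻¹ V`, where
`g : Y ⟶ X` lies over `Spec S ⟶ Spec R` and maps the complement of the divisor on `Y` into the
complement of the divisor on `X`. -/
def IsPullbackForm (h : g ≫ f = f' ≫ Spec.map (CommRingCat.ofHom b))
    (hoff : ∀ y, OffDivisor E y → OffDivisor D (g y)) {n : ℕ} {V : X.Opens} {W : Y.Opens}
    (hW : W ≤ g ⁻¹ᵁ V) (ω : LogForms f D n V) (η : LogForms f' E n W) : Prop :=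
  ∀ (y : W) (hy : OffDivisor E y.1),
    η.1 y ⟨hy⟩ = stalkPullback h y.1 (ω.1 ⟨g y.1, hW y.2⟩ ⟨hoff y.1 hy⟩)

theorem offDivisor_comap (y : Y) :
    OffDivisor (fun i => (D i).comap g) y ↔ OffDivisor D (g y) := by
  refine forall_congr' fun i => not_congr ?_
  rw [Scheme.IdealSheafData.support_comap]
  rfl

theorem offDivisor_iff_prod [Fintype ι] (x : X) :
    OffDivisor D x ↔ x ∉ (∏ i, D i).support := by
  have key : ∀ s : Finset ι, x ∈ (∏ i ∈ s, D i).support ↔ ∃ i ∈ s, x ∈ (D i).support := by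
    classical
    intro s
    induction s using Finset.induction_on with
    | empty =>
      rw [Finset.prod_empty]
      refine iff_of_false ?_ (by simp)
      change x ∉ (⊤ : X.IdealSheafData).support
      rw [Scheme.IdealSheafData.support_top]
      exact fun h => h
    | insert a s ha ih =>
      rw [Finset.prod_insert ha, Scheme.IdealSheafData.support_mul]
      simp only [Finset.exists_mem_insert, ← ih]
      rfl
  rw [key]
  simp [OffDivisor]

end pullback

section lifting

variable (p : ℕ) [Fact p.Prime] {k : Type u} [Field k] [CharP k p]
  {X : Scheme.{u}} (f : X ⟶ Spec (CommRingCat.of k)) {ι : Type*} (D : ι → X.IdealSheafData)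

/-- A lifting of `(X, ∑ᵢ Dᵢ)` over `W₂(k)`. -/
structure LogLifting where
  /-- the scheme `X̃` -/
  space : Scheme.{u}
  /-- the structure morphism of `X̃` -/
  str : space ⟶ Spec (CommRingCat.of (W2 p k))
  /-- the closed subschemes `D̃ᵢ` of `X̃` -/
  div : ι → space.IdealSheafData
  /-- the closed immersion of `X` into `X̃` -/
  incl : X ⟶ space
  isPullback : IsPullback incl f str (Spec.map (CommRingCat.ofHom (w2Proj p k)))
  flat : Flat str
  flat_div : ∀ i, Flat ((div i).subschemeι ≫ str)
  comap_div : ∀ i, (div i).comap incl = D i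

variable {p f D}

namespace LogLifting

variable (L : LogLifting p f D)

/-- The inclusion of `X'` into `X̃'`. -/
def inclTwist : twist (frobenius k p) f ⟶ twist (w2Frob p k) L.str :=
  pullback.map _ _ _ _ L.incl (Spec.map (CommRingCat.ofHom (w2Proj p k)))
    (Spec.map (CommRingCat.ofHom (w2Proj p k))) L.isPullback.w.symm (by
      rw [← Spec.map_comp, ← Spec.map_comp, ← CommRingCat.ofHom_comp, ← CommRingCat.ofHom_comp,
        w2Proj_comp_w2Frob])

theorem inclTwist_comp : L.inclTwist ≫ twistStr (w2Frob p k) L.str =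
    twistStr (frobenius k p) f ≫ Spec.map (CommRingCat.ofHom (w2Proj p k)) :=
  pullback.lift_snd _ _ _

theorem inclTwist_fst : L.inclTwist ≫ pullback.fst _ _ = pullback.fst _ _ ≫ L.incl :=
  pullback.lift_fst _ _ _

set_option linter.unusedSectionVars false in
theorem offDivisor_incl (x : X) : OffDivisor D x → OffDivisor L.div (L.incl x) := by
  rw [← offDivisor_comap, funext L.comap_div]
  exact id

theorem offDivisor_inclTwist (x : twist (frobenius k p) f) :
    OffDivisor (twistDiv (frobenius k p) f D) x →
      OffDivisor (twistDiv (w2Frob p k) L.str L.div) (L.inclTwist x) := by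
  have : twistDiv (frobenius k p) f D =
      fun i => (twistDiv (w2Frob p k) L.str L.div i).comap L.inclTwist := by
    funext i
    rw [← Scheme.IdealSheafData.comap_comp, inclTwist_fst, Scheme.IdealSheafData.comap_comp,
      L.comap_div]
  rw [this, offDivisor_comap]
  exact id

end LogLifting

/-- A lifting of the relative Frobenius morphism `F : X ⟶ X'` that is compatible with `D̃`, i.e.
`F̃^* 𝒪(-D̃') = 𝒪(-p D̃)` where `D̃ = ∑ᵢ D̃ᵢ`. -/
structure FrobeniusLifting [Fintype ι] (L : LogLifting p f D) where
  /-- the morphism `F̃ : X̃ ⟶ X̃'` -/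
  hom : L.space ⟶ twist (w2Frob p k) L.str
  hom_comp : hom ≫ twistStr (w2Frob p k) L.str = L.str
  incl_hom : L.incl ≫ hom = relFrobenius p f ≫ L.inclTwist
  compatible : (∏ i, twistDiv (w2Frob p k) L.str L.div i).comap hom = (∏ i, L.div i) ^ p

namespace FrobeniusLifting

variable [Fintype ι] {L : LogLifting p f D} (Φ : FrobeniusLifting L)

theorem hom_over : Φ.hom ≫ twistStr (w2Frob p k) L.str =
    L.str ≫ Spec.map (CommRingCat.ofHom (RingHom.id (W2 p k))) := by
  rw [CommRingCat.ofHom_id, Spec.map_id, Category.comp_id, Φ.hom_comp]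

theorem offDivisor (x : L.space) : OffDivisor L.div x →
    OffDivisor (twistDiv (w2Frob p k) L.str L.div) (Φ.hom x) := by
  rw [offDivisor_iff_prod, offDivisor_iff_prod]
  intro h h'
  apply h
  have h2 : x ∈ ((∏ i, twistDiv (w2Frob p k) L.str L.div i).comap Φ.hom).support := by
    rw [Scheme.IdealSheafData.support_comap]
    exact h'
  rw [Φ.compatible, Scheme.IdealSheafData.support_pow _ _ (Fact.out : p.Prime).ne_zero] at h2
  exact h2

theorem preimage_le {V : (twist (w2Frob p k) L.str).Opens} {W : L.space.Opens}
    (hW : W ≤ Φ.hom ⁻¹ᵁ V) : L.incl ⁻¹ᵁ W ≤ relFrobenius p f ⁻¹ᵁ (L.inclTwist ⁻¹ᵁ V) := by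
  intro x hx
  change (relFrobenius p f ≫ L.inclTwist) x ∈ V
  rw [← Φ.incl_hom]
  exact hW hx

end FrobeniusLifting

variable [PerfectRing k p]

variable (p f D) in
/-- `⨁ᵢ Ωⁱ_{X'}(log D')[-i]`. -/
abbrev sourceComplex : CochainComplex (twist (frobenius k p) f).Modules ℕ :=
  hodgeComplex (twistStr (frobenius k p) f) (twistDiv (frobenius k p) f D)

variable (p f D) in
/-- `F_* Ω^•_X(log D)`. -/
abbrev targetComplex : CochainComplex (twist (frobenius k p) f).Modules ℕ :=
  pushforwardComplex (f := f) (D := D) (relFrobenius p f) (relFrobenius_closed p f)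

/-- The component `φⁿ : Γ(V, Ωⁿ_{X'}(log D')) → Γ(F⁻¹ V, Ωⁿ_X(log D))`. -/
def component (φ : sourceComplex p f D ⟶ targetComplex p f D) (n : ℕ)
    (V : (twist (frobenius k p) f).Opens)
    (ω : LogForms (twistStr (frobenius k p) f) (twistDiv (frobenius k p) f D) n V) :
    LogForms f D n (relFrobenius p f ⁻¹ᵁ V) :=
  ((φ.f n).app V).hom ω

/-- `φ` is the morphism of complexes given by the Frobenius homomorphism in degree zero, by
`p⁻¹ F̃^*` in degree one, and by the exterior powers of `p⁻¹ F̃^*` in higher degrees. -/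
structure IsDivFrobenius [Fintype ι] {L : LogLifting p f D} (Φ : FrobeniusLifting L)
    (φ : sourceComplex p f D ⟶ targetComplex p f D) : Prop where
  degree_zero : ∀ (V : (twist (frobenius k p) f).Opens) (c : Γ(twist (frobenius k p) f, V)),
    component φ 0 V (functionForm _ _ c) =
      functionForm f D (((relFrobenius p f).app V).hom c)
  /-- If `ω` is the reduction of `ω̃`, and `η̃` lifts `φ¹ ω`, then `p η̃ = F̃^* ω̃`. -/
  degree_one : ∀ (V : (twist (w2Frob p k) L.str).Opens)
    (ω' : LogForms (twistStr (w2Frob p k) L.str) (twistDiv (w2Frob p k) L.str L.div) 1 V)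
    (ω : LogForms (twistStr (frobenius k p) f) (twistDiv (frobenius k p) f D) 1
      (L.inclTwist ⁻¹ᵁ V)),
    IsPullbackForm L.inclTwist_comp L.offDivisor_inclTwist le_rfl ω' ω →
    ∀ (W : L.space.Opens) (hW : W ≤ Φ.hom ⁻¹ᵁ V) (η' : LogForms L.str L.div 1 W),
    IsPullbackForm L.isPullback.w L.offDivisor_incl le_rfl η'
      (logRes f D 1 (Φ.preimage_le hW) (component φ 1 _ ω)) →
    IsPullbackForm Φ.hom_over Φ.offDivisor hW ω' ((p : ℤ) • η')
  wedge : ∀ (V : (twist (frobenius k p) f).Opens) (m n : ℕ)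
    (α : LogForms (twistStr (frobenius k p) f) (twistDiv (frobenius k p) f D) m V)
    (β : LogForms (twistStr (frobenius k p) f) (twistDiv (frobenius k p) f D) n V),
    component φ (m + n) V (LogForms.wedge α β) =
      LogForms.wedge (component φ m V α) (component φ n V β)

end lifting

end LogDR

end

/-!
The projection `X' ⟶ X` is an isomorphism of schemes, since `k` is perfect; its inverse is
`toTwist`, and the relative Frobenius is the absolute Frobenius, the identity on points, followed by
`toTwist`. So the lifting of the relative Frobenius amounts to an endomorphism of the structure
sheaf of the lifted scheme that reduces to `a ↦ a ^ p`, as captured by `IsFrobLift`.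

*The divided Frobenius.* Let `Ψ` be such an endomorphism of `T`, with reduction `A`, and write
`Ψ ã = ã ^ p + p ũ` for a lift `ã` of `a ∈ A`. Flatness makes the class of `du` depend on `a` only,
and `a ↦ a ^ (p - 1) da + du` is a derivation semilinear along the Frobenius endomorphism of `A`
(`IsFrobLift.divD`); additivity comes from the carry polynomial `((x + y) ^ p - x ^ p - y ^ p) / p`,
and the derivation kills `k` since `k` is perfect. Its values are closed, so it extends to a ring
endomorphism `IsFrobLift.divFrob` of `⋀ Ω` with closed values, which is `p⁻¹ Ψ^*` in degree one
(`IsFrobLift.exists_divided`). Using it on stalks defines `φ` in all degrees at once, compatibly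
with products and with the differentials.

*Logarithmic poles.* Compatibility with the divisor says that the product of the `Ψ τ`, over the
local equations `τ` of the components, is divisible by the `p`-th power of the product of the `τ`.
As `t ^ p` is regular modulo `s ^ p` for different coordinates, each factor satisfies
`Ψ τ = τ ^ p (1 + p w)` (`IsFrobLift.exists_eq_pow_mul`). Hence `dt / t ↦ dt / t + dw` for these
coordinates, whereas `dt ↦ t ^ (p - 1) dt + dw` for the others; this is the notion `IsFrobChart`,
and it shows that logarithmic forms go to logarithmic forms.

*The quasi-isomorphism.* The claim is local, and amounts to a computation with sections in étale
coordinates `t`. There, `A` is additively generated by the monomials `t ^ β c ^ p`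
(`mem_closure_frobMonomials`), and the logarithmic forms with such coefficients are eigenvectors of
the Lie derivatives `L` along the Euler fields `t_i ∂ / ∂ t_i` (`lie_monomial`), with eigenvalues
in the prime field. As `L = d ι + ι d`, the projection `1 - L ^ (p - 1)` to weight zero does not
change cohomology classes, so that only forms of weight zero in all directions matter
(`exists_cohomologous_weight_zero`, `eq_zero_of_exact_of_weight_zero`). These are the sums of forms
`c ^ p ε_J`, where `ε_j` is `dt_j / t_j` or `t_j ^ (p - 1) dt_j`, that is, of Frobenius pullbacks
without the exact terms `dw`, which do not affect the cohomology class (`exists_frobImage_eq`). Such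
a sum determines its coefficients `c`, because `A` is reduced and the basic forms are independent.
This gives surjectivity and injectivity on cohomology sheaves.
-/

open scoped KaehlerDifferential

noncomputable section

namespace LogDR

/-! ### Lie derivatives and the projection to weight zero -/

section homotopy

variable {M σ : Type*} [AddCommGroup M]

/-- The Lie derivative `d h + h d` attached to a differential `d` and a contraction `h`. -/
def lieOp (d h : M →+ M) : M →+ M := d.comp h + h.comp d

theorem lieOp_apply (d h : M →+ M) (x : M) : lieOp d h x = d (h x) + h (d x) := rfl

/-- The projection `1 - L ^ (p - 1)` onto the kernel of `L`, when `L ^ p = L`. -/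
def weightProj (p : ℕ) (L : M →+ M) : M →+ M where
  toFun x := x - L^[p - 1] x
  map_zero' := by rw [iterate_map_zero, sub_zero]
  map_add' x y := by rw [iterate_map_add]; abel

theorem weightProj_apply (p : ℕ) (L : M →+ M) (x : M) :
    weightProj p L x = x - L^[p - 1] x := rfl

theorem iterate_eigen {L : M →+ M} {x : M} {l : ℕ} (h : L x = l • x) (n : ℕ) :
    L^[n] x = l ^ n • x := by
  induction n with
  | zero => simp
  | succ n ih => rw [Function.iterate_succ_apply', ih, map_nsmul, h, smul_smul, pow_succ]

/-- By Fermat's little theorem, `1 - L ^ (p - 1)` kills an eigenvector whose weight is prime to `p`,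
and it fixes an eigenvector whose weight is divisible by `p`. -/
theorem weightProj_eigen {p : ℕ} (hp : p.Prime) {L : M →+ M} {x : M} (hx : p • x = 0) {l : ℕ}
    (h : L x = l • x) : weightProj p L x = 0 ∨ (weightProj p L x = x ∧ L x = 0) := by
  rw [weightProj_apply, iterate_eigen h]
  by_cases hl : p ∣ l
  · obtain ⟨m, rfl⟩ := hl
    have h0 : (p * m) • x = 0 := by rw [mul_comm, mul_smul, hx, smul_zero]
    obtain ⟨r, hr⟩ : ∃ r, p - 1 = r + 1 := ⟨p - 2, by have := hp.two_le; omega⟩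
    refine Or.inr ⟨?_, by rw [h, h0]⟩
    rw [hr, pow_succ, mul_smul, h0, smul_zero, sub_zero]
  · left
    have h1 : l ^ (p - 1) ≡ 1 [MOD p] := by
      have := Nat.ModEq.pow_totient ((Nat.Prime.coprime_iff_not_dvd hp).mpr hl).symm
      rwa [Nat.totient_prime hp] at this
    have h2 : 1 ≤ l ^ (p - 1) := Nat.one_le_pow _ _ (Nat.pos_of_ne_zero (by rintro rfl; simp at hl))
    obtain ⟨m, hm⟩ := (Nat.modEq_iff_dvd' h2).mp h1.symm
    have h3 : l ^ (p - 1) = 1 + m * p := by rw [mul_comm, ← hm]; omega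
    rw [h3, add_smul, mul_smul, hx, smul_zero, add_zero, one_smul, sub_self]

variable {p : ℕ} (hp : p.Prime) {G : Set M} {K : AddSubgroup M} {d : M →+ M} {h : σ → M →+ M}
  (hpG : ∀ g ∈ G, p • g = 0)
  (hL : ∀ g ∈ G, ∀ i, ∃ l : ℕ, lieOp d (h i) g = l • g)
  (hK : ∀ g ∈ G, ∀ i, h i g ∈ K) (hdK : ∀ x ∈ K, d (d x) = 0)

include hp hpG hL in
/-- The projection onto the kernel of one Lie derivative keeps the span of the eigenvectors on
which a set of other Lie derivatives vanishes. -/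
theorem weightProj_mem_closure (s : Set σ) (i : σ) {x : M}
    (hx : x ∈ AddSubgroup.closure {g ∈ G | ∀ j ∈ s, lieOp d (h j) g = 0}) :
    weightProj p (lieOp d (h i)) x ∈
      AddSubgroup.closure {g ∈ G | ∀ j ∈ insert i s, lieOp d (h j) g = 0} := by
  have key : AddSubgroup.closure {g ∈ G | ∀ j ∈ s, lieOp d (h j) g = 0} ≤
      (AddSubgroup.closure {g ∈ G | ∀ j ∈ insert i s, lieOp d (h j) g = 0}).comap
        (weightProj p (lieOp d (h i))) := by
    rw [AddSubgroup.closure_le]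
    rintro g ⟨hg, hs⟩
    obtain ⟨l, hl⟩ := hL g hg i
    rw [SetLike.mem_coe, AddSubgroup.mem_comap]
    rcases weightProj_eigen hp (hpG g hg) hl with h0 | ⟨h0, h1⟩
    · rw [h0]; exact zero_mem _
    · rw [h0]
      refine AddSubgroup.subset_closure ⟨hg, ?_⟩
      rintro j (rfl | hj)
      · exact h1
      · exact hs j hj
  exact key hx

include hL in
theorem lieOp_mem_closure (i : σ) {x : M} (hx : x ∈ AddSubgroup.closure G) :
    lieOp d (h i) x ∈ AddSubgroup.closure G := by
  have key : AddSubgroup.closure G ≤ (AddSubgroup.closure G).comap (lieOp d (h i)) := by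
    rw [AddSubgroup.closure_le]
    intro g hg
    obtain ⟨l, hl⟩ := hL g hg i
    rw [SetLike.mem_coe, AddSubgroup.mem_comap, hl]
    exact nsmul_mem (AddSubgroup.subset_closure hg) l
  exact key hx

include hK in
theorem contract_mem (i : σ) {x : M} (hx : x ∈ AddSubgroup.closure G) : h i x ∈ K := by
  have key : AddSubgroup.closure G ≤ K.comap (h i) := by
    rw [AddSubgroup.closure_le]
    exact fun g hg => hK g hg i
  exact key hx

include hL hK hdK in
theorem iterate_lieOp_closed (i : σ) {x : M} (hx : x ∈ AddSubgroup.closure G) (hdx : d x = 0)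
    (n : ℕ) : (lieOp d (h i))^[n] x ∈ AddSubgroup.closure G ∧ d ((lieOp d (h i))^[n] x) = 0 := by
  induction n with
  | zero => exact ⟨hx, hdx⟩
  | succ n ih =>
    rw [Function.iterate_succ_apply']
    refine ⟨lieOp_mem_closure hL i ih.1, ?_⟩
    rw [lieOp_apply, ih.2, map_zero, add_zero, hdK _ (contract_mem hK i ih.1)]

include hp hpG hL hK hdK in
/-- A closed combination of eigenvectors of the Lie derivatives is cohomologous to a
combination of those eigenvectors that are killed by all Lie derivatives. -/
theorem exists_cohomologous_weight_zero [Fintype σ] {x : M} (hx : x ∈ AddSubgroup.closure G)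
    (hdx : d x = 0) : ∃ y ∈ AddSubgroup.closure {g ∈ G | ∀ j, lieOp d (h j) g = 0},
      ∃ z ∈ K, x = y + d z := by
  classical
  have key : ∀ s : Finset σ, ∃ y ∈ AddSubgroup.closure {g ∈ G | ∀ j ∈ (s : Set σ),
      lieOp d (h j) g = 0}, ∃ z ∈ K, x = y + d z := by
    intro s
    induction s using Finset.induction_on with
    | empty => exact ⟨x, by simpa using hx, 0, zero_mem _, by simp⟩
    | insert i s _ ih =>
      obtain ⟨y, hy, z, hz, rfl⟩ := ih
      have hyG : y ∈ AddSubgroup.closure G := AddSubgroup.closure_mono (fun g hg => hg.1) hy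
      have hdy : d y = 0 := by rw [map_add, hdK z hz, add_zero] at hdx; exact hdx
      obtain ⟨r, hr⟩ : ∃ r, p - 1 = r + 1 := ⟨p - 2, by have := hp.two_le; omega⟩
      obtain ⟨h1, h2⟩ := iterate_lieOp_closed hL hK hdK i hyG hdy r
      refine ⟨weightProj p (lieOp d (h i)) y, ?_, h i ((lieOp d (h i))^[r] y) + z,
        add_mem (contract_mem hK i h1) hz, ?_⟩
      · rw [Finset.coe_insert]
        exact weightProj_mem_closure hp hpG hL _ i hy
      -- On the closed form `L ^ r y` the Lie derivative is `d h`, so `L ^ (p - 1) y` is exact.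
      · rw [weightProj_apply, hr, Function.iterate_succ_apply', lieOp_apply, h2, map_zero,
          add_zero, map_add]
        abel
  simpa using key Finset.univ

include hp hpG hL hK hdK in
/-- A form that is killed by all Lie derivatives and is exact vanishes. -/
theorem eq_zero_of_exact_of_weight_zero [Fintype σ]
    (hd0 : ∀ g ∈ G, (∀ j, lieOp d (h j) g = 0) → d g = 0)
    {x y : M} (hx : x ∈ AddSubgroup.closure G) (hxy : d x = y) (hdy : d y = 0)
    (hy : ∀ j, lieOp d (h j) y = 0) :
    y = 0 := by
  classical
  have key : ∀ s : Finset σ, ∃ x' ∈ AddSubgroup.closure {g ∈ G | ∀ j ∈ (s : Set σ),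
      lieOp d (h j) g = 0}, d x' = y := by
    intro s
    induction s using Finset.induction_on with
    | empty => exact ⟨x, by simpa using hx, hxy⟩
    | insert i s _ ih =>
      obtain ⟨x, hx, hxy⟩ := ih
      have hxG : x ∈ AddSubgroup.closure G := AddSubgroup.closure_mono (fun g hg => hg.1) hx
      refine ⟨weightProj p (lieOp d (h i)) x, ?_, ?_⟩
      · rw [Finset.coe_insert]
        exact weightProj_mem_closure hp hpG hL _ i hx
      · obtain ⟨r, hr⟩ : ∃ r, p - 1 = r + 1 := ⟨p - 2, by have := hp.two_le; omega⟩
        -- Since `d L x = d h y = L y`, which vanishes, subtracting `L ^ (p - 1) x` keeps `d x`.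
        have h1 : ∀ n, (lieOp d (h i))^[n] x ∈ AddSubgroup.closure G ∧
            d ((lieOp d (h i))^[n + 1] x) = 0 := by
          intro n
          induction n with
          | zero =>
            refine ⟨hxG, ?_⟩
            have h3 := hy i
            rw [lieOp_apply, hdy, map_zero, add_zero] at h3
            change d (lieOp d (h i) x) = 0
            rw [lieOp_apply, map_add, hdK _ (contract_mem hK i hxG), hxy, h3, zero_add]
          | succ n ih =>
            have h5 : (lieOp d (h i))^[n + 1] x ∈ AddSubgroup.closure G := by
              rw [Function.iterate_succ_apply']; exact lieOp_mem_closure hL i ih.1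
            refine ⟨h5, ?_⟩
            rw [Function.iterate_succ_apply', lieOp_apply, ih.2, map_zero, add_zero,
              hdK _ (contract_mem hK i h5)]
        rw [weightProj_apply, hr, map_sub, (h1 r).2, sub_zero, hxy]
  obtain ⟨x', hx', hd⟩ := key Finset.univ
  rw [← hd]
  have : AddSubgroup.closure {g ∈ G | ∀ j ∈ ((Finset.univ : Finset σ) : Set σ),
      lieOp d (h j) g = 0} ≤ d.ker := by
    rw [AddSubgroup.closure_le]
    exact fun g hg => hd0 g hg.1 fun j => hg.2 j (by simp)
  exact this hx'

end homotopy

/-! ### Products of one-forms and Cartan's formula -/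

section words

variable (R : Type*) {B σ : Type*} [CommRing R] [CommRing B] [Algebra R B]

theorem extD_mul_of_closed {x y : Forms R B} (hx : extD R B x = 0) (hy : extD R B y = 0) :
    extD R B (x * y) = 0 := by
  change (twistHom R B _).1 0 1 = 0 at *
  rw [map_mul, Subring.coe_mul, Matrix.mul_apply, Fin.sum_univ_two, hx, hy, mul_zero, zero_mul,
    add_zero]

theorem extD_one : extD R B 1 = 0 := by
  rw [← map_one (algebraMap B (Forms R B)), extD_algebraMap, dOne_one]

/-- Contraction of forms with a vector field, given as a linear functional on one-forms. -/
def contr (v : Ω[B⁄R] →ₗ[B] B) : Forms R B →ₗ[B] Forms R B :=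
  CliffordAlgebra.contractLeft v

variable {R}

theorem contr_ι_mul (v : Ω[B⁄R] →ₗ[B] B) (w : Ω[B⁄R]) (x : Forms R B) :
    contr R v (ExteriorAlgebra.ι B w * x) = v w • x - ExteriorAlgebra.ι B w * contr R v x :=
  CliffordAlgebra.contractLeft_ι_mul v w x

theorem contr_one (v : Ω[B⁄R] →ₗ[B] B) : contr R v 1 = 0 := CliffordAlgebra.contractLeft_one _ v

/-- The product of the one-forms `η j`, for `j` running through a list. -/
def word (η : σ → Ω[B⁄R]) (J : List σ) : Forms R B :=
  (J.map fun j => ExteriorAlgebra.ι B (η j)).prod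

theorem word_cons (η : σ → Ω[B⁄R]) (j : σ) (J : List σ) :
    word η (j :: J) = ExteriorAlgebra.ι B (η j) * word η J := by
  simp [word]

theorem word_nil (η : σ → Ω[B⁄R]) : word η [] = 1 := rfl

theorem word_closed {η : σ → Ω[B⁄R]} (hd : ∀ j, extD R B (ExteriorAlgebra.ι B (η j)) = 0)
    (J : List σ) : extD R B (word η J) = 0 := by
  induction J with
  | nil => exact extD_one R
  | cons j J ih => rw [word_cons]; exact extD_mul_of_closed R (hd j) ih

theorem ι_mul_ι_swap (v w : Ω[B⁄R]) (x : Forms R B) :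
    ExteriorAlgebra.ι B v * (ExteriorAlgebra.ι B w * x) =
      -(ExteriorAlgebra.ι B w * (ExteriorAlgebra.ι B v * x)) := by
  rw [← mul_assoc, ← mul_assoc, ← neg_mul,
    eq_neg_of_add_eq_zero_left (ExteriorAlgebra.ι_add_mul_swap v w)]

theorem ι_mul_word_of_mem {η : σ → Ω[B⁄R]} {j : σ} {J : List σ} (h : j ∈ J) :
    ExteriorAlgebra.ι B (η j) * word η J = 0 := by
  induction J with
  | nil => simp at h
  | cons i J ih =>
    rw [word_cons]
    rcases List.mem_cons.mp h with rfl | h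
    · rw [← mul_assoc, ExteriorAlgebra.ι_sq_zero, zero_mul]
    · rw [ι_mul_ι_swap, ih h, mul_zero, neg_zero]

theorem word_of_not_nodup {η : σ → Ω[B⁄R]} {J : List σ} (h : ¬ J.Nodup) : word η J = 0 := by
  induction J with
  | nil => simp at h
  | cons i J ih =>
    rw [word_cons]
    by_cases hi : i ∈ J
    · exact ι_mul_word_of_mem hi
    · rw [ih (by simpa [hi] using h), mul_zero]

theorem word_smul (c : σ → B) (η : σ → Ω[B⁄R]) (J : List σ) :
    word (fun j => c j • η j) J = (J.map c).prod • word η J := by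
  induction J with
  | nil => simp [word_nil]
  | cons i J ih =>
    rw [word_cons, word_cons, ih, List.map_cons, List.prod_cons, map_smul, smul_mul_assoc,
      mul_smul_comm, mul_smul]

/-- On a product of closed eigenvectors, `d` after contraction is the whole Lie derivative, and the
weights add up. -/
theorem extD_contr_word (v : Ω[B⁄R] →ₗ[B] B) {η : σ → Ω[B⁄R]} {wt : σ → ℕ}
    (hd : ∀ j, extD R B (ExteriorAlgebra.ι B (η j)) = 0)
    (hw : ∀ j, dOne R (v (η j)) = wt j • ExteriorAlgebra.ι B (η j)) (J : List σ) :
    extD R B (contr R v (word η J)) = (J.map wt).sum • word η J := by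
  induction J with
  | nil => rw [word_nil, contr_one, map_zero]; simp
  | cons j J ih =>
    rw [word_cons, contr_ι_mul, map_sub, extD_smul, extD_ι_mul, hd, ih, word_closed hd, smul_zero,
      add_zero, zero_mul, zero_sub, sub_neg_eq_add, hw, smul_mul_assoc, mul_smul_comm, ← add_smul,
      List.map_cons, List.sum_cons]

/-- Cartan's formula on a product of eigenvectors: weights add up. -/
theorem lie_smul_word (v : Ω[B⁄R] →ₗ[B] B) {η : σ → Ω[B⁄R]} {wt : σ → ℕ}
    (hd : ∀ j, extD R B (ExteriorAlgebra.ι B (η j)) = 0)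
    (hw : ∀ j, dOne R (v (η j)) = wt j • ExteriorAlgebra.ι B (η j)) (J : List σ)
    {b : B} {l : ℕ} (hb : v (KaehlerDifferential.D R B b) = l • b) :
    extD R B (contr R v (b • word η J)) + contr R v (extD R B (b • word η J)) =
      (l + (J.map wt).sum) • (b • word η J) := by
  rw [map_smul, extD_smul, extD_contr_word v hd hw, extD_smul, word_closed hd, smul_zero,
    add_zero, dOne, contr_ι_mul, hb, add_smul, smul_assoc, smul_comm b (List.sum _)]
  abel

/-- The monomial `t ^ β c ^ p` is an eigenvector of weight `β i` for a derivation acting on the `t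
j` like `t_i ∂ / ∂ t_i`, because `p`-th powers are constants in characteristic `p`. -/
theorem derivation_monomial {σ : Type*} [Fintype σ] [DecidableEq σ] {p : ℕ} (hp : (p : B) = 0)
    (v : Derivation R B B) (t : σ → B) (i : σ) (hv : ∀ j, v (t j) = if j = i then t i else 0)
    (β : σ → ℕ) (c : B) :
    v ((∏ j, t j ^ β j) * c ^ p) = β i • ((∏ j, t j ^ β j) * c ^ p) := by
  have h1 : v (c ^ p) = 0 := by
    rw [Derivation.leibniz_pow, ← Nat.cast_smul_eq_nsmul B, hp, zero_smul]
  have h2 : ∀ j, v (t j ^ β j) = (if j = i then β i else 0) • t j ^ β j := by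
    intro j
    rw [Derivation.leibniz_pow, hv]
    split_ifs with h
    · subst h
      rcases Nat.eq_zero_or_pos (β j) with h0 | h0
      · simp [h0]
      · rw [smul_eq_mul, ← pow_succ, Nat.sub_add_cancel h0]
    · simp
  have h3 : ∀ s : Finset σ, v (∏ j ∈ s, t j ^ β j) =
      (∑ j ∈ s, if j = i then β i else 0) • ∏ j ∈ s, t j ^ β j := by
    intro s
    induction s using Finset.induction_on with
    | empty => simp
    | insert a s ha ih =>
      rw [Finset.prod_insert ha, Finset.sum_insert ha, Derivation.leibniz, ih, h2]
      simp only [smul_eq_mul, nsmul_eq_mul]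
      push_cast
      ring
  rw [Derivation.leibniz, h1, smul_zero, zero_add, h3]
  simp only [Finset.sum_ite_eq', Finset.mem_univ, if_true, smul_eq_mul, nsmul_eq_mul]
  ring

end words

section etale

open TensorProduct

/-- A finite unramified extension generated by `p`-th powers is trivial: if `A` is formally
unramified over `C` and every `p`-th power of an element of `A` comes from `C`, then `C → A`
is surjective. -/
theorem surjective_of_unramified_of_pow (p : ℕ) (hp : p ≠ 0) (C A : Type*) [CommRing C] [CommRing A]
    [Algebra C A] [Algebra.FiniteType C A] [Algebra.FormallyUnramified C A]
    (hadd : ∀ x y : A ⊗[C] A, (x - y) ^ p = x ^ p - y ^ p)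
    (h : ∀ a : A, a ^ p ∈ (algebraMap C A).range) : Function.Surjective (algebraMap C A) := by
  have hint : Algebra.IsIntegral C A := ⟨fun a => by
    obtain ⟨c, hc⟩ := h a
    refine IsIntegral.of_pow (Nat.pos_of_ne_zero hp) (n := p) ?_
    rw [← hc]
    exact isIntegral_algebraMap⟩
  have hfin : Module.Finite C A := Algebra.IsIntegral.finite
  rw [← Algebra.isEpi_iff_surjective_algebraMap_of_finite, Algebra.isEpi_iff_forall_one_tmul_eq]
  have hfg : (KaehlerDifferential.ideal C A).FG := KaehlerDifferential.ideal_fg C A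
  have hid : IsIdempotentElem (KaehlerDifferential.ideal C A) := by
    have := (Ideal.cotangent_subsingleton_iff (KaehlerDifferential.ideal C A)).mp
      (Algebra.FormallyUnramified.subsingleton_kaehlerDifferential (R := C) (A := A))
    exact this
  obtain ⟨e, he, heI⟩ := (Ideal.isIdempotentElem_iff_of_fg _ hfg).mp hid
  -- The kernel of `A ⊗ A → A` is generated by nilpotents, as well as by an idempotent; hence it
  -- vanishes, so that the finite homomorphism `C → A` is an epimorphism.
  have hgen : ∀ a : A, (1 ⊗ₜ a - a ⊗ₜ 1 : A ⊗[C] A) ^ p = 0 := by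
    intro a
    obtain ⟨c, hc⟩ := h a
    rw [hadd, Algebra.TensorProduct.tmul_pow, Algebra.TensorProduct.tmul_pow, one_pow, ← hc,
      sub_eq_zero, Algebra.algebraMap_eq_smul_one, TensorProduct.smul_tmul]
  have hnil : ∀ x ∈ KaehlerDifferential.ideal C A, IsNilpotent x := by
    have : KaehlerDifferential.ideal C A ≤ nilradical (A ⊗[C] A) := by
      rw [← KaehlerDifferential.span_range_eq_ideal, Ideal.span_le]
      rintro _ ⟨a, rfl⟩
      exact ⟨p, hgen a⟩
    exact fun x hx => this hx
  have he0 : e = 0 := by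
    obtain ⟨m, hm⟩ := hnil e (heI ▸ Ideal.mem_span_singleton_self e)
    rcases m with _ | m
    · rw [pow_zero] at hm
      rw [← one_mul e, hm, zero_mul]
    · rwa [he.pow_succ_eq] at hm
  intro a
  have : (1 ⊗ₜ a - a ⊗ₜ 1 : A ⊗[C] A) ∈ KaehlerDifferential.ideal C A :=
    KaehlerDifferential.one_smul_sub_smul_one_mem_ideal C a
  rw [heI, he0] at this
  exact sub_eq_zero.mp (by simpa using this)

end etale

/-! ### Étale coordinates -/

section coordinates

open TensorProduct MvPolynomial

/-- A ring that is flat and unramified of finite type over a domain is reduced. -/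
theorem isReduced_of_flat_of_formallyUnramified (P A : Type*) [CommRing P] [IsDomain P]
    [CommRing A] [Algebra P A] [Module.Flat P A] [Algebra.FormallyUnramified P A]
    [Algebra.FiniteType P A] : IsReduced A := by
  let K := FractionRing P
  have h1 : IsReduced (K ⊗[P] A) := Algebra.FormallyUnramified.isReduced_of_field K (K ⊗[P] A)
  have h2 : Function.Injective (Algebra.TensorProduct.includeRight : A →ₐ[P] K ⊗[P] A) :=
    Algebra.TensorProduct.includeRight_injective (IsFractionRing.injective P K)
  exact isReduced_of_injective _ h2

theorem natCast_eq_zero_of_hom (p : ℕ) {k A : Type*} [Field k] [CharP k p] [CommRing A]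
    (b : k →+* A) : (p : A) = 0 := by
  rw [← map_natCast b, CharP.cast_eq_zero, map_zero]

/-- The monomials `t ^ β * c ^ p`. -/
def frobMonomials (p : ℕ) {A : Type*} [CommRing A] {n : ℕ} (t : Fin n → A) : Set A :=
  {x | ∃ (β : Fin n → ℕ) (c : A), x = (∏ j, t j ^ β j) * c ^ p}

/-- The submonoid of the monomials `t ^ β * c ^ p`. -/
def frobMonomialSubmonoid (p : ℕ) {A : Type*} [CommRing A] {n : ℕ} (t : Fin n → A) :
    Submonoid A where
  carrier := frobMonomials p t
  one_mem' := ⟨0, 1, by simp⟩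
  mul_mem' := by
    rintro _ _ ⟨β, c, rfl⟩ ⟨γ, e, rfl⟩
    refine ⟨β + γ, c * e, ?_⟩
    simp only [Pi.add_apply, pow_add, Finset.prod_mul_distrib, mul_pow]
    ring

theorem coord_mem_frobMonomials (p : ℕ) {A : Type*} [CommRing A] {n : ℕ} (t : Fin n → A)
    (i : Fin n) : t i ∈ frobMonomials p t :=
  ⟨Pi.single i 1, 1, by
    rw [one_pow, mul_one, Finset.prod_eq_single i] <;> simp +contextual⟩

/-- If the differentials of the coordinates `t` generate the differentials of `A` over a perfect
field, then `A` is generated by `t` over its subring of `p`-th powers. -/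
theorem mem_closure_frobMonomials (p : ℕ) [Fact p.Prime] {k A : Type*} [Field k] [CharP k p]
    [PerfectRing k p] [CommRing A] {n : ℕ} (b : k →+* A) (t : Fin n → A)
    (hu : (eval₂Hom b t).FormallyUnramified) (hf : (eval₂Hom b t).FiniteType) (a : A) :
    a ∈ AddSubgroup.closure (frobMonomials p t) := by
  have hpA : (p : A) = 0 := natCast_eq_zero_of_hom p b
  -- The subring `C` generated by `t` and the `p`-th powers contains the constants, since `k` is
  -- perfect; hence `A` is unramified over `C`.
  let Q : Subring A := (powHom p A hpA).range
  let C : Subalgebra Q A := Algebra.adjoin Q (Set.range t)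
  have hbQ : ∀ x, b x ∈ Q := fun x => ⟨b ((frobeniusEquiv k p).symm x), by
    change b _ ^ p = _
    rw [← map_pow, frobeniusEquiv_symm_pow_p]⟩
  have hC : ∀ f : MvPolynomial (Fin n) k, eval₂Hom b t f ∈ C := by
    intro f
    induction f using MvPolynomial.induction_on with
    | C x =>
      rw [coe_eval₂Hom, eval₂_C]
      exact C.algebraMap_mem ⟨b x, hbQ x⟩
    | add f g hf hg => rw [map_add]; exact add_mem hf hg
    | mul_X f i hf =>
      rw [map_mul]
      refine mul_mem hf ?_
      rw [coe_eval₂Hom, eval₂_X]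
      exact Algebra.subset_adjoin ⟨i, rfl⟩
  let : Algebra (MvPolynomial (Fin n) k) A := (eval₂Hom b t).toAlgebra
  let : Algebra (MvPolynomial (Fin n) k) C := ((eval₂Hom b t).codRestrict C hC).toAlgebra
  have : IsScalarTower (MvPolynomial (Fin n) k) C A := IsScalarTower.of_algebraMap_eq fun _ => rfl
  have : Algebra.FormallyUnramified (MvPolynomial (Fin n) k) A := hu
  have : Algebra.FiniteType (MvPolynomial (Fin n) k) A := hf
  have : Algebra.FormallyUnramified C A :=
    Algebra.FormallyUnramified.of_restrictScalars (MvPolynomial (Fin n) k) C A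
  have : Algebra.FiniteType C A :=
    Algebra.FiniteType.of_restrictScalars_finiteType (MvPolynomial (Fin n) k) C A
  have hsurj : Function.Surjective (algebraMap C A) := by
    refine surjective_of_unramified_of_pow p (Fact.out : p.Prime).ne_zero C A ?_ ?_
    · intro x y
      have h0 : (p : A ⊗[C] A) = 0 := by
        rw [← map_natCast (algebraMap A (A ⊗[C] A)), hpA, map_zero]
      exact map_sub (powHom p (A ⊗[C] A) h0) x y
    · intro a
      exact ⟨algebraMap Q C ⟨a ^ p, a, rfl⟩, rfl⟩
  obtain ⟨⟨c, hc⟩, rfl⟩ := hsurj a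
  change c ∈ _
  have key : ∀ x ∈ C, x ∈ Subring.closure (frobMonomialSubmonoid p t : Set A) := by
    intro x hx
    refine Algebra.adjoin_induction ?_ ?_ (fun x y _ _ hx hy => add_mem hx hy)
      (fun x y _ _ hx hy => mul_mem hx hy) hx
    · rintro _ ⟨i, rfl⟩
      exact Subring.subset_closure (coord_mem_frobMonomials p t i)
    · rintro ⟨_, c, rfl⟩
      exact Subring.subset_closure ⟨0, c, by simp; rfl⟩
  have := key c hc
  rwa [Subring.mem_closure_iff, Submonoid.closure_eq] at this

theorem isReduced_of_etale {k A : Type*} [Field k] [CommRing A] {n : ℕ} (b : k →+* A)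
    (t : Fin n → A) (h : (eval₂Hom b t).Etale) : IsReduced A := by
  obtain ⟨h1, h2, h3⟩ := RingHom.Etale.iff_flat_and_formallyUnramified.mp h
  let : Algebra (MvPolynomial (Fin n) k) A := (eval₂Hom b t).toAlgebra
  have : Module.Flat (MvPolynomial (Fin n) k) A := h1
  have : Algebra.FormallyUnramified (MvPolynomial (Fin n) k) A := h2
  have : Algebra.FinitePresentation (MvPolynomial (Fin n) k) A := h3
  exact isReduced_of_flat_of_formallyUnramified (MvPolynomial (Fin n) k) A

/-- A coordinate is a nonzerodivisor, as it is one in the polynomial ring. -/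
theorem coord_regular {k A : Type*} [Field k] [CommRing A] {n : ℕ} (b : k →+* A)
    (t : Fin n → A) (h : (eval₂Hom b t).Flat) (i : Fin n) {a : A} (ha : t i * a = 0) : a = 0 := by
  let : Algebra (MvPolynomial (Fin n) k) A := (eval₂Hom b t).toAlgebra
  have : Module.Flat (MvPolynomial (Fin n) k) A := h
  have h1 : IsSMulRegular A (eval₂Hom b t (X i)) :=
    IsSMulRegular.of_flat (S := A) (R := MvPolynomial (Fin n) k) (x := X i)
      (fun x y hxy => mul_left_cancel₀ (X_ne_zero i) hxy)
  rw [coe_eval₂Hom, eval₂_X] at h1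
  exact h1 (by simpa using ha)

/-- If `g` is a nonzerodivisor modulo `f` in `P`, then also in every flat `P`-algebra. -/
theorem dvd_of_flat {P A : Type*} [CommRing P] [CommRing A] [Algebra P A] [Module.Flat P A]
    {f g : P} (h : ∀ d, f ∣ g * d → f ∣ d) {a : A}
    (ha : algebraMap P A f ∣ algebraMap P A g * a) : algebraMap P A f ∣ a := by
  obtain ⟨c, hc⟩ := ha
  have hrel : ∑ l, (![g, -f] : Fin 2 → P) l • (![a, c] : Fin 2 → A) l = 0 := by
    simp only [Fin.sum_univ_two, Matrix.cons_val_zero, Matrix.cons_val_one, Algebra.smul_def,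
      map_neg, hc]
    ring
  obtain ⟨r, d, y, hy, hd⟩ :=
    Module.Flat.isTrivialRelation_of_sum_smul_eq_zero (R := P) (M := A) hrel
  have hy0 : a = ∑ l, d 0 l • y l := hy 0
  rw [hy0]
  refine Finset.dvd_sum fun l _ => ?_
  have h2 := hd l
  simp only [Fin.sum_univ_two, Matrix.cons_val_zero, Matrix.cons_val_one] at h2
  obtain ⟨e, he⟩ := h (d 0 l) ⟨d 1 l, by linear_combination h2⟩
  rw [he, Algebra.smul_def, map_mul, mul_assoc]
  exact Dvd.intro _ rfl

/-- The powers of a coordinate are nonzerodivisors modulo the powers of another one. -/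
theorem coord_regular_mod {k A : Type*} [Field k] [CommRing A] {n : ℕ} (b : k →+* A)
    (t : Fin n → A) (h : (eval₂Hom b t).Flat) {i j : Fin n} (hij : i ≠ j) (m : ℕ) {a : A}
    (ha : t i ^ m ∣ t j ^ m * a) : t i ^ m ∣ a := by
  let : Algebra (MvPolynomial (Fin n) k) A := (eval₂Hom b t).toAlgebra
  have : Module.Flat (MvPolynomial (Fin n) k) A := h
  have hX : ∀ i, algebraMap (MvPolynomial (Fin n) k) A (X i ^ m) = t i ^ m := fun i => by
    rw [map_pow]
    exact congrArg (· ^ m) (eval₂_X b t i)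
  rw [← hX i, ← hX j] at ha
  rw [← hX i]
  refine dvd_of_flat (fun d hd => ?_) ha
  have hco : IsRelPrime (X i ^ m : MvPolynomial (Fin n) k) (X j ^ m) := by
    refine IsRelPrime.pow ?_
    rw [(X_prime (i := i)).irreducible.isRelPrime_iff_not_dvd, X_dvd_X]
    exact hij
  exact hco.dvd_of_dvd_mul_left hd

/-- Étale coordinates give a basis of the module of differentials. -/
theorem exists_basis_of_formallyEtale {k A : Type*} [Field k] [CommRing A] [Algebra k A] {n : ℕ}
    (t : Fin n → A) (h : (eval₂Hom (algebraMap k A) t).FormallyEtale) :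
    ∃ B : Module.Basis (Fin n) A Ω[A⁄k], ∀ i, B i = KaehlerDifferential.D k A (t i) := by
  let : Algebra (MvPolynomial (Fin n) k) A := (eval₂Hom (algebraMap k A) t).toAlgebra
  have : Algebra.FormallyEtale (MvPolynomial (Fin n) k) A := h
  have : IsScalarTower k (MvPolynomial (Fin n) k) A := IsScalarTower.of_algebraMap_eq fun x =>
    (eval₂_C (algebraMap k A) t x).symm
  refine ⟨((KaehlerDifferential.mvPolynomialBasis k (Fin n)).baseChange A).map
    (KaehlerDifferential.tensorKaehlerEquivOfFormallyEtale k (MvPolynomial (Fin n) k) A), ?_⟩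
  intro i
  rw [Module.Basis.map_apply, Module.Basis.baseChange_apply,
    KaehlerDifferential.mvPolynomialBasis_apply, ← LinearEquiv.eq_symm_apply]
  have := KaehlerDifferential.tensorKaehlerEquivOfFormallyEtale_symm_D_algebraMap k
    (MvPolynomial (Fin n) k) A (X i)
  rw [← this]
  congr 2
  exact eval₂_X (algebraMap k A) t i

end coordinates

/-! ### The divided Frobenius on the algebra of forms -/

section carry

open MvPolynomial

theorem derivation_aeval {A M : Type*} [CommRing A] [AddCommGroup M] [Module A M]
    (D : Derivation ℤ A M) (x : Fin 2 → A) (f : MvPolynomial (Fin 2) ℤ) :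
    D (aeval x f) = ∑ i, aeval x (pderiv i f) • D (x i) := by
  induction f using MvPolynomial.induction_on with
  | C c => simp
  | add f g hf hg => simp only [map_add, hf, hg, add_smul, Finset.sum_add_distrib]
  | mul_X f j hf =>
    simp only [map_mul, aeval_X, Derivation.leibniz, hf, pderiv_X, Finset.smul_sum, map_add,
      smul_eq_mul, add_smul, Finset.sum_add_distrib, smul_smul]
    congr 1
    rw [Finset.sum_eq_single j]
    · simp
    · intro b _ hb; simp [hb.symm]
    · simp

/-- The polynomial `((x + y) ^ p - x ^ p - y ^ p) / p` and its differential. -/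
theorem exists_carry (p : ℕ) [hp : Fact p.Prime] {A M : Type*} [CommRing A] [AddCommGroup M]
    [Module A M] (D : Derivation ℤ A M) :
    ∃ R : MvPolynomial (Fin 2) ℤ,
      (∀ {T : Type*} [CommRing T] (a b : T), (a + b) ^ p = a ^ p + b ^ p + p * aeval ![a, b] R) ∧
      ∀ a b : A, D (aeval ![a, b] R) =
        (a + b) ^ (p - 1) • D (a + b) - a ^ (p - 1) • D a - b ^ (p - 1) • D b := by
  obtain ⟨r, hr⟩ := exists_add_pow_prime_eq hp.out (X 0 : MvPolynomial (Fin 2) ℤ) (X 1)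
  refine ⟨X 0 * X 1 * r, fun a b => ?_, fun a b => ?_⟩
  · have h := congrArg (aeval ![a, b]) hr
    simpa [mul_assoc] using h
  · have hd : ∀ i : Fin 2, pderiv i (X 0 * X 1 * r) =
        (X 0 + X 1) ^ (p - 1) - X i ^ (p - 1) := by
      intro i
      have h := congrArg (pderiv i) hr
      have hp0 : (p : MvPolynomial (Fin 2) ℤ) ≠ 0 := Nat.cast_ne_zero.mpr hp.out.ne_zero
      apply mul_left_cancel₀ hp0
      have h2 : pderiv i ((p : MvPolynomial (Fin 2) ℤ) * (X 0 * X 1 * r)) =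
          (p : MvPolynomial (Fin 2) ℤ) * pderiv i (X 0 * X 1 * r) := by
        rw [Derivation.leibniz, Derivation.map_natCast, smul_zero, add_zero, smul_eq_mul]
      have h3 : ∀ j : Fin 2, (pderiv i) (X j : MvPolynomial (Fin 2) ℤ) = if j = i then 1 else 0 :=
        fun j => by rw [pderiv_X, Pi.single_apply]
      rw [← h2]
      have h4 : (p : MvPolynomial (Fin 2) ℤ) * (X 0 * X 1 * r) =
          (X 0 + X 1) ^ p - X 0 ^ p - X 1 ^ p := by rw [hr]; ring
      rw [h4]
      simp only [map_sub, Derivation.leibniz_pow, map_add, h3, nsmul_eq_mul, smul_eq_mul]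
      fin_cases i <;> simp <;> ring
    rw [derivation_aeval, Fin.sum_univ_two, hd, hd]
    simp only [map_sub, map_pow, map_add, aeval_X, Matrix.cons_val_zero, Matrix.cons_val_one,
      sub_smul, smul_add]
    abel

end carry

section divided

variable {p : ℕ} {k T A : Type*} [CommRing T] [CommRing A]

/-- `Ψ` lifts the Frobenius endomorphism of `A`, along a map `r : T → A` that presents `A` as
the reduction of `T` modulo `p`, where `T` is flat over `ℤ / p ^ 2`. -/
structure IsFrobLift (p : ℕ) (r : T →+* A) (Ψ : T →+* T) : Prop where
  sq_zero : (p : T) * p = 0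
  surjective : Function.Surjective r
  natCast_mul_eq_zero_iff : ∀ x, (p : T) * x = 0 ↔ r x = 0
  exists_of_eq_zero : ∀ x, r x = 0 → ∃ y, x = p * y
  frob : ∀ x, r (Ψ x) = r x ^ p

namespace IsFrobLift

variable {r : T →+* A} {Ψ : T →+* T} (H : IsFrobLift p r Ψ)

include H

theorem char : (p : A) = 0 := by
  rw [← map_natCast r, ← H.natCast_mul_eq_zero_iff, H.sq_zero]

theorem exists_delta (x : T) : ∃ u, Ψ x = x ^ p + p * u := by
  obtain ⟨u, hu⟩ := H.exists_of_eq_zero (Ψ x - x ^ p) (by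
    rw [map_sub, H.frob, map_pow, sub_self])
  exact ⟨u, by rw [← hu]; ring⟩

theorem pow_add_mul [hp : Fact p.Prime] (x y : T) : (x + p * y) ^ p = x ^ p := by
  obtain ⟨s, hs⟩ := exists_add_pow_prime_eq hp.out x ((p : T) * y)
  obtain ⟨m, hm⟩ : ∃ m, p = m + 2 := ⟨p - 2, by have := hp.out.two_le; omega⟩
  have h1 : ((p : T) * y) ^ p = 0 := by
    conv_lhs => rw [hm, pow_add, mul_pow _ _ 2]
    rw [← hm, pow_two (p : T), H.sq_zero]; ring
  rw [hs, h1]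
  linear_combination (x * y * s) * H.sq_zero

section base

variable [CommRing k] [Algebra k A]

/-- The differential `du` depends only on the reduction of the lift: if a lift changes by `p y`,
then `u` changes by the `p`-th power `r y ^ p`. -/
theorem delta_unique [hp : Fact p.Prime] {x x' u u' : T} (h : r x = r x')
    (hu : Ψ x = x ^ p + p * u)
    (hu' : Ψ x' = x' ^ p + p * u') :
    KaehlerDifferential.D k A (r u) = KaehlerDifferential.D k A (r u') := by
  obtain ⟨y, hy⟩ := H.exists_of_eq_zero (x' - x) (by rw [map_sub, h, sub_self])
  obtain rfl : x' = x + p * y := by rw [← hy]; ring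
  rw [H.pow_add_mul, map_add, map_mul, map_natCast, hu] at hu'
  have h1 : r (u + Ψ y - u') = 0 := by
    rw [← H.natCast_mul_eq_zero_iff]
    linear_combination hu'
  rw [map_sub, map_add, H.frob, sub_eq_zero] at h1
  rw [← h1, map_add, Derivation.leibniz_pow, ← Nat.cast_smul_eq_nsmul A, H.char, zero_smul,
    add_zero]

/-- The derivation `a ↦ a ^ (p - 1) da + du`, where `Ψ ã = ã ^ p + p ũ` for a lift `ã` of `a` and
`u` is the reduction of `ũ`. -/
def divD (a : A) : Ω[A⁄k] :=
  a ^ (p - 1) • KaehlerDifferential.D k A a +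
    KaehlerDifferential.D k A (r (H.exists_delta (H.surjective a).choose).choose)

theorem divD_eq [hp : Fact p.Prime] {x u : T} (hu : Ψ x = x ^ p + p * u) :
    H.divD (k := k) (r x) = r x ^ (p - 1) • KaehlerDifferential.D k A (r x) +
      KaehlerDifferential.D k A (r u) := by
  rw [divD]
  congr 1
  exact H.delta_unique (H.surjective (r x)).choose_spec
    (H.exists_delta (H.surjective (r x)).choose).choose_spec hu

theorem divD_add [hp : Fact p.Prime] (a b : A) :
    H.divD (k := k) (a + b) = H.divD a + H.divD b := by
  obtain ⟨x, rfl⟩ := H.surjective a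
  obtain ⟨y, rfl⟩ := H.surjective b
  obtain ⟨u, hu⟩ := H.exists_delta x
  obtain ⟨v, hv⟩ := H.exists_delta y
  obtain ⟨R, hR, hD⟩ := exists_carry.{_, _, _} p ((KaehlerDifferential.D k A).restrictScalars ℤ)
  -- The correction term of `x + y` involves the carry polynomial, whose differential accounts for
  -- the failure of `a ↦ a ^ (p - 1) da` to be additive.
  have h : Ψ (x + y) = (x + y) ^ p + p * (u + v - MvPolynomial.aeval ![x, y] R) := by
    rw [map_add, hu, hv, hR]; ring
  have h2 : r (MvPolynomial.aeval ![x, y] R) = MvPolynomial.aeval ![r x, r y] R := by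
    have := MvPolynomial.map_aeval ![x, y] (r : T →+* A) R
    rw [this, MvPolynomial.aeval_def, MvPolynomial.coe_eval₂Hom]
    congr 1
    · exact RingHom.ext_int _ _
    · ext i; fin_cases i <;> rfl
  have h3 := hD (r x) (r y)
  rw [← map_add, H.divD_eq h, H.divD_eq hu, H.divD_eq hv, map_sub, map_sub, h2]
  simp only [Derivation.restrictScalars_apply] at h3
  rw [h3]
  simp only [map_add]
  abel

theorem divD_mul [hp : Fact p.Prime] (a b : A) :
    H.divD (k := k) (a * b) = a ^ p • H.divD b + b ^ p • H.divD a := by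
  obtain ⟨x, rfl⟩ := H.surjective a
  obtain ⟨y, rfl⟩ := H.surjective b
  obtain ⟨u, hu⟩ := H.exists_delta x
  obtain ⟨v, hv⟩ := H.exists_delta y
  have h : Ψ (x * y) = (x * y) ^ p + p * (x ^ p * v + y ^ p * u) := by
    rw [map_mul, hu, hv]
    linear_combination u * v * H.sq_zero
  have h0 : ∀ c : A, KaehlerDifferential.D k A (c ^ p) = 0 := fun c => by
    rw [Derivation.leibniz_pow, ← Nat.cast_smul_eq_nsmul A, H.char, zero_smul]
  obtain ⟨m, hm⟩ : ∃ m, p = m + 1 := ⟨p - 1, by have := hp.out.pos; omega⟩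
  rw [← map_mul, H.divD_eq h, H.divD_eq hu, H.divD_eq hv]
  simp only [map_mul, map_add, map_pow, Derivation.leibniz, h0, smul_zero, add_zero, smul_add,
    smul_smul, mul_pow]
  have e1 : r x ^ p * r y ^ (p - 1) = r x ^ (p - 1) * r y ^ (p - 1) * r x := by
    conv_lhs => rw [hm, pow_succ, Nat.add_sub_cancel]
    rw [hm, Nat.add_sub_cancel]; ring
  have e2 : r y ^ p * r x ^ (p - 1) = r x ^ (p - 1) * r y ^ (p - 1) * r y := by
    conv_lhs => rw [hm, pow_succ, Nat.add_sub_cancel]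
    rw [hm, Nat.add_sub_cancel]; ring
  rw [e1, e2]
  abel

theorem extD_divD [hp : Fact p.Prime] (a : A) :
    extD k A (ExteriorAlgebra.ι A (H.divD (k := k) a)) = 0 := by
  obtain ⟨x, rfl⟩ := H.surjective a
  obtain ⟨u, hu⟩ := H.exists_delta x
  rw [H.divD_eq hu, map_add, map_smul]
  change extD k A (_ • dOne k (r x) + dOne k (r u)) = 0
  rw [map_add, extD_smul, extD_dOne, extD_dOne, smul_zero, add_zero, add_zero, dOne,
    Derivation.leibniz_pow, map_nsmul, map_smul, smul_mul_assoc, smul_mul_assoc,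
    ← dOne, dOne, ExteriorAlgebra.ι_sq_zero, smul_zero, smul_zero]

end base

end IsFrobLift

/-- The exterior algebra `⋀ Ω_{A/k}` with the `A`-algebra structure given by the Frobenius
endomorphism of `A`. -/
def FrobForms (p : ℕ) (k A : Type*) [CommRing k] [CommRing A] [Algebra k A]
    (_ : (p : A) = 0) : Type _ := Forms k A

section frobForms

variable [CommRing k] [Algebra k A] {h : (p : A) = 0}

instance : Ring (FrobForms p k A h) := inferInstanceAs (Ring (Forms k A))

instance [Fact p.Prime] : Algebra A (FrobForms p k A h) :=
  ((algebraMap A (Forms k A)).comp (powHom p A h)).toAlgebra' (fun c x =>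
    Algebra.commutes (A := Forms k A) (c ^ p) x)

instance [Fact p.Prime] : Algebra k (FrobForms p k A h) :=
  (((algebraMap A (Forms k A)).comp (powHom p A h)).comp (algebraMap k A)).toAlgebra' (fun c x =>
    Algebra.commutes (A := Forms k A) (algebraMap k A c ^ p) x)

instance [Fact p.Prime] : IsScalarTower k A (FrobForms p k A h) :=
  IsScalarTower.of_algebraMap_eq fun _ => rfl

theorem FrobForms.smul_def [Fact p.Prime] (a : A) (x : FrobForms p k A h) :
    a • x = (a ^ p • (show Forms k A from x) : Forms k A) := by
  rw [Algebra.smul_def, Algebra.smul_def]; rfl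

end frobForms

namespace IsFrobLift

variable {r : T →+* A} {Ψ : T →+* T} (H : IsFrobLift p r Ψ) [Fact p.Prime] [Field k] [CharP k p]
  [PerfectRing k p] [Algebra k A]

/-- `divD` as a derivation with values in the one-forms, viewed as an `A`-module through the
Frobenius endomorphism. It is linear over the perfect field `k` since constants are
`p`-th powers. -/
def divDer : Derivation k A (FrobForms p k A H.char) :=
  Derivation.mk'
    { toFun := fun a => (ExteriorAlgebra.ι A (H.divD (k := k) a) : Forms k A)
      map_add' := fun a b => by rw [H.divD_add, map_add]; rfl
      map_smul' := fun c a => by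
        obtain ⟨e, rfl⟩ := (frobeniusEquiv k p).surjective c
        -- Constants are `p`-th powers, and `divD` kills those in characteristic `p`.
        have hc : H.divD (k := k) (algebraMap k A (frobeniusEquiv k p e)) = 0 := by
          have h1 : ∀ (m : ℕ) (x : A), H.divD (k := k) (x ^ (m + 1)) =
              ((m + 1 : ℕ) : A) • ((x ^ m) ^ p • H.divD (k := k) x) := by
            intro m x
            induction m with
            | zero => simp
            | succ m ih =>
              rw [pow_succ, H.divD_mul, ih, smul_smul, smul_smul, smul_smul, ← add_smul]
              congr 1
              push_cast
              ring
          rw [frobeniusEquiv_apply, frobenius_def, map_pow]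
          have h2 := h1 (p - 1) (algebraMap k A e)
          rw [Nat.sub_add_cancel (Fact.out : p.Prime).one_le, H.char, zero_smul] at h2
          exact h2
        rw [RingHom.id_apply, Algebra.smul_def, H.divD_mul, hc, smul_zero, add_zero, map_smul]
        exact Algebra.smul_def (A := Forms k A) _ _ }
    (fun a b => by
      change (ExteriorAlgebra.ι A (H.divD (k := k) (a * b)) : Forms k A) = _
      rw [H.divD_mul, map_add, map_smul, map_smul, FrobForms.smul_def, FrobForms.smul_def]
      rfl)

theorem divDer_apply (a : A) :
    H.divDer a = (ExteriorAlgebra.ι A (H.divD (k := k) a) : Forms k A) := rfl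

/-- The linear extension of `divDer` takes one-forms to one-forms, so its values square to zero. -/
theorem divLin_mem (w : Ω[A⁄k]) : ∃ v, (H.divDer (k := k)).liftKaehlerDifferential w =
    (ExteriorAlgebra.ι A v : Forms k A) := by
  have hw : w ∈ Submodule.span A (Set.range (KaehlerDifferential.D k A)) := by
    rw [KaehlerDifferential.span_range_derivation]; trivial
  induction hw using Submodule.span_induction with
  | zero => exact ⟨0, by rw [map_zero, map_zero]; rfl⟩
  | add u v _ _ hu hv =>
    obtain ⟨u', hu⟩ := hu
    obtain ⟨v', hv⟩ := hv
    exact ⟨u' + v', by rw [map_add, map_add, hu, hv]; rfl⟩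
  | smul a u _ hu =>
    obtain ⟨u', hu⟩ := hu
    exact ⟨a ^ p • u', by rw [map_smul, hu, map_smul]; exact FrobForms.smul_def (h := H.char) a _⟩
  | mem u hu =>
    obtain ⟨a, rfl⟩ := hu
    exact ⟨H.divD a, by rw [Derivation.liftKaehlerDifferential_comp_D, divDer_apply]⟩

/-- The divided Frobenius as an algebra homomorphism. -/
def divFrobAlg : Forms k A →ₐ[A] FrobForms p k A H.char :=
  ExteriorAlgebra.lift A ⟨(H.divDer (k := k)).liftKaehlerDifferential, fun w => by
    obtain ⟨v, hv⟩ := H.divLin_mem w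
    rw [hv]
    exact ExteriorAlgebra.ι_sq_zero v⟩

/-- The divided Frobenius: the ring endomorphism of `⋀ Ω_{A/k}` that is the Frobenius
endomorphism in degree zero and `p⁻¹ Ψ^*` in degree one. -/
def divFrob : Forms k A →+* Forms k A := (H.divFrobAlg (k := k)).toRingHom

theorem divFrob_algebraMap (a : A) :
    H.divFrob (k := k) (algebraMap A _ a) = algebraMap A _ (a ^ p) :=
  (H.divFrobAlg (k := k)).commutes a

theorem divFrob_ι (w : Ω[A⁄k]) : H.divFrob (ExteriorAlgebra.ι A w) =
    (H.divDer (k := k)).liftKaehlerDifferential w :=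
  ExteriorAlgebra.lift_ι_apply (A := FrobForms p k A H.char) _ _ _ _

theorem divFrob_dOne (a : A) :
    H.divFrob (dOne k a) = ExteriorAlgebra.ι A (H.divD (k := k) a) := by
  rw [dOne, divFrob_ι, Derivation.liftKaehlerDifferential_comp_D, divDer_apply]

theorem divFrob_smul (a : A) (x : Forms k A) :
    H.divFrob (a • x) = a ^ p • H.divFrob x := by
  rw [Algebra.smul_def, map_mul, divFrob_algebraMap, Algebra.smul_def]

theorem divFrob_closed (x : Forms k A) : extD k A (H.divFrob x) = 0 := by
  induction x using ExteriorAlgebra.induction with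
  | algebraMap a => rw [divFrob_algebraMap, extD_algebraMap, dOne_pow_char k A p H.char]
  | ι w =>
    have hw : w ∈ Submodule.span A (Set.range (KaehlerDifferential.D k A)) := by
      rw [KaehlerDifferential.span_range_derivation]; trivial
    induction hw using Submodule.span_induction with
    | zero => rw [map_zero, map_zero, map_zero]
    | add u v _ _ hu hv => rw [map_add, map_add, map_add, hu, hv, add_zero]
    | smul a u _ hu =>
      rw [map_smul, divFrob_smul, extD_smul, hu, dOne_pow_char k A p H.char, zero_mul, smul_zero,
        add_zero]
    | mem u hu =>
      obtain ⟨a, rfl⟩ := hu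
      change extD k A (H.divFrob (dOne k a)) = 0
      rw [divFrob_dOne, extD_divD]
  | mul x y hx hy => rw [map_mul, extD_mul_of_closed k hx hy]
  | add x y hx hy => rw [map_add, map_add, hx, hy, add_zero]

end IsFrobLift

end divided

/-! ### The divided Frobenius on one-forms -/

section formsMapLemmas

variable {R A S B : Type*} [CommRing R] [CommRing A] [Algebra R A] [CommRing S] [CommRing B]
  [Algebra S B]

theorem formsMap_smul (b : R →+* S) (g : A →+* B)
    (h : ∀ r, g (algebraMap R A r) = algebraMap S B (b r)) (a : A) (x : Forms R A) :
    formsMap b g h (a • x) = g a • formsMap b g h x := by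
  rw [Algebra.smul_def, map_mul, formsMap_algebraMap, Algebra.smul_def]

theorem kaehlerDifferential_induction {P : Ω[A⁄R] → Prop} (h0 : P 0)
    (hadd : ∀ u v, P u → P v → P (u + v))
    (hsmul : ∀ (a : A) u, P u → P (a • u)) (hD : ∀ a, P (KaehlerDifferential.D R A a))
    (w : Ω[A⁄R]) : P w := by
  have hw : w ∈ Submodule.span A (Set.range (KaehlerDifferential.D R A)) := by
    rw [KaehlerDifferential.span_range_derivation]; trivial
  induction hw using Submodule.span_induction with
  | zero => exact h0
  | add u v _ _ hu hv => exact hadd u v hu hv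
  | smul a u _ hu => exact hsmul a u hu
  | mem u hu => obtain ⟨a, rfl⟩ := hu; exact hD a

/-- A ring homomorphism between algebras of forms is determined by the images of functions and
of exact one-forms. -/
theorem forms_ringHom_ext {E : Type*} [Ring E] {g g' : Forms R A →+* E}
    (h : ∀ a, g (algebraMap A _ a) = g' (algebraMap A _ a))
    (h' : ∀ a, g (dOne R a) = g' (dOne R a)) : g = g' := by
  ext x
  induction x using ExteriorAlgebra.induction with
  | algebraMap a => exact h a
  | ι w =>
    induction w using kaehlerDifferential_induction with
    | h0 => simp
    | hadd u v hu hv => rw [map_add, map_add, map_add, hu, hv]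
    | hsmul a u hu => rw [map_smul, Algebra.smul_def, map_mul, map_mul, hu, h]
    | hD a => exact h' a
  | mul x y hx hy => rw [map_mul, map_mul, hx, hy]
  | add x y hx hy => rw [map_add, map_add, hx, hy]

theorem inverse_map_of_isUnit {A B : Type*} [CommRing A] [CommRing B] (g : A →+* B) {t : A}
    (ht : IsUnit t) : Ring.inverse (g t) = g (Ring.inverse t) := by
  obtain ⟨u, rfl⟩ := ht
  rw [Ring.inverse_unit]
  have : g u = (Units.map (g : A →* B) u : Bˣ) := rfl
  rw [this, Ring.inverse_unit, ← map_inv]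
  rfl

theorem formsMap_dlog (b : R →+* S) (g : A →+* B)
    (h : ∀ r, g (algebraMap R A r) = algebraMap S B (b r)) {t : A} (ht : IsUnit t) :
    formsMap b g h (dlog R t) = dlog S (g t) := by
  rw [dlog, formsMap_smul, formsMap_dOne, dlog, inverse_map_of_isUnit g ht]

theorem dlog_mul {t v : A} (ht : IsUnit t) (hv : IsUnit v) :
    dlog R (v * t) = dlog R t + Ring.inverse v • dOne R v := by
  have h1 : Ring.inverse t * t = 1 := Ring.inverse_mul_cancel t ht
  have h2 : Ring.inverse v * v = 1 := Ring.inverse_mul_cancel v hv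
  have h3 : Ring.inverse (v * t) = Ring.inverse v * Ring.inverse t := by
    have h4 := Ring.inverse_mul_cancel _ (hv.mul ht)
    calc Ring.inverse (v * t) = Ring.inverse (v * t) * ((Ring.inverse v * v) *
          (Ring.inverse t * t)) := by rw [h1, h2]; ring
      _ = (Ring.inverse (v * t) * (v * t)) * (Ring.inverse v * Ring.inverse t) := by ring
      _ = _ := by rw [h4, one_mul]
  rw [dlog, dlog, dOne_mul, h3, smul_add, smul_smul, smul_smul]
  congr 2
  · linear_combination (Ring.inverse t) * h2
  · linear_combination (Ring.inverse v) * h1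

end formsMapLemmas

namespace IsFrobLift

variable {p : ℕ} {k T A : Type*} [CommRing T] [CommRing A]
variable {r : T →+* A} {Ψ : T →+* T} (H : IsFrobLift p r Ψ) [Fact p.Prime] [Field k] [CharP k p]
  [PerfectRing k p] [Algebra k A]

/-- If `Ψ t̃ = t̃ ^ p (1 + p w)`, then `d t / t` goes to `d t / t + d w`. -/
theorem divFrob_dlog {x w : T} (hx : Ψ x = x ^ p * (1 + p * w)) (hu : IsUnit (r x)) :
    H.divFrob (dlog k (r x)) = dlog k (r x) + dOne k (r w) := by
  have h1 : Ψ x = x ^ p + p * (x ^ p * w) := by rw [hx]; ring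
  have h2 : Ring.inverse (r x) * r x = 1 := Ring.inverse_mul_cancel _ hu
  have h3 : Ring.inverse (r x) ^ p * r x ^ p = 1 := by rw [← mul_pow, h2, one_pow]
  have h4 : Ring.inverse (r x) ^ p * r x ^ (p - 1) = Ring.inverse (r x) := by
    obtain ⟨m, hm⟩ : ∃ m, p = m + 1 := ⟨p - 1, by have := (Fact.out : p.Prime).pos; omega⟩
    rw [hm, Nat.add_sub_cancel, pow_succ, mul_right_comm, ← mul_pow, h2, one_pow, one_mul]
  rw [dlog, divFrob_smul, divFrob_dOne, H.divD_eq h1, map_mul, map_pow, map_add, map_smul]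
  change _ • (_ • dOne k (r x) + dOne k (r x ^ p * r w)) = _
  rw [dOne_mul, dOne_pow_char k A p H.char, smul_zero, add_zero, smul_add, smul_smul, smul_smul,
    h3, h4, one_smul]

theorem divFrob_dOne_eq {x u : T} (hx : Ψ x = x ^ p + p * u) :
    H.divFrob (dOne k (r x)) = r x ^ (p - 1) • dOne k (r x) + dOne k (r u) := by
  rw [divFrob_dOne, H.divD_eq hx, map_add, map_smul]
  rfl

section degreeOne

variable {R : Type*} [CommRing R] [Algebra R T]

include H in
/-- A one-form on `T` that reduces to zero is killed by `p`, because `p • d` factors through a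
derivation of `A`, and thus through the one-forms on `A`. -/
theorem nsmul_eq_zero_of_map_eq_zero (b : R →+* k)
    (hb : ∀ c, r (algebraMap R T c) = algebraMap k A (b c)) (w : Ω[T⁄R])
    (hw : formsMap b r hb (ExteriorAlgebra.ι T w) = 0) : p • w = 0 := by
  -- The `p`-torsion `N` of the one-forms on `T` is an `A`-module, and it contains all `p • dx`.
  let N : Submodule T Ω[T⁄R] := Submodule.torsionBy T Ω[T⁄R] (p : T)
  let I := RingHom.ker r
  have hI : Module.IsTorsionBySet T N (I : Set T) := by
    rintro ⟨n, hn⟩ ⟨x, hx⟩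
    obtain ⟨y, rfl⟩ := H.exists_of_eq_zero x hx
    apply Subtype.ext
    change ((p : T) * y) • n = 0
    rw [mul_comm, mul_smul, (Submodule.mem_torsionBy_iff _ _).mp hn, smul_zero]
  let : Module (T ⧸ I) N := hI.module
  let e : T ⧸ I ≃+* A := RingHom.quotientKerEquivOfSurjective H.surjective
  let : Module A N := Module.compHom N e.symm.toRingHom
  have hsmul : ∀ (x : T) (n : N), r x • n = x • n := by
    intro x n
    have : e.symm (r x) = Ideal.Quotient.mk I x := by
      rw [RingEquiv.symm_apply_eq]; rfl
    change e.symm (r x) • n = _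
    rw [this]
    rfl
  let : Module k N := Module.compHom N (algebraMap k A)
  have : IsScalarTower k A N := ⟨fun c a n => by
    change (c • a) • n = algebraMap k A c • (a • n)
    rw [Algebra.smul_def, mul_smul]⟩
  let g : T → N := fun x => ⟨p • KaehlerDifferential.D R T x, by
    rw [Submodule.mem_torsionBy_iff, ← Nat.cast_smul_eq_nsmul T, smul_smul, H.sq_zero, zero_smul]⟩
  have hg : ∀ x y, r x = r y → g x = g y := by
    intro x y hxy
    obtain ⟨z, hz⟩ := H.exists_of_eq_zero (x - y) (by rw [map_sub, hxy, sub_self])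
    apply Subtype.ext
    change p • KaehlerDifferential.D R T x = p • KaehlerDifferential.D R T y
    rw [← sub_eq_zero, ← smul_sub, ← map_sub, hz, Derivation.leibniz, Derivation.map_natCast,
      smul_zero, add_zero, ← Nat.cast_smul_eq_nsmul T, smul_smul, H.sq_zero, zero_smul]
  have hgadd : ∀ x y, g (x + y) = g x + g y := fun x y => Subtype.ext (by
    change p • KaehlerDifferential.D R T (x + y) = _ + _
    rw [map_add, smul_add])
  have hgmul : ∀ x y, g (x * y) = x • g y + y • g x := fun x y => Subtype.ext (by
    change p • KaehlerDifferential.D R T (x * y) = x • (p • _) + y • (p • _)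
    rw [Derivation.leibniz, smul_add, smul_comm, smul_comm p y])
  let s : A → T := fun a => (H.surjective a).choose
  have hs : ∀ a, r (s a) = a := fun a => (H.surjective a).choose_spec
  let G : A → N := fun a => g (s a)
  have hG : ∀ x, G (r x) = g x := fun x => hg _ _ (hs _)
  have hGadd : ∀ a b, G (a + b) = G a + G b := by
    intro a b
    obtain ⟨x, rfl⟩ := H.surjective a
    obtain ⟨y, rfl⟩ := H.surjective b
    rw [← map_add, hG, hG, hG, hgadd]
  have hGmul : ∀ a b, G (a * b) = a • G b + b • G a := by
    intro a b
    obtain ⟨x, rfl⟩ := H.surjective a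
    obtain ⟨y, rfl⟩ := H.surjective b
    rw [← map_mul, hG, hG, hG, hgmul, hsmul, hsmul]
  have hpN : ∀ n : N, p • n = 0 := fun n => Subtype.ext (by
    have := (Submodule.mem_torsionBy_iff _ _).mp n.2
    rwa [Nat.cast_smul_eq_nsmul] at this)
  have hGpow : ∀ (m : ℕ) (x : A), G (x ^ (m + 1)) = (m + 1) • (x ^ m • G x) := by
    intro m x
    induction m with
    | zero => simp
    | succ m ih =>
      rw [pow_succ, hGmul, ih, smul_comm x (m + 1), smul_smul x, ← pow_succ', add_smul (m + 1) 1,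
        one_smul, add_comm]
  let D : Derivation k A N := Derivation.mk'
    { toFun := G
      map_add' := hGadd
      map_smul' := fun c a => by
        obtain ⟨e, rfl⟩ := (frobeniusEquiv k p).surjective c
        have h1 : G (algebraMap k A (frobeniusEquiv k p e)) = 0 := by
          rw [frobeniusEquiv_apply, frobenius_def, map_pow]
          have h2 := hGpow (p - 1) (algebraMap k A e)
          rwa [Nat.sub_add_cancel (Fact.out : p.Prime).one_le, hpN] at h2
        rw [RingHom.id_apply, Algebra.smul_def, hGmul, h1, smul_zero, add_zero]
        rfl } hGmul
  have key : ∀ w : Ω[T⁄R], ∃ v, formsMap b r hb (ExteriorAlgebra.ι T w) = ExteriorAlgebra.ι A v ∧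
      (D.liftKaehlerDifferential v : Ω[T⁄R]) = p • w := by
    intro w
    induction w using kaehlerDifferential_induction with
    | h0 => exact ⟨0, by simp, by simp⟩
    | hadd u v hu hv =>
      obtain ⟨u', hu, hu'⟩ := hu
      obtain ⟨v', hv, hv'⟩ := hv
      refine ⟨u' + v', by rw [map_add, map_add, map_add, hu, hv], ?_⟩
      rw [map_add, Submodule.coe_add, hu', hv', smul_add]
    | hsmul a u hu =>
      obtain ⟨u', hu, hu'⟩ := hu
      refine ⟨r a • u', by rw [map_smul, formsMap_smul, hu, map_smul], ?_⟩
      rw [map_smul, hsmul, Submodule.coe_smul, hu', smul_comm]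
    | hD a =>
      refine ⟨_, formsMap_dOne b r hb a, ?_⟩
      rw [Derivation.liftKaehlerDifferential_comp_D]
      exact congrArg Subtype.val (hG a)
  obtain ⟨v, hv, hv'⟩ := key w
  rw [hw] at hv
  have : v = 0 := ExteriorAlgebra.ι_leftInverse.injective (by rw [← hv, map_zero])
  rw [← hv', this, map_zero]
  rfl

include H in
theorem nsmul_ι_eq_of_map_eq (b : R →+* k)
    (hb : ∀ c, r (algebraMap R T c) = algebraMap k A (b c)) (v w : Ω[T⁄R])
    (hw : formsMap b r hb (ExteriorAlgebra.ι T v) = formsMap b r hb (ExteriorAlgebra.ι T w)) :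
    p • ExteriorAlgebra.ι T v = p • ExteriorAlgebra.ι T w := by
  rw [← sub_eq_zero, ← smul_sub, ← map_sub, ← map_nsmul,
    H.nsmul_eq_zero_of_map_eq_zero b hb (v - w), map_zero]
  rw [map_sub, map_sub, hw, sub_self]

/-- On one-forms, the divided Frobenius is the reduction of `p⁻¹ Φ^*`: the pullback of `w` along `Φ`
is `p • v` for some `v` whose reduction is the divided Frobenius of the reduction of `w`. Here `Φ`
starts from a ring `T'` that is only identified with `T` in so far as `hΦ` says. -/
theorem exists_divided {R' T' : Type*} [CommRing R'] [CommRing T'] [Algebra R' T'] (b : R →+* k)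
    (hb : ∀ c, r (algebraMap R T c) = algebraMap k A (b c)) (c : R' →+* R) (Φ : T' →+* T)
    (hc : ∀ x, Φ (algebraMap R' T' x) = algebraMap R T (c x)) (ρ₀ : T' →+* A)
    (ρ : Forms R' T' →+* Forms k A) (hρ : ∀ a, ρ (algebraMap T' _ a) = algebraMap A _ (ρ₀ a))
    (hρ' : ∀ a, ρ (dOne R' a) = dOne k (ρ₀ a))
    (hΦ : ∀ a, ∃ x, Φ a = Ψ x ∧ r x = ρ₀ a) (w : Ω[T'⁄R']) :
    ∃ v : Ω[T⁄R], formsMap c Φ hc (ExteriorAlgebra.ι T' w) = p • ExteriorAlgebra.ι T v ∧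
      H.divFrob (ρ (ExteriorAlgebra.ι T' w)) = formsMap b r hb (ExteriorAlgebra.ι T v) := by
  induction w using kaehlerDifferential_induction with
  | h0 => exact ⟨0, by simp, by simp⟩
  | hadd u v hu hv =>
    obtain ⟨u', hu, hu'⟩ := hu
    obtain ⟨v', hv, hv'⟩ := hv
    refine ⟨u' + v', ?_, ?_⟩
    · rw [map_add, map_add, map_add, hu, hv, smul_add]
    · rw [map_add, map_add, map_add, map_add, map_add, hu', hv']
  | hsmul a u hu =>
    obtain ⟨u', hu, hu'⟩ := hu
    obtain ⟨x, hx, hx'⟩ := hΦ a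
    refine ⟨Φ a • u', ?_, ?_⟩
    · rw [map_smul, formsMap_smul, hu, map_smul, smul_comm]
    · rw [map_smul (ExteriorAlgebra.ι T'), map_smul (ExteriorAlgebra.ι T), formsMap_smul, ← hu',
        Algebra.smul_def, map_mul, map_mul, hρ, divFrob_algebraMap, hx, H.frob, hx',
        Algebra.smul_def]
  | hD a =>
    obtain ⟨x, hx, hx'⟩ := hΦ a
    obtain ⟨u, hu⟩ := H.exists_delta x
    refine ⟨x ^ (p - 1) • KaehlerDifferential.D R T x + KaehlerDifferential.D R T u, ?_, ?_⟩
    · refine (formsMap_dOne c Φ hc a).trans ?_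
      rw [hx, hu, dOne, ← map_nsmul]
      congr 1
      rw [map_add, Derivation.leibniz_pow, Derivation.leibniz, Derivation.map_natCast, smul_zero,
        add_zero, smul_add, Nat.cast_smul_eq_nsmul]
    · change H.divFrob (ρ (dOne R' a)) = _
      rw [hρ', ← hx', H.divFrob_dOne_eq hu, map_add, map_smul, map_add, formsMap_smul, map_pow]
      change _ = _ • formsMap b r hb (dOne R x) + formsMap b r hb (dOne R u)
      rw [formsMap_dOne, formsMap_dOne]

end degreeOne

end IsFrobLift

/-! ### The basic logarithmic forms in coordinates -/

section etaForms

variable (R : Type*) {B : Type*} [CommRing R] [CommRing B] [Algebra R B] {n : ℕ}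

open scoped Classical in
/-- The one-forms `d t / t` for `t` a coordinate with index in `S`, and `d t` for the other
coordinates. -/
def etaForm (S : Set (Fin n)) (t : Fin n → B) (i : Fin n) : Ω[B⁄R] :=
  if i ∈ S then Ring.inverse (t i) • KaehlerDifferential.D R B (t i)
  else KaehlerDifferential.D R B (t i)

variable {R}

theorem ι_etaForm_of_mem {S : Set (Fin n)} {t : Fin n → B} {i : Fin n} (h : i ∈ S) :
    ExteriorAlgebra.ι B (etaForm R S t i) = dlog R (t i) := by
  rw [etaForm, if_pos h, dlog_eq_ι]

theorem ι_etaForm_of_notMem {S : Set (Fin n)} {t : Fin n → B} {i : Fin n} (h : i ∉ S) :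
    ExteriorAlgebra.ι B (etaForm R S t i) = dOne R (t i) := by
  rw [etaForm, if_neg h, dOne]

theorem etaForm_closed (S : Set (Fin n)) (t : Fin n → B) (i : Fin n) :
    extD R B (ExteriorAlgebra.ι B (etaForm R S t i)) = 0 := by
  by_cases h : i ∈ S
  · rw [ι_etaForm_of_mem h, extD_dlog]
  · rw [ι_etaForm_of_notMem h, extD_dOne]

/-- The vector field `t_i ∂ / ∂ t_i`. -/
def eulerField {t : Fin n → B} (b : Module.Basis (Fin n) B Ω[B⁄R]) (i : Fin n) :
    Ω[B⁄R] →ₗ[B] B := t i • b.coord i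

theorem eulerField_D {t : Fin n → B} {b : Module.Basis (Fin n) B Ω[B⁄R]}
    (hb : ∀ i, b i = KaehlerDifferential.D R B (t i)) (i j : Fin n) :
    eulerField (t := t) b i (KaehlerDifferential.D R B (t j)) = if j = i then t i else 0 := by
  rw [eulerField, LinearMap.smul_apply, ← hb, Module.Basis.coord_apply, Module.Basis.repr_self,
    Finsupp.single_apply, smul_eq_mul, mul_ite, mul_one, mul_zero]

open scoped Classical in
/-- The weight of the `j`-th basic one-form under the `i`-th Euler vector field. -/
def etaWeight (S : Set (Fin n)) (i j : Fin n) : ℕ := if j = i ∧ i ∉ S then 1 else 0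

variable {S : Set (Fin n)} {t : Fin n → B} {b : Module.Basis (Fin n) B Ω[B⁄R]}
  (hb : ∀ i, b i = KaehlerDifferential.D R B (t i)) (hS : ∀ i ∈ S, IsUnit (t i))

include hb hS

theorem eulerField_etaForm (i j : Fin n) :
    eulerField (t := t) b i (etaForm R S t j) =
      if j = i then (open scoped Classical in if i ∈ S then 1 else t i) else 0 := by
  rw [etaForm]
  by_cases hij : j = i
  · subst hij
    by_cases h : j ∈ S
    · rw [if_pos h, map_smul, eulerField_D hb, if_pos rfl, if_pos rfl, if_pos h, smul_eq_mul,
        Ring.inverse_mul_cancel _ (hS j h)]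
    · rw [if_neg h, eulerField_D hb, if_pos rfl, if_pos rfl, if_neg h]
  · split_ifs with h
    · rw [map_smul, eulerField_D hb, if_neg hij, smul_zero]
    · rw [eulerField_D hb, if_neg hij]

theorem dOne_eulerField_etaForm (i j : Fin n) :
    dOne R (eulerField (t := t) b i (etaForm R S t j)) =
      etaWeight S i j • ExteriorAlgebra.ι B (etaForm R S t j) := by
  rw [eulerField_etaForm hb hS, etaWeight]
  by_cases hij : j = i
  · subst hij
    by_cases h : j ∈ S
    · simp [h, dOne_one]
    · rw [if_pos rfl, if_neg h, if_pos ⟨rfl, h⟩, one_smul, ι_etaForm_of_notMem h]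
  · simp [hij, dOne_zero]

/-- The basic logarithmic forms are eigenvectors of the Lie derivatives along the Euler vector
fields. -/
theorem lie_monomial {p : ℕ} (hp : (p : B) = 0) (i : Fin n) (β : Fin n → ℕ) (c : B)
    (J : List (Fin n)) :
    extD R B (contr R (eulerField (t := t) b i)
        (((∏ j, t j ^ β j) * c ^ p) • word (etaForm R S t) J)) +
      contr R (eulerField (t := t) b i)
        (extD R B (((∏ j, t j ^ β j) * c ^ p) • word (etaForm R S t) J)) =
      (β i + (J.map (etaWeight S i)).sum) •
        (((∏ j, t j ^ β j) * c ^ p) • word (etaForm R S t) J) := by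
  refine lie_smul_word _ (etaForm_closed S t) (dOne_eulerField_etaForm hb hS i) J ?_
  let v : Derivation R B B :=
    (eulerField (t := t) b i).compDer (KaehlerDifferential.D R B)
  exact derivation_monomial hp v t i (fun j => eulerField_D hb i j) β c

/-- Ordered products of the basic logarithmic one-forms are linearly independent. -/
theorem etaWord_linearIndependent {m : ℕ} (c : Set.powersetCard (Fin n) m → B)
    (h : ∑ J, c J • word (etaForm R S t)
      (List.ofFn (Set.powersetCard.ofFinEmbEquiv.symm J)) = 0) (J : Set.powersetCard (Fin n) m) :
    c J = 0 := by
  classical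
  let w : Fin n → Bˣ := fun i => if h : i ∈ S then (hS i h).unit⁻¹ else 1
  let b' := b.unitsSMul w
  have hb' : ∀ i, b' i = etaForm R S t i := by
    intro i
    rw [Module.Basis.unitsSMul_apply, hb, etaForm]
    by_cases hi : i ∈ S
    · simp only [w, hi, if_true, dif_pos]
      rw [Units.smul_def]
      congr 1
      conv_rhs => rw [← (hS i hi).unit_spec]
      rw [Ring.inverse_unit]
    · simp only [w, hi, if_false, dif_neg, not_false_eq_true, one_smul]
  have hlin : LinearIndependent B (fun J : Set.powersetCard (Fin n) m =>
      b'.ExteriorAlgebra (J : Finset (Fin n))) :=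
    b'.ExteriorAlgebra.linearIndependent.comp _ Subtype.val_injective
  refine Fintype.linearIndependent_iff.mp hlin c ?_ J
  rw [← h]
  refine Finset.sum_congr rfl fun J _ => ?_
  rw [ExteriorAlgebra.basis_apply_powersetCard, ExteriorAlgebra.ιMulti_family,
    ExteriorAlgebra.ιMulti_apply, word,
    List.map_ofFn]
  congr 3
  funext i
  exact congrArg _ (hb' _)

end etaForms

section wordHom

variable {A B R : Type*} [CommRing A] [CommRing B] [CommRing R] [Algebra R B] {n : ℕ}

/-- The ring homomorphism from the exterior algebra of a free module to the algebra of forms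
that is given by a ring homomorphism on coefficients and one-forms as images of the basis. -/
def wordHom (g : A →+* B) (η : Fin n → Ω[B⁄R]) :
    ExteriorAlgebra A (Fin n → A) →+* Forms R B :=
  letI := g.toAlgebra
  (ExteriorAlgebra.lift A
    ⟨(ExteriorAlgebra.ι B).restrictScalars A ∘ₗ Fintype.linearCombination A η,
      fun _ => ExteriorAlgebra.ι_sq_zero _⟩ :
    ExteriorAlgebra A (Fin n → A) →ₐ[A] Forms R B).toRingHom

theorem wordHom_algebraMap (g : A →+* B) (η : Fin n → Ω[B⁄R]) (a : A) :
    wordHom g η (algebraMap A _ a) = algebraMap B _ (g a) := by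
  let := g.toAlgebra
  exact (AlgHom.commutes _ a).trans (IsScalarTower.algebraMap_apply A B (Forms R B) a)

theorem wordHom_smul (g : A →+* B) (η : Fin n → Ω[B⁄R]) (a : A)
    (x : ExteriorAlgebra A (Fin n → A)) : wordHom g η (a • x) = g a • wordHom g η x := by
  rw [Algebra.smul_def, map_mul, wordHom_algebraMap, Algebra.smul_def]

theorem wordHom_ι (g : A →+* B) (η : Fin n → Ω[B⁄R]) (a : Fin n → A) :
    wordHom g η (ExteriorAlgebra.ι A a) = ∑ i, g (a i) • ExteriorAlgebra.ι B (η i) := by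
  let := g.toAlgebra
  refine (ExteriorAlgebra.lift_ι_apply _ _ _ _).trans ?_
  simp only [LinearMap.comp_apply, Fintype.linearCombination_apply, LinearMap.restrictScalars_apply,
    map_sum]
  refine Finset.sum_congr rfl fun i _ => ?_
  exact map_smul (ExteriorAlgebra.ι B) (g (a i)) (η i)

theorem wordHom_ofFn (g : A →+* B) (η : Fin n → Ω[B⁄R]) {m : ℕ} (v : Fin m → Fin n → A) :
    wordHom g η (ExteriorAlgebra.ιMulti A m v) =
      (List.ofFn fun j => ∑ i, g (v j i) • ExteriorAlgebra.ι B (η i)).prod := by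
  rw [ExteriorAlgebra.ιMulti_apply, map_list_prod, List.map_ofFn]
  congr 2
  funext j
  exact wordHom_ι g η (v j)

/-- Coefficients, independent of `g` and `η`, that expand a product of linear combinations of
the `η i` into ordered products of the `η i`. -/
theorem exists_expand (A : Type*) [CommRing A] {n m : ℕ} (v : Fin m → Fin n → A) :
    ∃ c : Set.powersetCard (Fin n) m → A,
      ∀ {B R : Type*} [CommRing B] [CommRing R] [Algebra R B] (g : A →+* B) (η : Fin n → Ω[B⁄R]),
        (List.ofFn fun j => ∑ i, g (v j i) • ExteriorAlgebra.ι B (η i)).prod =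
          ∑ J, g (c J) • word η (List.ofFn (Set.powersetCard.ofFinEmbEquiv.symm J)) := by
  classical
  let b := (Pi.basisFun A (Fin n)).exteriorPower m
  let x : ⋀[A]^m (Fin n → A) := exteriorPower.ιMulti A m v
  refine ⟨fun J => b.repr x J, fun g η => ?_⟩
  have hx : ExteriorAlgebra.ιMulti A m v =
      ∑ J, b.repr x J • ExteriorAlgebra.ιMulti_family A m (Pi.basisFun A (Fin n)) J := by
    have h1 := congrArg Subtype.val (b.sum_repr x)
    rw [← exteriorPower.ιMulti_apply_coe, ← h1]
    rw [AddSubmonoidClass.coe_finsetSum]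
    refine Finset.sum_congr rfl fun J _ => ?_
    rw [Submodule.coe_smul, exteriorPower.basis_apply, exteriorPower.ιMulti_family_apply_coe]
  rw [← wordHom_ofFn, hx, map_sum]
  refine Finset.sum_congr rfl fun J _ => ?_
  rw [wordHom_smul, wordHom_ofFn, word, List.map_ofFn]
  congr 3
  funext j
  simp [Pi.single_apply]

end wordHom

/-! ### Logarithmic charts -/

section logChart

open MvPolynomial

theorem formallyEtale_of_etale {A B : Type*} [CommRing A] [CommRing B] {φ : A →+* B}
    (h : φ.Etale) : φ.FormallyEtale := by
  let := φ.toAlgebra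
  have : Algebra.Etale A B := h
  exact (inferInstance : Algebra.FormallyEtale A B)

theorem finiteType_of_etale {A B : Type*} [CommRing A] [CommRing B] {φ : A →+* B}
    (h : φ.Etale) : φ.FiniteType := by
  let := φ.toAlgebra
  have : Algebra.Etale A B := h
  exact (inferInstance : Algebra.FiniteType A B)

/-- Families of forms on a family of `k`-algebras `B y`, where a value at `y` is asked for only
in the presence of an element of `P y`. -/
abbrev FormFamily (k : Type*) [CommRing k] {Y : Type*} (P : Y → Type*) (B : Y → Type*)
    [∀ y, CommRing (B y)] [∀ y, Algebra k (B y)] : Type _ :=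
  (y : Y) → P y → Forms k (B y)

/-- Étale coordinates `t` on a `k`-algebra `A`, together with a jointly injective family of
`A`-algebras `B y` in which the coordinates `t i`, `i ∈ S`, are invertible. In the application `A`
is the ring of functions on an affine open, and the `B y` are its local rings off the zero locus
of the `t i`, `i ∈ S`. -/
structure LogChart {k A : Type*} [Field k] [CommRing A] (b : k →+* A) {Y : Type*}
    (P : Y → Type*) (B : Y → Type*) [∀ y, CommRing (B y)] [∀ y, Algebra k (B y)]
    (g : ∀ y, A →+* B y) {n : ℕ} (t : Fin n → A) (S : Set (Fin n)) where
  etale : (eval₂Hom b t).Etale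
  comp : ∀ y r, g y (b r) = algebraMap k (B y) r
  /-- the basis of the differentials of `B y` given by the coordinates -/
  basis : ∀ y, Module.Basis (Fin n) (B y) Ω[B y⁄k]
  basis_eq : ∀ y i, basis y i = KaehlerDifferential.D k (B y) (g y (t i))
  isUnit : ∀ y, P y → ∀ i ∈ S, IsUnit (g y (t i))
  injective : ∀ a, (∀ y, P y → g y a = 0) → a = 0

variable {k A : Type*} [Field k] [CommRing A] {b : k →+* A} {Y : Type*}
    {P : Y → Type*} {B : Y → Type*} [∀ y, CommRing (B y)] [∀ y, Algebra k (B y)]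
    {g : ∀ y, A →+* B y} {n : ℕ} {t : Fin n → A} {S : Set (Fin n)}

variable (k P) in
/-- The exterior derivative on families of forms. -/
def famD (B : Y → Type*) [∀ y, CommRing (B y)] [∀ y, Algebra k (B y)] :
    FormFamily k P B →+ FormFamily k P B where
  toFun s y h := extD k (B y) (s y h)
  map_zero' := by ext y h; exact map_zero (extD k (B y))
  map_add' s s' := by ext y h; exact map_add (extD k (B y)) _ _

theorem famD_apply (s : FormFamily k P B) (y : Y) (h : P y) :
    famD k P B s y h = extD k (B y) (s y h) := rfl

variable (k P g t S) in
/-- The forms `a • η_{j₁} ⋯ η_{jₘ}` with `η_j = dt_j / t_j` for `j ∈ S` and `η_j = dt_j`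
otherwise. -/
def logWord (a : A) (J : List (Fin n)) : FormFamily k P B :=
  fun y _ => g y a • word (etaForm k S fun i => g y (t i)) J

theorem logWord_add (a a' : A) (J : List (Fin n)) :
    logWord k P g t S (a + a') J = logWord k P g t S a J + logWord k P g t S a' J := by
  ext y h
  exact (congrArg (· • _) (map_add (g y) a a')).trans (add_smul _ _ _)

variable (k P g t S) in
/-- The logarithmic `m`-forms on a chart. -/
def logSpan (m : ℕ) : AddSubgroup (FormFamily k P B) :=
  AddSubgroup.closure {s | ∃ a J, J.length = m ∧ s = logWord k P g t S a J}

theorem logWord_mem {m : ℕ} (a : A) (J : List (Fin n)) (hJ : J.length = m) :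
    logWord k P g t S a J ∈ logSpan k P g t S m :=
  AddSubgroup.subset_closure ⟨a, J, hJ, rfl⟩

variable (k P g t S) in
/-- The logarithmic forms of degree one less than `m`. -/
def prevSpan : ℕ → AddSubgroup (FormFamily k P B)
  | 0 => ⊥
  | m + 1 => logSpan k P g t S m

theorem logSpan_induction {m : ℕ} {T : AddSubgroup (FormFamily k P B)}
    {F : FormFamily k P B →+ FormFamily k P B}
    (h : ∀ a J, J.length = m → F (logWord k P g t S a J) ∈ T) {x : FormFamily k P B}
    (hx : x ∈ logSpan k P g t S m) : F x ∈ T := by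
  have : logSpan k P g t S m ≤ T.comap F := by
    rw [logSpan, AddSubgroup.closure_le]
    rintro _ ⟨a, J, hJ, rfl⟩
    exact h a J hJ
  exact this hx

variable (k P g t S) in
/-- The logarithmic one-form with coefficients `c`. -/
def oneFam (c : Fin n → A) : FormFamily k P B :=
  fun y _ => ∑ i, g y (c i) • ExteriorAlgebra.ι (B y) (etaForm k S (fun i => g y (t i)) i)

theorem oneFam_mul_mem (c : Fin n → A) {m : ℕ} {x : FormFamily k P B}
    (hx : x ∈ logSpan k P g t S m) : oneFam k P g t S c * x ∈ logSpan k P g t S (m + 1) := by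
  refine logSpan_induction (F := AddMonoidHom.mulLeft (oneFam k P g t S c)) ?_ hx
  intro a J hJ
  have : oneFam k P g t S c * logWord k P g t S a J =
      ∑ i, logWord k P g t S (c i * a) (i :: J) := by
    ext y h
    rw [Finset.sum_apply, Finset.sum_apply]
    refine (Finset.sum_mul _ _ _).trans (Finset.sum_congr rfl fun i _ => ?_)
    refine (smul_mul_smul_comm (g y (c i)) _ (g y a) _).trans ?_
    rw [← map_mul, ← word_cons]
    rfl
  change oneFam k P g t S c * logWord k P g t S a J ∈ _
  rw [this]
  exact sum_mem fun i _ => logWord_mem _ _ (by simp [hJ])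

theorem smul_mem_logSpan (a : A) {m : ℕ} {x : FormFamily k P B}
    (hx : x ∈ logSpan k P g t S m) :
    (fun y h => g y a • x y h : FormFamily k P B) ∈ logSpan k P g t S m := by
  let F : FormFamily k P B →+ FormFamily k P B :=
    { toFun s y h := g y a • s y h
      map_zero' := by ext y h; exact smul_zero _
      map_add' s s' := by ext y h; exact smul_add _ _ _ }
  refine logSpan_induction (F := F) ?_ hx
  intro a' J hJ
  have : F (logWord k P g t S a' J) = logWord k P g t S (a * a') J := by
    ext y h
    change g y a • g y a' • (word _ J : Forms k (B y)) = g y (a * a') • (word _ J : Forms k (B y))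
    rw [smul_smul, map_mul]
  rw [this]
  exact logWord_mem _ _ hJ

namespace LogChart

variable (H : LogChart b P B g t S)
include H

/-- Differentials of functions are combinations of the basic logarithmic one-forms, with
coefficients in `A`, because `dt = t • dt / t`. -/
theorem exists_dOne (a : A) : ∃ c : Fin n → A, ∀ y, P y →
    dOne k (g y a) =
      ∑ i, g y (c i) • ExteriorAlgebra.ι (B y) (etaForm k S (fun i => g y (t i)) i) := by
  classical
  let := b.toAlgebra
  have het : (eval₂Hom (algebraMap k A) t).Etale := H.etale
  obtain ⟨bas, hbas⟩ := exists_basis_of_formallyEtale t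
    (formallyEtale_of_etale het)
  refine ⟨fun i => (if i ∈ S then t i else 1) * bas.repr (KaehlerDifferential.D k A a) i,
    fun y h => ?_⟩
  have h1 : dOne k a = ∑ i, bas.repr (KaehlerDifferential.D k A a) i • dOne k (t i) := by
    rw [dOne, ← bas.sum_repr (KaehlerDifferential.D k A a), map_sum]
    refine Finset.sum_congr rfl fun i _ => ?_
    rw [map_smul, hbas, bas.sum_repr]
    rfl
  have h2 := congrArg (formsMap (RingHom.id k) (g y) (fun r => H.comp y r)) h1
  rw [formsMap_dOne, map_sum] at h2
  rw [h2]
  refine Finset.sum_congr rfl fun i _ => ?_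
  rw [formsMap_smul, formsMap_dOne]
  dsimp only
  by_cases hi : i ∈ S
  · rw [if_pos hi, map_mul, ι_etaForm_of_mem hi, dlog, smul_smul, mul_comm (g y (t i)), mul_assoc,
      Ring.mul_inverse_cancel _ (H.isUnit y h i hi), mul_one]
  · rw [if_neg hi, one_mul, ι_etaForm_of_notMem hi]

omit H in
theorem famD_logWord (a : A) (J : List (Fin n)) :
    famD k P B (logWord k P g t S a J) =
      fun y _ => dOne k (g y a) * word (etaForm k S fun i => g y (t i)) J := by
  ext y h
  rw [famD_apply, logWord, extD_smul, word_closed (etaForm_closed S _), smul_zero, add_zero]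

omit H in
theorem famD_famD {m : ℕ} {x : FormFamily k P B} (hx : x ∈ logSpan k P g t S m) :
    famD k P B (famD k P B x) = 0 := by
  have := logSpan_induction (T := ⊥) (F := (famD k P B).comp (famD k P B)) ?_ hx
  · exact this
  intro a J hJ
  change famD k P B (famD k P B _) = 0
  rw [famD_logWord]
  ext y h
  exact extD_mul_of_closed k (extD_dOne k (B y) _) (word_closed (etaForm_closed S _) J)

omit H in
theorem famD_famD_prev {m : ℕ} {x : FormFamily k P B} (hx : x ∈ prevSpan k P g t S m) :
    famD k P B (famD k P B x) = 0 := by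
  cases m with
  | zero =>
    rw [show x = 0 from hx, map_zero, map_zero]
  | succ m => exact famD_famD hx

/-- Contraction with the Euler vector field `t_i ∂ / ∂ t_i`. -/
def famContr (i : Fin n) : FormFamily k P B →+ FormFamily k P B where
  toFun s y h := contr k (eulerField (t := fun i => g y (t i)) (H.basis y) i) (s y h)
  map_zero' := by ext y h; exact map_zero (contr k _)
  map_add' s s' := by ext y h; exact map_add (contr k _) _ _

/-- Contraction with an Euler vector field creates no denominators, as it takes `dt_i / t_i` to `1`.
-/
theorem famContr_mem (i : Fin n) {m : ℕ} {x : FormFamily k P B} (hx : x ∈ logSpan k P g t S m) :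
    H.famContr i x ∈ prevSpan k P g t S m := by
  classical
  refine logSpan_induction (F := H.famContr i) ?_ hx
  clear hx
  intro a J hJ
  have h0 : ∀ (a : A) J, H.famContr i (logWord k P g t S a J) =
      fun y h => g y a • contr k (eulerField (t := fun i => g y (t i)) (H.basis y) i)
        (word (etaForm k S fun i => g y (t i)) J) := by
    intro a J
    ext y h
    exact map_smul (contr k _) (g y a) _
  induction J generalizing a m with
  | nil =>
    have : H.famContr i (logWord k P g t S a []) = 0 := by
      rw [h0]
      ext y h
      rw [word_nil, contr_one, smul_zero]
      rfl
    rw [this]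
    exact zero_mem _
  | cons j J ih =>
    subst hJ
    have h1 : H.famContr i (logWord k P g t S a (j :: J)) =
        logWord k P g t S (a * if j = i then (if i ∈ S then 1 else t i) else 0) J -
          oneFam k P g t S (Pi.single j 1) * H.famContr i (logWord k P g t S a J) := by
      rw [h0, h0]
      ext y h
      rw [word_cons, contr_ι_mul, eulerField_etaForm (H.basis_eq y) (H.isUnit y h), smul_sub,
        smul_smul]
      change _ = g y (a * _) • (word _ J : Forms k (B y)) - (∑ i' : Fin n, _) * _
      congr 1
      · congr 1
        rw [map_mul]
        congr 1
        split_ifs <;> simp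
      · rw [Finset.sum_eq_single j]
        · rw [Pi.single_eq_same, map_one, one_smul, mul_smul_comm]
        · intro i' _ hi'
          rw [Pi.single_eq_of_ne hi', map_zero, zero_smul]
        · simp
    rw [h1]
    refine sub_mem (logWord_mem _ _ rfl) ?_
    have h2 := ih a (m := J.length) rfl
    cases J with
    | nil =>
      rw [show H.famContr i (logWord k P g t S a []) = 0 from h2, mul_zero]
      exact zero_mem _
    | cons j' J => exact oneFam_mul_mem _ h2

variable (p : ℕ) [Fact p.Prime] [CharP k p]

omit [Fact p.Prime] in
theorem lie_logWord (i : Fin n) (β : Fin n → ℕ) (c : A) (J : List (Fin n)) :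
    lieOp (famD k P B) (H.famContr i) (logWord k P g t S ((∏ j, t j ^ β j) * c ^ p) J) =
      (β i + (J.map (etaWeight S i)).sum) • logWord k P g t S ((∏ j, t j ^ β j) * c ^ p) J := by
  ext y h
  have := lie_monomial (H.basis_eq y) (H.isUnit y h) (natCast_eq_zero_of_hom p (algebraMap k (B y)))
    i β (g y c) J
  have h1 : g y ((∏ j, t j ^ β j) * c ^ p) = (∏ j, g y (t j) ^ β j) * g y c ^ p := by
    simp only [map_mul, map_prod, map_pow]
  rw [← h1] at this
  exact this

omit H [Fact p.Prime] in
theorem nsmul_eq_zero (x : FormFamily k P B) : p • x = 0 := by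
  ext y h
  change p • x y h = 0
  rw [← Nat.cast_smul_eq_nsmul (B y), natCast_eq_zero_of_hom p (algebraMap k (B y)), zero_smul]

variable [PerfectRing k p]

/-- Logarithmic forms are sums of eigenvectors of the Lie derivatives along the Euler vector
fields. -/
theorem logSpan_eq (m : ℕ) : logSpan k P g t S m = AddSubgroup.closure
    {s | ∃ a ∈ frobMonomials p t, ∃ J : List (Fin n), J.length = m ∧
      s = logWord k P g t S a J} := by
  apply le_antisymm
  · rw [logSpan, AddSubgroup.closure_le]
    rintro _ ⟨a, J, hJ, rfl⟩
    have ha := mem_closure_frobMonomials p b t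
      H.etale.formallyUnramified (finiteType_of_etale H.etale) a
    let F : A →+ FormFamily k P B := AddMonoidHom.mk' (fun a => logWord k P g t S a J)
      fun a a' => logWord_add a a' J
    have : AddSubgroup.closure (frobMonomials p t) ≤ (AddSubgroup.closure
      {s | ∃ a ∈ frobMonomials p t, ∃ J : List (Fin n), J.length = m ∧
        s = logWord k P g t S a J}).comap F := by
      rw [AddSubgroup.closure_le]
      exact fun a ha => AddSubgroup.subset_closure ⟨a, ha, J, hJ, rfl⟩
    exact this ha
  · refine AddSubgroup.closure_mono ?_
    rintro _ ⟨a, -, J, hJ, rfl⟩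
    exact ⟨a, J, hJ, rfl⟩

end LogChart

end logChart

/-! ### The Cartier isomorphism on a chart -/

section localCartier

open MvPolynomial

variable {k A : Type*} [Field k] [CommRing A] {b : k →+* A} {Y : Type*}
    {P : Y → Type*} {B : Y → Type*} [∀ y, CommRing (B y)] [∀ y, Algebra k (B y)]
    {g : ∀ y, A →+* B y} {n : ℕ} {t : Fin n → A} {S : Set (Fin n)}

open scoped Classical in
/-- The coefficient of the divided Frobenius pullback of `η_j` with respect to `η_j`, up to exact
forms. -/
def frobCoeff (p : ℕ) (t : Fin n → A) (S : Set (Fin n)) (j : Fin n) : A :=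
  if j ∈ S then 1 else t j ^ (p - 1)

theorem frobCoeff_prod (p : ℕ) (t : Fin n → A) (S : Set (Fin n)) (J : List (Fin n)) :
    (J.map (frobCoeff p t S)).prod =
      ∏ i, t i ^ ((J.map (etaWeight S i)).sum * (p - 1)) := by
  classical
  induction J with
  | nil => simp
  | cons j J ih =>
    simp only [List.map_cons, List.prod_cons, List.sum_cons, add_mul, pow_add,
      Finset.prod_mul_distrib]
    rw [ih]
    congr 1
    rw [Finset.prod_eq_single j]
    · by_cases hj : j ∈ S <;> simp [frobCoeff, etaWeight, hj]
    · intro i _ hi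
      simp [etaWeight, hi.symm]
    · simp

theorem sum_etaWeight_le {J : List (Fin n)} (hJ : J.Nodup) (i : Fin n) :
    (J.map (etaWeight S i)).sum ≤ 1 := by
  classical
  induction J with
  | nil => simp
  | cons j J ih =>
    rw [List.map_cons, List.sum_cons]
    obtain ⟨h1, h2⟩ := List.nodup_cons.mp hJ
    by_cases hj : j = i ∧ i ∉ S
    · have : (J.map (etaWeight S i)).sum = 0 := by
        rw [List.sum_eq_zero_iff]
        intro x hx
        obtain ⟨j', hj', rfl⟩ := List.mem_map.mp hx
        rw [etaWeight, if_neg]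
        rintro ⟨rfl, -⟩
        rw [hj.1] at h1
        exact h1 hj'
      rw [this, etaWeight, if_pos hj]
    · rw [etaWeight, if_neg hj, zero_add]
      exact ih h2

variable (k P g t S) in
/-- The forms `cᵖ • ε_{j₁} ⋯ ε_{jₘ}`, where `ε_j = dt_j / t_j` for `j ∈ S` and
`ε_j = t_j ^ (p - 1) dt_j` otherwise. -/
def frobWord (p : ℕ) (c : A) (J : List (Fin n)) : FormFamily k P B :=
  logWord k P g t S ((J.map (frobCoeff p t S)).prod * c ^ p) J

variable (k P g t S) in
/-- The divided Frobenius pullback of the form `c • η_{j₁} ⋯ η_{jₘ}`, when that of `η_j` is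
`ε_j + dw_j`. -/
def frobImage (p : ℕ) (w : Fin n → A) (c : A) (J : List (Fin n)) : FormFamily k P B :=
  fun y _ => g y (c ^ p) • word (fun j => g y (frobCoeff p t S j) •
    etaForm k S (fun i => g y (t i)) j + KaehlerDifferential.D k (B y) (g y (w j))) J

theorem frobImage_apply (p : ℕ) (w : Fin n → A) (c : A) (J : List (Fin n)) (y : Y) (h : P y) :
    frobImage k P g t S p w c J y h = g y (c ^ p) • word (fun j => g y (frobCoeff p t S j) •
      etaForm k S (fun i => g y (t i)) j + KaehlerDifferential.D k (B y) (g y (w j))) J := rfl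

theorem frobWord_apply (p : ℕ) (c : A) (J : List (Fin n)) (y : Y) (h : P y) :
    frobWord k P g t S p c J y h = g y (c ^ p) • word (fun j => g y (frobCoeff p t S j) •
      etaForm k S (fun i => g y (t i)) j) J := by
  rw [word_smul, frobWord, logWord, smul_smul, mul_comm, map_mul, map_list_prod, List.map_map]
  rfl

theorem logWord_zero (J : List (Fin n)) : logWord k P g t S 0 J = 0 := by
  ext y h
  change g y 0 • (word _ J : Forms k (B y)) = 0
  rw [map_zero, zero_smul]

theorem logWord_of_not_nodup (a : A) {J : List (Fin n)} (hJ : ¬ J.Nodup) :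
    logWord k P g t S a J = 0 := by
  ext y h
  rw [logWord, word_of_not_nodup hJ, smul_zero]
  rfl

theorem exists_logWord_sum {m : ℕ} {x : FormFamily k P B} (hx : x ∈ logSpan k P g t S m) :
    ∃ c : Set.powersetCard (Fin n) m → A, x = ∑ J, logWord k P g t S (c J)
      (List.ofFn (Set.powersetCard.ofFinEmbEquiv.symm J)) := by
  classical
  induction hx using AddSubgroup.closure_induction with
  | zero => exact ⟨0, by simp [logWord_zero]⟩
  | add x y _ _ hx hy =>
    obtain ⟨c, rfl⟩ := hx
    obtain ⟨c', rfl⟩ := hy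
    exact ⟨c + c', by simp only [Pi.add_apply, logWord_add, Finset.sum_add_distrib]⟩
  | neg x _ hx =>
    obtain ⟨c, rfl⟩ := hx
    refine ⟨-c, ?_⟩
    rw [eq_comm, ← add_eq_zero_iff_eq_neg, ← Finset.sum_add_distrib]
    refine Finset.sum_eq_zero fun J _ => ?_
    rw [← logWord_add, Pi.neg_apply, neg_add_cancel, logWord_zero]
  | mem x hx =>
    obtain ⟨a, J, rfl, rfl⟩ := hx
    obtain ⟨c, hc⟩ := exists_expand A (fun j : Fin J.length => (Pi.single (J.get j) 1 : Fin n → A))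
    refine ⟨fun J' => a * c J', ?_⟩
    ext y h
    have h1 := hc (R := k) (g y) (etaForm k S fun i => g y (t i))
    have h2 : (List.ofFn fun j : Fin J.length => ∑ i, g y ((Pi.single (J.get j) 1 : Fin n → A) i) •
        ExteriorAlgebra.ι (B y) (etaForm k S (fun i => g y (t i)) i)).prod =
        word (etaForm k S fun i => g y (t i)) J := by
      rw [word]
      congr 1
      conv_rhs => rw [← List.ofFn_get J, List.map_ofFn]
      congr 1
      funext j
      rw [Finset.sum_eq_single (J.get j)]
      · rw [Pi.single_eq_same, map_one, one_smul]
        rfl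
      · intro i _ hi
        rw [Pi.single_eq_of_ne hi, map_zero, zero_smul]
      · simp
    rw [h2] at h1
    rw [Finset.sum_apply, Finset.sum_apply]
    change g y a • word _ J = _
    rw [h1, Finset.smul_sum]
    refine Finset.sum_congr rfl fun J' _ => ?_
    rw [smul_smul, ← map_mul]
    rfl

namespace LogChart

/-- The forms `dt_j / t_j` and `t_j ^ (p - 1) dt_j` are closed. -/
theorem eps_closed (p : ℕ) (j : Fin n) (y : Y) :
    extD k (B y) (ExteriorAlgebra.ι (B y) (g y (frobCoeff p t S j) •
      etaForm k S (fun i => g y (t i)) j)) = 0 := by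
  rw [map_smul, extD_smul, etaForm_closed, smul_zero, add_zero]
  by_cases hj : j ∈ S
  · rw [frobCoeff, if_pos hj, map_one, dOne_one, zero_mul]
  · rw [frobCoeff, if_neg hj, ι_etaForm_of_notMem hj, map_pow, dOne, Derivation.leibniz_pow,
      map_nsmul, map_smul, smul_mul_assoc, smul_mul_assoc]
    change _ • _ • (dOne k _ * dOne k _) = _
    have : dOne k (g y (t j)) * dOne k (g y (t j)) = 0 := ExteriorAlgebra.ι_sq_zero _
    rw [this, smul_zero, smul_zero]

variable (H : LogChart b P B g t S) (p : ℕ) [Fact p.Prime] [CharP k p]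

include H

/-- The form `t ^ (p - 1) dt` has weight `p`, hence weight zero. -/
theorem lie_frobWord (i : Fin n) (c : A) (J : List (Fin n)) :
    lieOp (famD k P B) (H.famContr i) (frobWord k P g t S p c J) = 0 := by
  rw [frobWord, frobCoeff_prod, H.lie_logWord p]
  have hp : 1 ≤ p := (Fact.out : p.Prime).one_le
  have h1 : ((J.map (etaWeight S i)).sum * (p - 1) + (J.map (etaWeight S i)).sum) =
      (J.map (etaWeight S i)).sum * p := by
    obtain ⟨q, rfl⟩ : ∃ q, p = q + 1 := ⟨p - 1, by omega⟩
    rw [Nat.add_sub_cancel]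
    ring
  rw [h1, mul_smul, nsmul_eq_zero p, smul_zero]

omit H [Fact p.Prime] in
theorem famD_frobWord (c : A) (J : List (Fin n)) :
    famD k P B (frobWord k P g t S p c J) = 0 := by
  ext y h
  rw [famD_apply, frobWord_apply, extD_smul, word_closed (fun j => eps_closed p j y),
    smul_zero, add_zero, map_pow,
    dOne_pow_char k (B y) p (natCast_eq_zero_of_hom p (algebraMap k (B y))), zero_mul]
  rfl

/-- A monomial form that is killed by all Lie derivatives is a form `c ^ p • ε_J`: if it is not
zero, the exponent of `t_i` is divisible by `p` if `dt_i` does not occur, and is `p - 1` modulo `p`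
if it does. -/
theorem exists_frobWord_of_weight_zero {a : A} (ha : a ∈ frobMonomials p t) (J : List (Fin n))
    (h : ∀ i, lieOp (famD k P B) (H.famContr i) (logWord k P g t S a J) = 0) :
    ∃ c, logWord k P g t S a J = frobWord k P g t S p c J := by
  obtain ⟨β, c, rfl⟩ := ha
  by_cases hJ : J.Nodup
  swap
  · exact ⟨0, by rw [frobWord, logWord_of_not_nodup _ hJ, logWord_of_not_nodup _ hJ]⟩
  have hp : p.Prime := Fact.out
  by_cases hw : ∀ i, p ∣ β i + (J.map (etaWeight S i)).sum
  swap
  · push Not at hw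
    obtain ⟨i, hi⟩ := hw
    refine ⟨0, ?_⟩
    have h1 := h i
    rw [H.lie_logWord p] at h1
    have h2 := nsmul_eq_zero (P := P) (B := B) p (logWord k P g t S ((∏ j, t j ^ β j) * c ^ p) J)
    have h3 := ((Nat.Prime.coprime_iff_not_dvd hp).mpr hi).symm
    have h4 : logWord k P g t S ((∏ j, t j ^ β j) * c ^ p) J = 0 := by
      have h5 := addOrderOf_dvd_of_nsmul_eq_zero h1
      have h6 := addOrderOf_dvd_of_nsmul_eq_zero h2
      exact AddMonoid.addOrderOf_eq_one_iff.mp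
        (Nat.eq_one_of_dvd_one (h3 ▸ Nat.dvd_gcd h5 h6))
    rw [h4, frobWord, zero_pow hp.ne_zero, mul_zero, logWord_zero]
  choose q hq using hw
  have key : ∀ i, β i = (J.map (etaWeight S i)).sum * (p - 1) +
      (q i - (J.map (etaWeight S i)).sum) * p := by
    intro i
    have h1 := hq i
    have h2 := sum_etaWeight_le (S := S) hJ i
    generalize (J.map (etaWeight S i)).sum = s at *
    obtain ⟨r, rfl⟩ : ∃ r, p = r + 1 := ⟨p - 1, by have := hp.one_le; omega⟩
    have h3 : s ≤ q i := by
      rcases Nat.eq_zero_or_pos (q i) with h0 | h0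
      · rw [h0, mul_zero] at h1; omega
      · omega
    obtain ⟨d, hd⟩ := Nat.exists_eq_add_of_le h3
    rw [hd, Nat.add_sub_cancel_left, Nat.add_sub_cancel]
    rw [hd] at h1
    have : β i + s = (s * r + d * (r + 1)) + s := by rw [h1]; ring
    omega
  refine ⟨(∏ i, t i ^ (q i - (J.map (etaWeight S i)).sum)) * c, ?_⟩
  rw [frobWord, frobCoeff_prod, mul_pow, ← Finset.prod_pow, ← mul_assoc, ← Finset.prod_mul_distrib]
  congr 2
  refine Finset.prod_congr rfl fun i _ => ?_
  rw [← pow_mul, ← pow_add, ← key i]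

variable [PerfectRing k p]

/-- The Cartier isomorphism is onto: a closed logarithmic form is a sum of Frobenius pullbacks
modulo exact forms. -/
theorem exists_frobWord_add_exact {m : ℕ} {x : FormFamily k P B} (hx : x ∈ logSpan k P g t S m)
    (hdx : famD k P B x = 0) :
    ∃ y ∈ AddSubgroup.closure {s | ∃ c J, J.length = m ∧ s = frobWord k P g t S p c J},
      ∃ z ∈ prevSpan k P g t S m, x = y + famD k P B z := by
  have hx' := hx
  rw [H.logSpan_eq p] at hx'
  have hL : ∀ s ∈ {s | ∃ a ∈ frobMonomials p t, ∃ J : List (Fin n), J.length = m ∧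
      s = logWord k P g t S a J}, ∀ i, ∃ l : ℕ, lieOp (famD k P B) (H.famContr i) s = l • s := by
    rintro _ ⟨_, ⟨β, c, rfl⟩, J, hJ, rfl⟩ i
    exact ⟨_, H.lie_logWord p i β c J⟩
  have hK : ∀ s ∈ {s | ∃ a ∈ frobMonomials p t, ∃ J : List (Fin n), J.length = m ∧
      s = logWord k P g t S a J}, ∀ i, H.famContr i s ∈ prevSpan k P g t S m := by
    rintro _ ⟨a, _, J, hJ, rfl⟩ i
    exact H.famContr_mem i (logWord_mem _ _ hJ)
  obtain ⟨y, hy, z, hz, rfl⟩ := exists_cohomologous_weight_zero (Fact.out : p.Prime)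
    (fun g _ => nsmul_eq_zero p g) hL hK (fun x hx => famD_famD_prev hx) hx' hdx
  refine ⟨y, AddSubgroup.closure_mono ?_ hy, z, hz, rfl⟩
  rintro _ ⟨⟨a, ha, J, hJ, rfl⟩, h⟩
  obtain ⟨c, hc⟩ := H.exists_frobWord_of_weight_zero p ha J h
  exact ⟨c, J, hJ, hc⟩

/-- The Cartier isomorphism is one-to-one: an exact sum of Frobenius pullbacks vanishes. -/
theorem eq_zero_of_exact {m : ℕ} {x y : FormFamily k P B} (hx : x ∈ prevSpan k P g t S m)
    (hy : y ∈ AddSubgroup.closure {s | ∃ c J, J.length = m ∧ s = frobWord k P g t S p c J})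
    (hxy : famD k P B x = y) : y = 0 := by
  cases m with
  | zero =>
    rw [← hxy, show x = 0 from hx, map_zero]
  | succ m =>
    have hx' : x ∈ logSpan k P g t S m := hx
    rw [H.logSpan_eq p] at hx'
    refine eq_zero_of_exact_of_weight_zero (Fact.out : p.Prime)
      (K := prevSpan k P g t S m) (d := famD k P B) (h := H.famContr)
      (fun g _ => nsmul_eq_zero p g) ?_ ?_ (fun x hx => famD_famD_prev hx) ?_ hx' hxy ?_ ?_
    · rintro _ ⟨_, ⟨β, c, rfl⟩, J, hJ, rfl⟩ i
      exact ⟨_, H.lie_logWord p i β c J⟩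
    · rintro _ ⟨a, _, J, hJ, rfl⟩ i
      exact H.famContr_mem i (logWord_mem _ _ hJ)
    · rintro _ ⟨a, ha, J, hJ, rfl⟩ h
      obtain ⟨c, hc⟩ := H.exists_frobWord_of_weight_zero p ha J h
      rw [hc, famD_frobWord]
    · rw [← hxy, famD_famD (m := m) hx]
    · intro j
      have : AddSubgroup.closure {s | ∃ c J, J.length = m + 1 ∧ s = frobWord k P g t S p c J} ≤
          (lieOp (famD k P B) (H.famContr j)).ker := by
        rw [AddSubgroup.closure_le]
        rintro _ ⟨c, J, -, rfl⟩
        exact H.lie_frobWord p j c J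
      exact this hy

omit [Fact p.Prime] [CharP k p] [PerfectRing k p] in
theorem frobCoeff_prod_regular (J : List (Fin n)) {a : A}
    (h : (J.map (frobCoeff p t S)).prod * a = 0) : a = 0 := by
  have hflat := (RingHom.Etale.iff_flat_and_formallyUnramified.mp H.etale).1
  have hpow : ∀ (i : Fin n) (r : ℕ) (a : A), t i ^ r * a = 0 → a = 0 := by
    intro i r
    induction r with
    | zero => intro a ha; rwa [pow_zero, one_mul] at ha
    | succ r ih =>
      intro a ha
      rw [pow_succ', mul_assoc] at ha
      exact ih a (coord_regular b t hflat i ha)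
  induction J with
  | nil => simpa using h
  | cons j J ih =>
    rw [List.map_cons, List.prod_cons, mul_assoc] at h
    refine ih ?_
    by_cases hj : j ∈ S
    · rwa [frobCoeff, if_pos hj, one_mul] at h
    · rw [frobCoeff, if_neg hj] at h
      exact hpow j _ _ h

omit [Fact p.Prime] [PerfectRing k p] [CharP k p] in
/-- The forms `c ^ p • ε_J` determine `c`: since the basic forms are independent and the `t_j` are
regular, `c ^ p` is determined, and `A` is reduced. -/
theorem frobWord_linearIndependent {m : ℕ} (c : Set.powersetCard (Fin n) m → A)
    (h : ∑ J, frobWord k P g t S p (c J)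
      (List.ofFn (Set.powersetCard.ofFinEmbEquiv.symm J)) = 0)
    (J : Set.powersetCard (Fin n) m) : c J = 0 := by
  have := isReduced_of_etale b t H.etale
  have h1 := H.injective (((List.ofFn (Set.powersetCard.ofFinEmbEquiv.symm J)).map
      (frobCoeff p t S)).prod * c J ^ p) (fun y hy => by
    have h2 := congrFun (congrFun h y) hy
    rw [Finset.sum_apply, Finset.sum_apply] at h2
    exact etaWord_linearIndependent (H.basis_eq y) (H.isUnit y hy) _ h2 J)
  exact eq_zero_of_pow_eq_zero (H.frobCoeff_prod_regular p _ h1)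

omit [Fact p.Prime] [CharP k p] [PerfectRing k p] in
theorem exists_oneFam (w : Fin n → A) (j : Fin n) : ∃ c : Fin n → A, ∀ y (h : P y),
    ExteriorAlgebra.ι (B y) (g y (frobCoeff p t S j) • etaForm k S (fun i => g y (t i)) j +
      KaehlerDifferential.D k (B y) (g y (w j))) = oneFam k P g t S c y h := by
  obtain ⟨c, hc⟩ := H.exists_dOne (w j)
  refine ⟨c + Pi.single j (frobCoeff p t S j), fun y h => ?_⟩
  rw [map_add, map_smul]
  refine (congrArg (_ + ·) (hc y h)).trans ?_
  simp only [oneFam, Pi.add_apply, map_add, add_smul, Finset.sum_add_distrib]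
  rw [add_comm]
  congr 1
  rw [Finset.sum_eq_single j]
  · rw [Pi.single_eq_same]
  · intro i _ hi
    rw [Pi.single_eq_of_ne hi, map_zero, zero_smul]
  · simp

omit [Fact p.Prime] [CharP k p] [PerfectRing k p] in
theorem frobImage_mem (w : Fin n → A) (c : A) (J : List (Fin n)) :
    frobImage k P g t S p w c J ∈ logSpan k P g t S J.length := by
  induction J with
  | nil => exact logWord_mem _ _ rfl
  | cons j J ih =>
    obtain ⟨c', hc'⟩ := H.exists_oneFam p w j
    have : frobImage k P g t S p w c (j :: J) =
        oneFam k P g t S c' * frobImage k P g t S p w c J := by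
      ext y h
      rw [Pi.mul_apply, Pi.mul_apply, ← hc' y h, frobImage, frobImage, word_cons, mul_smul_comm]
    rw [this]
    exact oneFam_mul_mem c' ih

omit [PerfectRing k p] [Fact p.Prime] H in
theorem famD_frobImage (w : Fin n → A) (c : A) (J : List (Fin n)) :
    famD k P B (frobImage k P g t S p w c J) = 0 := by
  ext y h
  rw [famD_apply, frobImage, extD_smul, word_closed, smul_zero, add_zero, map_pow,
    dOne_pow_char k (B y) p (natCast_eq_zero_of_hom p (algebraMap k (B y))), zero_mul]
  · rfl
  · intro j
    rw [map_add, map_add, eps_closed, zero_add]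
    exact extD_dOne k (B y) _

omit [PerfectRing k p] [Fact p.Prime] in
/-- The exact summands `dw_j` change a Frobenius pullback by an exact form only. -/
theorem exists_frobImage_eq (w : Fin n → A) (c : A) (J : List (Fin n)) :
    ∃ z ∈ prevSpan k P g t S J.length,
      frobImage k P g t S p w c J = frobWord k P g t S p c J + famD k P B z := by
  induction J with
  | nil =>
    refine ⟨0, zero_mem _, ?_⟩
    ext y h
    rw [map_zero, add_zero, frobWord_apply, frobImage, word_nil, word_nil]
  | cons j J ih =>
    obtain ⟨z, hz, hzJ⟩ := ih
    let e : FormFamily k P B := oneFam k P g t S (Pi.single j (frobCoeff p t S j))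
    have he : ∀ y h, e y h = ExteriorAlgebra.ι (B y) (g y (frobCoeff p t S j) •
        etaForm k S (fun i => g y (t i)) j) := by
      intro y h
      rw [map_smul]
      change ∑ i, _ = _
      rw [Finset.sum_eq_single j]
      · rw [Pi.single_eq_same]
      · intro i _ hi
        rw [Pi.single_eq_of_ne hi, map_zero, zero_smul]
      · simp
    -- As the image of the word `J` is closed, `dw_j` times it is `d` of `w_j` times it.
    refine ⟨(fun y h => g y (w j) • frobImage k P g t S p w c J y h : FormFamily k P B) - e * z,
      sub_mem (smul_mem_logSpan _ (H.frobImage_mem p w c J)) ?_, ?_⟩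
    · cases J with
      | nil =>
        rw [show z = 0 from hz, mul_zero]
        exact zero_mem _
      | cons j' J => exact oneFam_mul_mem _ hz
    · have hF := famD_frobImage (k := k) (P := P) (B := B) (g := g) (t := t) (S := S) p w c J
      ext y h
      have hF' := congrFun (congrFun hF y) h
      have hz' := congrFun (congrFun hzJ y) h
      rw [map_sub, Pi.add_apply, Pi.add_apply, Pi.sub_apply, Pi.sub_apply, famD_apply, famD_apply,
        extD_smul, Pi.mul_apply, Pi.mul_apply, he, extD_ι_mul, eps_closed, zero_mul, zero_sub,
        sub_neg_eq_add, ← famD_apply, hF', Pi.zero_apply, Pi.zero_apply, smul_zero, add_zero,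
        frobWord_apply, word_cons, frobImage_apply, word_cons, map_add, add_mul, smul_add]
      have h3 : g y (c ^ p) • (ExteriorAlgebra.ι (B y) (g y (frobCoeff p t S j) •
          etaForm k S (fun i => g y (t i)) j) * word (fun j => g y (frobCoeff p t S j) •
            etaForm k S (fun i => g y (t i)) j + KaehlerDifferential.D k (B y) (g y (w j))) J) =
          ExteriorAlgebra.ι (B y) (g y (frobCoeff p t S j) •
          etaForm k S (fun i => g y (t i)) j) * frobImage k P g t S p w c J y h := by
        rw [frobImage, mul_smul_comm]
      have h4 : dOne k (g y (w j)) * frobImage k P g t S p w c J y h =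
          g y (c ^ p) • (ExteriorAlgebra.ι (B y) (KaehlerDifferential.D k (B y) (g y (w j))) *
            word (fun j => g y (frobCoeff p t S j) • etaForm k S (fun i => g y (t i)) j +
              KaehlerDifferential.D k (B y) (g y (w j))) J) := by
        rw [frobImage_apply, mul_smul_comm, dOne]
      rw [h3, h4, hz', Pi.add_apply, Pi.add_apply, frobWord_apply, mul_add, mul_smul_comm,
        famD_apply]
      abel

/-- Surjectivity of the divided Frobenius on cohomology. -/
theorem exists_frobImage_add_exact (w : Fin n → A) {m : ℕ} {x : FormFamily k P B}
    (hx : x ∈ logSpan k P g t S m) (hdx : famD k P B x = 0) :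
    ∃ y ∈ AddSubgroup.closure {s | ∃ c J, J.length = m ∧ s = frobImage k P g t S p w c J},
      ∃ z ∈ prevSpan k P g t S m, x = y + famD k P B z := by
  obtain ⟨y, hy, z, hz, rfl⟩ := H.exists_frobWord_add_exact p hx hdx
  suffices h : ∃ y' ∈ AddSubgroup.closure {s | ∃ c J, J.length = m ∧
      s = frobImage k P g t S p w c J}, ∃ z ∈ prevSpan k P g t S m, y = y' + famD k P B z by
    obtain ⟨y', hy', z', hz', rfl⟩ := h
    exact ⟨y', hy', z' + z, add_mem hz' hz, by rw [map_add, add_assoc]⟩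
  clear hx hdx
  induction hy using AddSubgroup.closure_induction with
  | zero => exact ⟨0, zero_mem _, 0, zero_mem _, by simp⟩
  | add x y _ _ hx hy =>
    obtain ⟨a, ha, z, hz, rfl⟩ := hx
    obtain ⟨a', ha', z', hz', rfl⟩ := hy
    exact ⟨a + a', add_mem ha ha', z + z', add_mem hz hz', by rw [map_add]; abel⟩
  | neg x _ hx =>
    obtain ⟨a, ha, z, hz, rfl⟩ := hx
    exact ⟨-a, neg_mem ha, -z, neg_mem hz, by rw [map_neg]; abel⟩
  | mem x hx =>
    obtain ⟨c, J, rfl, rfl⟩ := hx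
    obtain ⟨z, hz, h⟩ := H.exists_frobImage_eq p w c J
    exact ⟨_, AddSubgroup.subset_closure ⟨c, J, rfl, rfl⟩, -z, neg_mem hz, by
      rw [h, map_neg, add_neg_cancel_right]⟩

/-- Injectivity of the divided Frobenius on cohomology. -/
theorem frobImage_sum_exact (w : Fin n → A) {m : ℕ} (c : Set.powersetCard (Fin n) m → A)
    {x : FormFamily k P B} (hx : x ∈ prevSpan k P g t S m)
    (h : famD k P B x = ∑ J, frobImage k P g t S p w (c J)
      (List.ofFn (Set.powersetCard.ofFinEmbEquiv.symm J))) : c = 0 := by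
  choose z hz hzJ using fun J : Set.powersetCard (Fin n) m => H.exists_frobImage_eq p w (c J)
    (List.ofFn (Set.powersetCard.ofFinEmbEquiv.symm J))
  simp only [List.length_ofFn] at hz
  simp only [hzJ, Finset.sum_add_distrib] at h
  rw [← map_sum, ← sub_eq_iff_eq_add, ← map_sub] at h
  have h0 := H.eq_zero_of_exact p (sub_mem hx (sum_mem fun J _ => hz J)) (sum_mem fun J _ =>
    AddSubgroup.subset_closure ⟨c J, _, List.length_ofFn, rfl⟩) h
  funext J
  exact H.frobWord_linearIndependent p c h0 J

end LogChart

/-- Logarithmic forms in terms of any set of one-forms that contains the basic ones. -/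
theorem closure_products_eq_logSpan (O : Set (FormFamily k P B))
    (h₁ : ∀ γ ∈ O, ∃ c, γ = oneFam k P g t S c)
    (h₂ : ∀ j, (fun y _ => ExteriorAlgebra.ι (B y) (etaForm k S (fun i => g y (t i)) j)) ∈ O)
    (m : ℕ) :
    AddSubgroup.closure {s : FormFamily k P B | ∃ (a : A) (γ : Fin m → FormFamily k P B),
      (∀ j, γ j ∈ O) ∧ s = fun y h => g y a • (List.ofFn fun j => γ j y h).prod} =
      logSpan k P g t S m := by
  apply le_antisymm
  · rw [AddSubgroup.closure_le]
    rintro _ ⟨a, γ, hγ, rfl⟩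
    have key : ∀ (m : ℕ) (γ : Fin m → FormFamily k P B), (∀ j, γ j ∈ O) →
        (fun y h => g y a • (List.ofFn fun j => γ j y h).prod : FormFamily k P B) ∈
          logSpan k P g t S m := by
      intro m
      induction m with
      | zero => exact fun γ _ => logWord_mem a [] rfl
      | succ m ih =>
        intro γ hγ
        obtain ⟨c, hc⟩ := h₁ _ (hγ 0)
        have h := oneFam_mul_mem c (ih (fun j => γ j.succ) fun j => hγ j.succ)
        rw [← hc] at h
        convert h using 1
        ext y h
        rw [Pi.mul_apply, Pi.mul_apply, List.ofFn_succ, List.prod_cons, mul_smul_comm]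
    exact key m γ hγ
  · rw [logSpan, AddSubgroup.closure_le]
    rintro _ ⟨a, J, rfl, rfl⟩
    refine AddSubgroup.subset_closure ⟨a, fun i => _, fun i => h₂ (J.get i), ?_⟩
    ext y h
    rw [logWord, word]
    congr 2
    conv_lhs => rw [← List.ofFn_get J, List.map_ofFn]
    rfl

section frobenius

variable (H : LogChart b P B g t S) (p : ℕ) [Fact p.Prime] [CharP k p] [PerfectRing k p]
  (w : Fin n → A) (ψ : ∀ y, Forms k (B y) →+* Forms k (B y))

/-- A family of ring homomorphisms, applied to a family of forms. -/
def famMap : FormFamily k P B →+ FormFamily k P B where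
  toFun s y h := ψ y (s y h)
  map_zero' := by ext y h; exact map_zero (ψ y)
  map_add' s s' := by ext y h; exact map_add (ψ y) _ _

variable (hψ : ∀ y (c : B y) ω, ψ y (c • ω) = c ^ p • ψ y ω)
  (hη : ∀ y, P y → ∀ j, ψ y (ExteriorAlgebra.ι (B y) (etaForm k S (fun i => g y (t i)) j)) =
    g y (frobCoeff p t S j) • ExteriorAlgebra.ι (B y) (etaForm k S (fun i => g y (t i)) j) +
      dOne k (g y (w j)))
include hψ hη

omit [Fact p.Prime] [CharP k p] [PerfectRing k p] in
theorem famMap_logWord (c : A) (J : List (Fin n)) :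
    famMap (P := P) ψ (logWord k P g t S c J) = frobImage k P g t S p w c J := by
  ext y h
  change ψ y (g y c • _) = _
  rw [hψ, frobImage_apply, map_pow, word, map_list_prod, List.map_map, word]
  congr 3
  funext j
  refine (hη y h j).trans ?_
  rw [map_add, map_smul]
  rfl

namespace LogChart

include H

omit [Fact p.Prime] [CharP k p] [PerfectRing k p] in
theorem famMap_mem {m : ℕ} {x : FormFamily k P B} (hx : x ∈ logSpan k P g t S m) :
    famMap ψ x ∈ logSpan k P g t S m := by
  refine logSpan_induction (F := famMap ψ) ?_ hx
  intro a J hJ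
  rw [famMap_logWord p w ψ hψ hη, ← hJ]
  exact H.frobImage_mem p w a J

theorem exists_famMap_add_exact {m : ℕ} {x : FormFamily k P B}
    (hx : x ∈ logSpan k P g t S m) (hdx : famD k P B x = 0) :
    ∃ y ∈ logSpan k P g t S m, ∃ z ∈ prevSpan k P g t S m, x = famMap ψ y + famD k P B z := by
  obtain ⟨y, hy, z, hz, rfl⟩ := H.exists_frobImage_add_exact p w hx hdx
  have : AddSubgroup.closure {s | ∃ c J, J.length = m ∧ s = frobImage k P g t S p w c J} ≤
      (logSpan k P g t S m).map (famMap ψ) := by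
    rw [AddSubgroup.closure_le]
    rintro _ ⟨c, J, hJ, rfl⟩
    exact ⟨logWord k P g t S c J, logWord_mem c J hJ, famMap_logWord p w ψ hψ hη c J⟩
  obtain ⟨y', hy', rfl⟩ := this hy
  exact ⟨y', hy', z, hz, rfl⟩

theorem eq_zero_of_famMap_exact {m : ℕ} {x z : FormFamily k P B}
    (hx : x ∈ logSpan k P g t S m) (hz : z ∈ prevSpan k P g t S m)
    (h : famD k P B z = famMap ψ x) : x = 0 := by
  obtain ⟨c, rfl⟩ := exists_logWord_sum hx
  rw [map_sum] at h
  simp only [famMap_logWord p w ψ hψ hη] at h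
  rw [H.frobImage_sum_exact p w c hz h]
  exact Finset.sum_eq_zero fun J _ => logWord_zero _

end LogChart

end frobenius

end localCartier

/-! ### Logarithmic coordinates on a scheme -/

open AlgebraicGeometry CategoryTheory Limits TopologicalSpace Opposite

section idealComap

theorem ideal_comap_top {X Y : Scheme.{u}} [IsAffine X] [IsAffine Y] (g : X ⟶ Y)
    (I : Y.IdealSheafData) :
    (I.comap g).ideal ⟨⊤, isAffineOpen_top X⟩ =
      (I.ideal ⟨⊤, isAffineOpen_top Y⟩).map g.appTop.hom := by
  apply le_antisymm
  · let J : X.IdealSheafData := Scheme.IdealSheafData.ofIdealTop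
      ((I.ideal ⟨⊤, isAffineOpen_top Y⟩).map g.appTop.hom)
    have hJ : J.ideal ⟨⊤, isAffineOpen_top X⟩ =
        (I.ideal ⟨⊤, isAffineOpen_top Y⟩).map g.appTop.hom :=
      Scheme.IdealSheafData.equivOfIsAffine.right_inv _
    have h1 : I.comap g ≤ J := by
      rw [← Scheme.IdealSheafData.le_map_iff_comap_le]
      apply Scheme.IdealSheafData.le_of_isAffine
      rw [Scheme.IdealSheafData.ideal_map_of_isAffineHom]
      rw [← Ideal.map_le_iff_le_comap]
      exact hJ.ge
    refine (h1 _).trans hJ.le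
  · rw [Ideal.map_le_iff_le_comap]
    have h1 := Scheme.IdealSheafData.le_map_comap I g ⟨⊤, isAffineOpen_top Y⟩
    rwa [Scheme.IdealSheafData.ideal_map_of_isAffineHom] at h1

theorem ideal_comap_ι {X : Scheme.{u}} (J : X.IdealSheafData) (W : X.Opens) [IsAffine W] :
    (J.comap W.ι).ideal ⟨⊤, isAffineOpen_top _⟩ =
      J.ideal ⟨W.ι ''ᵁ ⊤, (isAffineOpen_top _).image_of_isOpenImmersion _⟩ := by
  rw [Scheme.IdealSheafData.ideal_comap_of_isOpenImmersion, Scheme.Opens.ι_appIso]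
  exact Ideal.comap_id _

/-- The inverse image of an ideal sheaf on affine opens. -/
theorem ideal_comap {X Y : Scheme.{u}} (g : X ⟶ Y) (I : Y.IdealSheafData) (V : Y.affineOpens)
    (W : X.affineOpens) (h : W.1 ≤ g ⁻¹ᵁ V.1) :
    (I.comap g).ideal W = (I.ideal V).map (g.appLE V.1 W.1 h).hom := by
  have : IsAffine V.1 := V.2
  have : IsAffine W.1 := W.2
  let V' : Y.affineOpens := ⟨V.1.ι ''ᵁ ⊤, (isAffineOpen_top _).image_of_isOpenImmersion _⟩
  let W' : X.affineOpens := ⟨W.1.ι ''ᵁ ⊤, (isAffineOpen_top _).image_of_isOpenImmersion _⟩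
  have hV : V' = V := Subtype.ext V.1.ι_image_top
  have hW : W' = W := Subtype.ext W.1.ι_image_top
  have h' : W'.1 ≤ g ⁻¹ᵁ V'.1 := by rw [hV, hW]; exact h
  suffices key : (I.comap g).ideal W' = (I.ideal V').map (g.appLE V'.1 W'.1 h').hom by
    clear_value V' W'
    subst hV hW
    exact key
  have h1 := ideal_comap_top (g.resLE V.1 W.1 h) (I.comap V.1.ι)
  rw [← Scheme.IdealSheafData.comap_comp, Scheme.Hom.resLE_comp_ι,
    Scheme.IdealSheafData.comap_comp, ideal_comap_ι, ideal_comap_ι] at h1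
  have h2 : (g.resLE V.1 W.1 h).appTop = g.appLE V'.1 W'.1 h' := by
    rw [Scheme.Hom.appTop, ← Scheme.Hom.appLE_eq_app, Scheme.Hom.resLE_appLE]
    rfl
  rw [h2] at h1
  exact h1

end idealComap

section coordinates

open MvPolynomial

variable {R : Type u} [CommRing R] {X : Scheme.{u}} (f : X ⟶ Spec (CommRingCat.of R))
  {ι : Type*} (D : ι → X.IdealSheafData)

/-- Étale coordinates on an affine open, such that the `D i` that are not empty there are the zero
loci of pairwise different coordinates. -/
structure IsLogCoord (W : X.affineOpens) {n : ℕ} (t : Fin n → Γ(X, W.1)) {s : Set ι}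
    (e : s ↪ Fin n) : Prop where
  etale : (eval₂Hom (baseToSections f W.1) t).Etale
  ideal_eq : ∀ i : s, (D i.1).ideal W = Ideal.span {t (e i)}
  ideal_eq_top : ∀ i ∉ s, (D i).ideal W = ⊤

theorem res_etale {W W' : X.affineOpens} (h : W'.1 ≤ W.1) : (res h).Etale := by
  have h1 := HasRingHomProperty.appLE (P := @Etale) (𝟙 X) inferInstance W W' h
  have h2 : (𝟙 X : X ⟶ X).appLE W.1 W'.1 h = X.presheaf.map (homOfLE h).op := by
    exact Category.id_comp _
  rw [h2] at h1
  exact h1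

theorem res_baseToSections {V W : X.Opens} (h : W ≤ V) (r : R) :
    res h (baseToSections f V r) = baseToSections f W r := by
  change (X.presheaf.map _).hom ((X.presheaf.map _).hom _) = (X.presheaf.map _).hom _
  rw [← RingHom.comp_apply, ← CommRingCat.hom_comp, ← X.presheaf.map_comp]
  rfl

theorem germAt_baseToSections {V : X.Opens} (x : V) (r : R) :
    germAt x (baseToSections f V r) = baseToStalk f x.1 r :=
  germAt_res (le_top : V ≤ ⊤) x _

variable {f D}

theorem IsLogCoord.restrict {W W' : X.affineOpens} (h : W'.1 ≤ W.1) {n : ℕ}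
    {t : Fin n → Γ(X, W.1)} {s : Set ι} {e : s ↪ Fin n} (H : IsLogCoord f D W t e) :
    IsLogCoord f D W' (fun j => res h (t j)) e where
  etale := by
    have h1 : eval₂Hom (baseToSections f W'.1) (fun j => res h (t j)) =
        (res h).comp (eval₂Hom (baseToSections f W.1) t) := by
      ext x
      · simp [res_baseToSections]
      · simp
    rw [h1]
    exact RingHom.Etale.stableUnderComposition _ _ H.etale (res_etale h)
  ideal_eq i := by
    rw [← (D i.1).map_ideal h, H.ideal_eq, Ideal.map_span, Set.image_singleton]
    rfl
  ideal_eq_top i hi := by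
    rw [← (D i).map_ideal h, H.ideal_eq_top i hi, Ideal.map_top]

theorem mem_support_iff_not_isUnit {I : X.IdealSheafData} {W : X.affineOpens} {t : Γ(X, W.1)}
    (h : I.ideal W = Ideal.span {t}) (x : W.1) : x.1 ∈ I.support ↔ ¬ IsUnit (germAt x t) := by
  rw [Scheme.IdealSheafData.mem_support_iff_of_mem x.2, h, Scheme.mem_zeroLocus_iff]
  have h1 : x.1 ∈ X.basicOpen t ↔ IsUnit (germAt x t) := Scheme.mem_basicOpen X t x.1 x.2
  rw [← h1]
  refine ⟨fun h => h t (Ideal.subset_span rfl), fun h a ha hx => h ?_⟩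
  obtain ⟨b, rfl⟩ := Ideal.mem_span_singleton.mp ha
  rw [Scheme.basicOpen_mul] at hx
  exact hx.1

theorem isUnit_germAt_of_ideal_eq {i : ι} {W : X.affineOpens} {t : Γ(X, W.1)}
    (h : (D i).ideal W = Ideal.span {t}) (x : W.1) (hx : OffDivisor D x.1) :
    IsUnit (germAt x t) := by
  have := hx i
  rwa [mem_support_iff_not_isUnit h, not_not] at this

section field

variable {k : Type u} [Field k] {f : X ⟶ Spec (CommRingCat.of k)}
  {W : X.affineOpens} {n : ℕ} {t : Fin n → Γ(X, W.1)} {s : Set ι} {e : s ↪ Fin n}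
  (H : IsLogCoord f D W t e)
include H

theorem IsLogCoord.isUnit (x : W.1) (hx : OffDivisor D x.1) {j : Fin n} (hj : j ∈ Set.range e) :
    IsUnit (germAt x (t j)) := by
  obtain ⟨i, rfl⟩ := hj
  exact isUnit_germAt_of_ideal_eq (H.ideal_eq i) x hx

/-- A function that vanishes off the divisor vanishes. -/
theorem IsLogCoord.injective (a : Γ(X, W.1))
    (ha : ∀ x : W.1, OffDivisor D x.1 → germAt x a = 0) : a = 0 := by
  classical
  have hflat := (RingHom.Etale.iff_flat_and_formallyUnramified.mp H.etale).1
  let T : Γ(X, W.1) := ∏ j with j ∈ Set.range e, t j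
  have h1 : X.presheaf.map (homOfLE (X.basicOpen_le T)).op a = 0 := by
    refine TopCat.Presheaf.section_ext X.sheaf (X.basicOpen T) _ _ fun x hx => ?_
    have hxW : x ∈ W.1 := X.basicOpen_le T hx
    have hoff : OffDivisor D x := by
      intro i
      by_cases hi : i ∈ s
      · rw [mem_support_iff_not_isUnit (H.ideal_eq ⟨i, hi⟩) ⟨x, hxW⟩, not_not]
        have h2 : IsUnit (germAt ⟨x, hxW⟩ T) := (Scheme.mem_basicOpen X T x hxW).mp hx
        refine isUnit_of_dvd_unit ?_ h2
        exact map_dvd _ (Finset.dvd_prod_of_mem _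
          (Finset.mem_filter.mpr ⟨Finset.mem_univ _, ⟨⟨i, hi⟩, rfl⟩⟩))
      · rw [mem_support_iff_not_isUnit (t := 1)
          (by rw [H.ideal_eq_top i hi, Ideal.span_singleton_one]) ⟨x, hxW⟩, map_one, not_not]
        exact isUnit_one
    refine (X.presheaf.germ_res_apply (homOfLE (X.basicOpen_le T)) x hx a).trans ?_
    refine (ha ⟨x, hxW⟩ hoff).trans ?_
    exact (map_zero (X.presheaf.germ (X.basicOpen T) x hx).hom).symm
  obtain ⟨N, hN⟩ :=
    exists_pow_mul_eq_zero_of_res_basicOpen_eq_zero_of_isAffineOpen X W.2 a T h1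
  have hreg : ∀ (F : Finset (Fin n)) (a : Γ(X, W.1)), (∏ j ∈ F, t j) * a = 0 → a = 0 := by
    intro F
    induction F using Finset.induction_on with
    | empty => intro a ha; simpa using ha
    | insert j F hj ih =>
      intro a ha
      rw [Finset.prod_insert hj, mul_assoc] at ha
      exact ih a (coord_regular _ t hflat j ha)
  induction N with
  | zero => simpa using hN
  | succ N ih =>
    rw [pow_succ', mul_assoc] at hN
    exact ih (hreg _ _ hN)

theorem IsLogCoord.exists_basis (x : W.1) :
    letI := stalkAlgebra f x.1
    ∃ B : Module.Basis (Fin n) (X.presheaf.stalk x.1) Ω[X.presheaf.stalk x.1⁄k],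
      ∀ i, B i = KaehlerDifferential.D k (X.presheaf.stalk x.1) (germAt x (t i)) := by
  let := stalkAlgebra f x.1
  refine exists_basis_of_formallyEtale (fun i => germAt x (t i)) ?_
  have h1 : eval₂Hom (algebraMap k (X.presheaf.stalk x.1)) (fun i => germAt x (t i)) =
      (germAt x).comp (eval₂Hom (baseToSections f W.1) t) := by
    ext y
    · simp only [RingHom.comp_apply, coe_eval₂Hom, eval₂_C, germAt_baseToSections]
      rfl
    · simp
  rw [h1]
  let : Algebra Γ(X, W.1) (X.presheaf.stalk x.1) := (germAt x).toAlgebra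
  have : IsLocalization.AtPrime (X.presheaf.stalk x.1) (W.2.primeIdealOf x).asIdeal :=
    W.2.isLocalization_stalk x
  have h2 : Algebra.FormallyEtale Γ(X, W.1) (X.presheaf.stalk x.1) :=
    Algebra.FormallyEtale.of_isLocalization (W.2.primeIdealOf x).asIdeal.primeCompl
  let : Algebra (MvPolynomial (Fin n) k) Γ(X, W.1) :=
    (eval₂Hom (baseToSections f W.1) t).toAlgebra
  let : Algebra (MvPolynomial (Fin n) k) (X.presheaf.stalk x.1) :=
    ((germAt x).comp (eval₂Hom (baseToSections f W.1) t)).toAlgebra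
  have : IsScalarTower (MvPolynomial (Fin n) k) Γ(X, W.1) (X.presheaf.stalk x.1) :=
    IsScalarTower.of_algebraMap_eq fun _ => rfl
  have h3 : Algebra.FormallyEtale (MvPolynomial (Fin n) k) Γ(X, W.1) :=
    formallyEtale_of_etale H.etale
  exact Algebra.FormallyEtale.comp (MvPolynomial (Fin n) k) Γ(X, W.1) (X.presheaf.stalk x.1)

/-- The local rings off the divisor, as an instance of the algebraic situation. -/
def IsLogCoord.chart :
    letI : ∀ x : W.1, Algebra k (X.presheaf.stalk x.1) := fun x => stalkAlgebra f x.1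
    LogChart (baseToSections f W.1) (fun x : W.1 => PLift (OffDivisor D x.1))
      (fun x : W.1 => X.presheaf.stalk x.1) germAt t (Set.range e) :=
  letI : ∀ x : W.1, Algebra k (X.presheaf.stalk x.1) := fun x => stalkAlgebra f x.1
  { etale := H.etale
    comp := germAt_baseToSections f
    basis := fun x => (H.exists_basis x).choose
    basis_eq := fun x => (H.exists_basis x).choose_spec
    isUnit := fun x hx _ hj => H.isUnit x hx.down hj
    injective := fun a ha => H.injective a fun x hx => ha x ⟨hx⟩ }

/-- Logarithmic forms on a chart are generated by products of the basic one-forms. -/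
theorem IsLogCoord.closure_eq (m : ℕ) :
    letI : ∀ x : W.1, Algebra k (X.presheaf.stalk x.1) := fun x => stalkAlgebra f x.1
    AddSubgroup.closure (logMonomials f D m W) =
      logSpan k (fun x : W.1 => PLift (OffDivisor D x.1)) (B := fun x : W.1 => X.presheaf.stalk x.1)
        germAt t (Set.range e) m := by
  let : ∀ x : W.1, Algebra k (X.presheaf.stalk x.1) := fun x => stalkAlgebra f x.1
  refine closure_products_eq_logSpan (k := k) (P := fun x : W.1 => PLift (OffDivisor D x.1))
    (B := fun x : W.1 => X.presheaf.stalk x.1) {γ | IsLogOne f D W γ} ?_ ?_ m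
  · rintro γ (⟨b, rfl⟩ | ⟨i, v, hv, rfl⟩)
    · obtain ⟨c, hc⟩ := H.chart.exists_dOne b
      exact ⟨c, by ext x hx; exact hc x hx⟩
    · have hunit : ∀ u u' : Γ(X, W.1), u * u' = 1 → ∃ c : Fin n → Γ(X, W.1),
          ∀ (x : W.1) (hx : PLift (OffDivisor D x.1)),
            Ring.inverse (germAt x u) • dOne k (germAt x u) =
              oneFam k (fun x : W.1 => PLift (OffDivisor D x.1)) germAt t (Set.range e) c x hx := by
        intro u u' hu
        obtain ⟨c, hc⟩ := H.chart.exists_dOne u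
        refine ⟨fun j => u' * c j, fun x hx => ?_⟩
        have h1 : Ring.inverse (germAt x u) = germAt x u' := by
          have h2 : germAt x u * germAt x u' = 1 := by rw [← map_mul, hu, map_one]
          have h3 : IsUnit (germAt x u) := IsUnit.of_mul_eq_one _ h2
          rw [← mul_one (Ring.inverse _), ← h2, ← mul_assoc, Ring.inverse_mul_cancel _ h3, one_mul]
        rw [h1, hc x hx, Finset.smul_sum]
        refine Finset.sum_congr rfl fun j _ => ?_
        rw [smul_smul, map_mul]
      by_cases hi : i ∈ s
      · have h1 := H.ideal_eq ⟨i, hi⟩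
        set j := e ⟨i, hi⟩ with hj
        rw [hv] at h1
        obtain ⟨u, hu⟩ := Ideal.mem_span_singleton.mp
          (h1 ▸ Ideal.mem_span_singleton_self v : v ∈ Ideal.span {t j})
        obtain ⟨u', hu'⟩ := Ideal.mem_span_singleton.mp
          (h1 ▸ Ideal.mem_span_singleton_self (t j) : t j ∈ Ideal.span {v})
        have huu : u * u' = 1 := by
          have hflat := (RingHom.Etale.iff_flat_and_formallyUnramified.mp H.etale).1
          refine (sub_eq_zero.mp (coord_regular _ t hflat j ?_)).symm
          rw [mul_sub, mul_one, ← mul_assoc, ← hu, ← hu', sub_self]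
        obtain ⟨c, hc⟩ := hunit u u' huu
        refine ⟨Pi.single j 1 + c, ?_⟩
        ext x hx
        have h3 : dlog k (germAt x v) = dlog k (germAt x (t j)) +
            Ring.inverse (germAt x u) • dOne k (germAt x u) := by
          rw [hu, mul_comm, map_mul]
          exact dlog_mul (H.isUnit x hx.down ⟨_, rfl⟩)
            (IsUnit.of_mul_eq_one (germAt x u') (by rw [← map_mul, huu, map_one]))
        refine h3.trans ?_
        rw [hc x hx]
        simp only [oneFam, Pi.add_apply, map_add, add_smul, Finset.sum_add_distrib]
        congr 1
        rw [Finset.sum_eq_single j]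
        · rw [Pi.single_eq_same, map_one, one_smul,
            ι_etaForm_of_mem (show j ∈ Set.range e from ⟨_, rfl⟩)]
        · intro i _ hi
          rw [Pi.single_eq_of_ne hi, map_zero, zero_smul]
        · simp
      · have h1 := H.ideal_eq_top i hi
        rw [hv, Ideal.span_singleton_eq_top] at h1
        obtain ⟨u', hu'⟩ := h1.exists_right_inv
        obtain ⟨c, hc⟩ := hunit v u' hu'
        exact ⟨c, by ext x hx; exact hc x hx⟩
  · intro j
    by_cases hj : j ∈ Set.range e
    · obtain ⟨i, rfl⟩ := hj
      refine Or.inr ⟨i.1, t (e i), H.ideal_eq i, ?_⟩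
      ext x hx
      exact ι_etaForm_of_mem ⟨i, rfl⟩
    · refine Or.inl ⟨t j, ?_⟩
      ext x hx
      exact ι_etaForm_of_notMem hj

end field

end coordinates

/-! ### Frobenius charts and the pullback of logarithmic forms -/

section frobeniusChart

variable {k : Type u} [Field k] {X : Scheme.{u}} (f : X ⟶ Spec (CommRingCat.of k))
  {ι : Type*} (D : ι → X.IdealSheafData)

/-- A family of ring endomorphisms of the stalks, applied to a family of germs. -/
def preMap (ψ : ∀ x : X, StalkForms f x →+* StalkForms f x) {V : X.Opens} :
    PreSection f D V →+ PreSection f D V where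
  toFun s x h := ψ x.1 (s x h)
  map_zero' := by ext x h; exact map_zero (ψ x.1)
  map_add' s s' := by ext x h; exact map_add (ψ x.1) _ _

/-- Logarithmic forms on an affine open, of degree one less than `m`. -/
def prevLog (W : X.affineOpens) : ℕ → AddSubgroup (PreSection f D W.1)
  | 0 => ⊥
  | m + 1 => AddSubgroup.closure (logMonomials f D m W)

/-- Logarithmic coordinates `t` in which the ring endomorphisms `ψ` of the algebras of forms look
like the Cartier isomorphism up to exact forms. -/
structure IsFrobChart (p : ℕ) (ψ : ∀ x : X, StalkForms f x →+* StalkForms f x)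
    (W : X.affineOpens) {n : ℕ} (t w : Fin n → Γ(X, W.1)) {s : Set ι} (e : s ↪ Fin n) : Prop
    extends IsLogCoord f D W t e where
  map_dlog : ∀ x : W.1, OffDivisor D x.1 → ∀ j ∈ Set.range e,
    ψ x.1 (stalkDlog f x.1 (germAt x (t j))) =
      stalkDlog f x.1 (germAt x (t j)) + stalkD f x.1 (germAt x (w j))
  map_d : ∀ x : W.1, OffDivisor D x.1 → ∀ j ∉ Set.range e,
    ψ x.1 (stalkD f x.1 (germAt x (t j))) =
      germAt x (t j) ^ (p - 1) • stalkD f x.1 (germAt x (t j)) + stalkD f x.1 (germAt x (w j))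

variable {f D}

variable {p : ℕ} {ψ : ∀ x : X, StalkForms f x →+* StalkForms f x}

theorem IsFrobChart.restrict {W W' : X.affineOpens} (h : W'.1 ≤ W.1) {n : ℕ}
    {t w : Fin n → Γ(X, W.1)} {s : Set ι} {e : s ↪ Fin n} (H : IsFrobChart f D p ψ W t w e) :
    IsFrobChart f D p ψ W' (fun j => res h (t j)) (fun j => res h (w j)) e where
  toIsLogCoord := H.toIsLogCoord.restrict h
  map_dlog x hx j hj := by
    rw [germAt_res, germAt_res]
    exact H.map_dlog ⟨x.1, h x.2⟩ hx j hj
  map_d x hx j hj := by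
    rw [germAt_res, germAt_res]
    exact H.map_d ⟨x.1, h x.2⟩ hx j hj

section chart

variable (hψ : ∀ (x : X) (c : X.presheaf.stalk x) ω, ψ x (c • ω) = c ^ p • ψ x ω)
  {W : X.affineOpens} {n : ℕ} {t w : Fin n → Γ(X, W.1)} {s : Set ι} {e : s ↪ Fin n}
  (H : IsFrobChart f D p ψ W t w e)
include hψ H

omit hψ in
theorem IsFrobChart.map_etaForm (x : W.1) (hx : PLift (OffDivisor D x.1)) (j : Fin n) :
    letI : Algebra k (X.presheaf.stalk x.1) := stalkAlgebra f x.1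
    ψ x.1 (ExteriorAlgebra.ι (X.presheaf.stalk x.1)
      (etaForm k (Set.range e) (fun i => germAt x (t i)) j)) =
      germAt x (frobCoeff p t (Set.range e) j) • ExteriorAlgebra.ι (X.presheaf.stalk x.1)
        (etaForm k (Set.range e) (fun i => germAt x (t i)) j) + dOne k (germAt x (w j)) := by
  let : Algebra k (X.presheaf.stalk x.1) := stalkAlgebra f x.1
  by_cases hj : j ∈ Set.range e
  · rw [ι_etaForm_of_mem hj, frobCoeff, if_pos hj, map_one, one_smul]
    exact H.map_dlog x hx.down j hj
  · rw [ι_etaForm_of_notMem hj, frobCoeff, if_neg hj, map_pow]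
    exact H.map_d x hx.down j hj

theorem IsFrobChart.preMap_mem {m : ℕ} {x : PreSection f D W.1}
    (hx : x ∈ AddSubgroup.closure (logMonomials f D m W)) :
    preMap f D ψ x ∈ AddSubgroup.closure (logMonomials f D m W) := by
  let : ∀ x : W.1, Algebra k (X.presheaf.stalk x.1) := fun x => stalkAlgebra f x.1
  have h1 := H.toIsLogCoord.closure_eq m
  rw [h1] at hx ⊢
  exact H.toIsLogCoord.chart.famMap_mem p w (fun x => ψ x.1) (fun x => hψ x.1)
    (fun x hx j => H.map_etaForm x hx j) hx

variable [Fact p.Prime] [CharP k p] [PerfectRing k p]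

omit hψ [Fact p.Prime] [CharP k p] [PerfectRing k p] in
theorem IsFrobChart.prevLog_eq (m : ℕ) :
    letI : ∀ x : W.1, Algebra k (X.presheaf.stalk x.1) := fun x => stalkAlgebra f x.1
    prevLog f D W m =
      prevSpan k (fun x : W.1 => PLift (OffDivisor D x.1))
        (B := fun x : W.1 => X.presheaf.stalk x.1) germAt t (Set.range e) m := by
  cases m with
  | zero => rfl
  | succ m => exact H.toIsLogCoord.closure_eq m

theorem IsFrobChart.exists_preMap_add_exact {m : ℕ} {x : PreSection f D W.1}
    (hx : x ∈ AddSubgroup.closure (logMonomials f D m W)) (hdx : preD f D x = 0) :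
    ∃ y ∈ AddSubgroup.closure (logMonomials f D m W), ∃ z ∈ prevLog f D W m,
      x = preMap f D ψ y + preD f D z := by
  let : ∀ x : W.1, Algebra k (X.presheaf.stalk x.1) := fun x => stalkAlgebra f x.1
  have h1 := H.toIsLogCoord.closure_eq m
  have h2 := H.prevLog_eq m
  rw [h1] at hx
  obtain ⟨y, hy, z, hz, h⟩ := H.toIsLogCoord.chart.exists_famMap_add_exact p w (fun x => ψ x.1)
    (fun x => hψ x.1) (fun x hx j => H.map_etaForm x hx j) hx hdx
  exact ⟨y, h1 ▸ hy, z, h2 ▸ hz, h⟩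

theorem IsFrobChart.eq_zero_of_preMap_exact {m : ℕ} {x z : PreSection f D W.1}
    (hx : x ∈ AddSubgroup.closure (logMonomials f D m W)) (hz : z ∈ prevLog f D W m)
    (h : preD f D z = preMap f D ψ x) : x = 0 := by
  let : ∀ x : W.1, Algebra k (X.presheaf.stalk x.1) := fun x => stalkAlgebra f x.1
  have h1 := H.toIsLogCoord.closure_eq m
  have h2 := H.prevLog_eq m
  rw [h1] at hx
  rw [h2] at hz
  exact H.toIsLogCoord.chart.eq_zero_of_famMap_exact p w (fun x => ψ x.1)
    (fun x => hψ x.1) (fun x hx j => H.map_etaForm x hx j) hx hz h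

end chart

section global

variable (hψ : ∀ (x : X) (c : X.presheaf.stalk x) ω, ψ x (c • ω) = c ^ p • ψ x ω)
  (hchart : ∀ x : X, ∃ (W : X.affineOpens) (_ : x ∈ W.1) (n : ℕ) (t w : Fin n → Γ(X, W.1))
    (s : Set ι) (e : s ↪ Fin n), IsFrobChart f D p ψ W t w e)
include hψ hchart

omit hψ in
theorem exists_frobChart_le {x : X} {V : X.Opens} (hx : x ∈ V) :
    ∃ (W : X.affineOpens) (_ : x ∈ W.1) (_ : W.1 ≤ V) (n : ℕ) (t w : Fin n → Γ(X, W.1))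
      (s : Set ι) (e : s ↪ Fin n), IsFrobChart f D p ψ W t w e := by
  obtain ⟨W, hxW, n, t, w, s, e, H⟩ := hchart x
  obtain ⟨W', hxW', hW'⟩ := exists_affine_le (V := W.1 ⊓ V) ⟨hxW, hx⟩
  exact ⟨W', hxW', hW'.trans inf_le_right, n, _, _, s, e, H.restrict (hW'.trans inf_le_left)⟩

theorem IsLogForm.preMap {m : ℕ} {V : X.Opens} {s : PreSection f D V} (hs : IsLogForm f D m s) :
    IsLogForm f D m (preMap f D ψ s) := by
  intro x hx
  obtain ⟨W, hxW, hW, hm⟩ := hs x hx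
  obtain ⟨W', hxW', hW', n, t, w, s', e, H⟩ := exists_frobChart_le hchart hxW
  exact ⟨W', hxW', hW'.trans hW, H.preMap_mem hψ (closure_restrict hW' hm)⟩

variable [Fact p.Prime] [CharP k p] [PerfectRing k p]

/-- Injectivity on cohomology, in degree zero. -/
theorem eq_zero_of_preMap_eq_zero {V : X.Opens} {s : PreSection f D V} (hs : IsLogForm f D 0 s)
    (h : LogDR.preMap f D ψ s = 0) : s = 0 := by
  ext x hx
  obtain ⟨W, hxW, hW, hm⟩ := hs x.1 x.2
  obtain ⟨W', hxW', hW', n, t, w, s', e, H⟩ := exists_frobChart_le hchart hxW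
  have h1 := H.eq_zero_of_preMap_exact hψ (closure_restrict hW' hm) (z := 0) (zero_mem _) (by
    rw [map_zero]
    ext y hy
    exact (congrFun (congrFun h ⟨y.1, hW (hW' y.2)⟩) hy).symm)
  exact congrFun (congrFun h1 ⟨x.1, hxW'⟩) hx

/-- Injectivity on cohomology, in positive degrees. The primitive `z` is any logarithmic form, not
only one defined on a chart. -/
theorem eq_zero_of_preMap_eq_preD {m : ℕ} {V : X.Opens} {s z : PreSection f D V}
    (hs : IsLogForm f D (m + 1) s) (hz : IsLogForm f D m z)
    (h : preD f D z = LogDR.preMap f D ψ s) : s = 0 := by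
  ext x hx
  obtain ⟨W₁, hx₁, hW₁, h₁⟩ := hs x.1 x.2
  obtain ⟨W₂, hx₂, hW₂, h₂⟩ := hz x.1 x.2
  obtain ⟨W, hxW, hW, n, t, w, s', e, H⟩ :=
    exists_frobChart_le hchart (V := W₁.1 ⊓ W₂.1) ⟨hx₁, hx₂⟩
  have hWV := (hW.trans inf_le_left).trans hW₁
  have h1 := H.eq_zero_of_preMap_exact hψ (closure_restrict (hW.trans inf_le_left) h₁)
    (z := preRestrict f D hWV z) (closure_restrict (hW.trans inf_le_right) h₂) (by
    ext y hy
    exact congrFun (congrFun h ⟨y.1, hWV y.2⟩) hy)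
  exact congrFun (congrFun h1 ⟨x.1, hxW⟩) hx

/-- Surjectivity on cohomology sheaves. -/
theorem exists_local_preMap_add {m : ℕ} {V : X.Opens} {s : PreSection f D V}
    (hs : IsLogForm f D m s) (hds : preD f D s = 0) (x : V) :
    ∃ (W : X.affineOpens) (_ : x.1 ∈ W.1) (hW : W.1 ≤ V) (y z : PreSection f D W.1),
      IsLogForm f D m y ∧ z ∈ prevLog f D W m ∧
        preRestrict f D hW s = LogDR.preMap f D ψ y + preD f D z := by
  obtain ⟨W₁, hx₁, hW₁, h₁⟩ := hs x.1 x.2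
  obtain ⟨W, hxW, hW, n, t, w, s', e, H⟩ := exists_frobChart_le hchart hx₁
  obtain ⟨y, hy, z, hz, h⟩ := H.exists_preMap_add_exact hψ (closure_restrict hW h₁) (by
    ext y hy
    exact congrFun (congrFun hds ⟨y.1, hW₁ (hW y.2)⟩) hy)
  exact ⟨W, hxW, hW.trans hW₁, y, z, fun _ hx => ⟨W, hx, le_rfl, hy⟩, hz, h⟩

end global

end frobeniusChart

section pullback

variable {R S : Type u} [CommRing R] [CommRing S] {X Y : Scheme.{u}}
  {f : X ⟶ Spec (CommRingCat.of R)} {f' : Y ⟶ Spec (CommRingCat.of S)} {b : R →+* S} {g : Y ⟶ X}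
  {ι : Type*} {D : ι → X.IdealSheafData} {E : ι → Y.IdealSheafData}

theorem stalkPullback_algebraMap (h : g ≫ f = f' ≫ Spec.map (CommRingCat.ofHom b)) (y : Y)
    (a : X.presheaf.stalk (g y)) :
    stalkPullback h y (algebraMap _ _ a) = algebraMap _ _ ((g.stalkMap y).hom a) :=
  @formsMap_algebraMap R _ _ _ (stalkAlgebra f (g y)) S _ _ _ (stalkAlgebra f' y) b
    (g.stalkMap y).hom (baseToStalk_comp h y) a

theorem stalkPullback_smul (h : g ≫ f = f' ≫ Spec.map (CommRingCat.ofHom b)) (y : Y)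
    (a : X.presheaf.stalk (g y)) (ω : StalkForms f (g y)) :
    stalkPullback h y (a • ω) = (g.stalkMap y).hom a • stalkPullback h y ω := by
  let := stalkAlgebra f (g y)
  let := stalkAlgebra f' y
  exact formsMap_smul b (g.stalkMap y).hom (baseToStalk_comp h y) _ _

theorem stalkPullback_stalkD (h : g ≫ f = f' ≫ Spec.map (CommRingCat.ofHom b)) (y : Y)
    (a : X.presheaf.stalk (g y)) :
    stalkPullback h y (stalkD f (g y) a) = stalkD f' y ((g.stalkMap y).hom a) :=
  @formsMap_dOne R _ _ _ (stalkAlgebra f (g y)) S _ _ _ (stalkAlgebra f' y) b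
    (g.stalkMap y).hom (baseToStalk_comp h y) a

theorem stalkPullback_stalkDlog (h : g ≫ f = f' ≫ Spec.map (CommRingCat.ofHom b)) (y : Y)
    (a : X.presheaf.stalk (g y)) (ha : IsUnit a) :
    stalkPullback h y (stalkDlog f (g y) a) = stalkDlog f' y ((g.stalkMap y).hom a) := by
  let := stalkAlgebra f (g y)
  let := stalkAlgebra f' y
  exact formsMap_dlog b (g.stalkMap y).hom (baseToStalk_comp h y) ha

theorem germAt_appLE {V : X.Opens} {W : Y.Opens} (h : W ≤ g ⁻¹ᵁ V) (y : W) (a : Γ(X, V)) :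
    germAt y ((g.appLE V W h).hom a) =
      (g.stalkMap y.1).hom (germAt (⟨g y.1, h y.2⟩ : V) a) := by
  have h1 := Scheme.Hom.germ_stalkMap_apply g V y.1 (h y.2) a
  refine Eq.trans ?_ h1.symm
  exact germAt_res (V := g ⁻¹ᵁ V) h y ((g.app V).hom a)

/-- The pullback of a family of germs of forms. -/
def prePullback (h : g ≫ f = f' ≫ Spec.map (CommRingCat.ofHom b))
    (hoff : ∀ y, OffDivisor E y → OffDivisor D (g y)) {V : X.Opens} {W : Y.Opens}
    (hW : W ≤ g ⁻¹ᵁ V) : PreSection f D V →+ PreSection f' E W where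
  toFun s y hy := stalkPullback h y.1 (s ⟨g y.1, hW y.2⟩ ⟨hoff y.1 hy.down⟩)
  map_zero' := by ext y hy; exact map_zero (stalkPullback h y.1)
  map_add' s s' := by ext y hy; exact map_add (stalkPullback h y.1) _ _

/-- Logarithmic forms pull back to logarithmic forms, if the divisor upstairs is the inverse
image. -/
theorem IsLogForm.pullback (h : g ≫ f = f' ≫ Spec.map (CommRingCat.ofHom b))
    (hoff : ∀ y, OffDivisor E y → OffDivisor D (g y)) (hE : ∀ i, E i = (D i).comap g)
    {V : X.Opens} {W : Y.Opens} (hW : W ≤ g ⁻¹ᵁ V) {m : ℕ} {s : PreSection f D V}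
    (hs : IsLogForm f D m s) : IsLogForm f' E m (prePullback h hoff hW s) := by
  intro y hy
  obtain ⟨V₁, hyV₁, hV₁, hm⟩ := hs (g y) (hW hy)
  obtain ⟨W₁, hyW₁, hW₁⟩ := exists_affine_le (x := y) (V := W ⊓ g ⁻¹ᵁ V₁.1) ⟨hy, hyV₁⟩
  refine ⟨W₁, hyW₁, hW₁.trans inf_le_left, ?_⟩
  have hWV : W₁.1 ≤ g ⁻¹ᵁ V₁.1 := hW₁.trans inf_le_right
  have key : AddSubgroup.closure (logMonomials f D m V₁) ≤
      (AddSubgroup.closure (logMonomials f' E m W₁)).comap (prePullback h hoff hWV) := by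
    rw [AddSubgroup.closure_le]
    rintro _ ⟨a, γ, hγ, rfl⟩
    refine AddSubgroup.subset_closure ⟨(g.appLE V₁.1 W₁.1 hWV).hom a,
      fun j => prePullback h hoff hWV (γ j), fun j => ?_, ?_⟩
    · rcases hγ j with ⟨c, hc⟩ | ⟨i, t, ht, hc⟩
      · refine Or.inl ⟨(g.appLE V₁.1 W₁.1 hWV).hom c, ?_⟩
        ext y hy
        dsimp only
        rw [hc]
        exact (stalkPullback_stalkD h y.1 _).trans (congrArg _ (germAt_appLE hWV y c).symm)
      · refine Or.inr ⟨i, (g.appLE V₁.1 W₁.1 hWV).hom t, ?_, ?_⟩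
        · rw [hE, ideal_comap g (D i) V₁ W₁ hWV, ht, Ideal.map_span, Set.image_singleton]
        · ext y hy
          dsimp only
          rw [hc]
          refine (stalkPullback_stalkDlog h y.1 _ ?_).trans
            (congrArg _ (germAt_appLE hWV y t).symm)
          exact isUnit_germAt_of_ideal_eq ht ⟨g y.1, hWV y.2⟩ (hoff y.1 hy.down)
    · ext y hy
      refine (stalkPullback_smul h y.1 _ _).trans ?_
      rw [germAt_appLE]
      congr 1
      refine (map_list_prod (stalkPullback h y.1) _).trans ?_
      rw [List.map_ofFn]
      rfl
  exact key hm

end pullback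

/-! ### Witt vectors of length two and the thickening -/

section witt

variable (p : ℕ) [Fact p.Prime] (k : Type u) [Field k] [CharP k p]

omit [CharP k p] in
theorem truncate_eq_iff (a b : WittVector p k) :
    (WittVector.truncate 2 a : W2 p k) = WittVector.truncate 2 b ↔
      a.coeff 0 = b.coeff 0 ∧ a.coeff 1 = b.coeff 1 := by
  constructor
  · intro h
    have h0 := congrArg (fun x => TruncatedWittVector.coeff 0 x) h
    have h1 := congrArg (fun x => TruncatedWittVector.coeff 1 x) h
    simp only [WittVector.coeff_truncate] at h0 h1
    exact ⟨h0, h1⟩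
  · rintro ⟨h0, h1⟩
    ext i
    rw [WittVector.coeff_truncate, WittVector.coeff_truncate]
    fin_cases i
    · exact h0
    · exact h1

omit [CharP k p] in
theorem w2Proj_truncate (a : WittVector p k) : w2Proj p k (WittVector.truncate 2 a) = a.coeff 0 :=
  WittVector.coeff_truncate a 0

theorem w2_natCast_mul_truncate (a : WittVector p k) :
    (p : W2 p k) * WittVector.truncate 2 a =
      WittVector.truncate 2 (WittVector.verschiebung (WittVector.frobenius a)) := by
  rw [WittVector.verschiebung_frobenius, map_mul, map_natCast, mul_comm]

omit [CharP k p] in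
theorem w2Proj_surjective : Function.Surjective (w2Proj p k) := by
  intro a
  refine ⟨WittVector.truncate 2 (WittVector.teichmuller p a), ?_⟩
  rw [w2Proj_truncate, WittVector.teichmuller_coeff_zero]

theorem w2_exists_of_proj_eq_zero [PerfectRing k p] {x : W2 p k} (hx : w2Proj p k x = 0) :
    ∃ y, x = p * y := by
  obtain ⟨a, rfl⟩ := WittVector.truncate_surjective p 2 k x
  rw [w2Proj_truncate] at hx
  obtain ⟨c, hc⟩ := (frobeniusEquiv k p).surjective (a.coeff 1)
  refine ⟨WittVector.truncate 2 (WittVector.teichmuller p c), ?_⟩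
  rw [w2_natCast_mul_truncate, truncate_eq_iff, WittVector.verschiebung_coeff_zero,
    WittVector.verschiebung_coeff_succ, WittVector.coeff_frobenius_charP,
    WittVector.teichmuller_coeff_zero]
  exact ⟨hx, hc.symm⟩

theorem w2Proj_eq_zero_of_natCast_mul {x : W2 p k} (hx : (p : W2 p k) * x = 0) :
    w2Proj p k x = 0 := by
  obtain ⟨a, rfl⟩ := WittVector.truncate_surjective p 2 k x
  rw [w2_natCast_mul_truncate, ← map_zero (WittVector.truncate 2), truncate_eq_iff] at hx
  have h1 := hx.2
  rw [WittVector.verschiebung_coeff_succ, WittVector.coeff_frobenius_charP,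
    WittVector.zero_coeff] at h1
  rw [w2Proj_truncate]
  exact eq_zero_of_pow_eq_zero h1

theorem w2_natCast_sq : (p : W2 p k) * p = 0 := by
  have h1 : (p : W2 p k) = WittVector.truncate 2 (p : WittVector p k) := by rw [map_natCast]
  have h2 : (p : WittVector p k) = WittVector.verschiebung (WittVector.frobenius 1) := by
    rw [WittVector.verschiebung_frobenius, one_mul]
  conv_lhs => rw [h1]
  rw [← map_mul, ← map_zero (WittVector.truncate 2), truncate_eq_iff]
  have h3 (a : WittVector p k) : (p : WittVector p k) * a =
      WittVector.verschiebung (WittVector.frobenius a) := by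
    rw [WittVector.verschiebung_frobenius, mul_comm]
  rw [h3, WittVector.verschiebung_coeff_zero, WittVector.verschiebung_coeff_succ, WittVector.coeff_frobenius_charP,
    h2,
    WittVector.verschiebung_coeff_zero, WittVector.zero_coeff,
    WittVector.zero_coeff, zero_pow (Fact.out : p.Prime).ne_zero]
  exact ⟨rfl, rfl⟩

theorem w2Frob_bijective [PerfectRing k p] : Function.Bijective (w2Frob p k) := by
  have h (x : W2 p k) (i : Fin 2) : (w2Frob p k x).coeff i = x.coeff i ^ p :=
    TruncatedWittVector.coeff_mk (p := p) (fun i => x.coeff i ^ p) i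
  constructor
  · intro x y hxy
    ext i
    refine (frobeniusEquiv k p).injective ?_
    change x.coeff i ^ p = y.coeff i ^ p
    rw [← h, ← h, hxy]
  · intro y
    refine ⟨TruncatedWittVector.mk p fun i => (frobeniusEquiv k p).symm (y.coeff i), ?_⟩
    ext i
    rw [h, TruncatedWittVector.coeff_mk]
    exact (frobeniusEquiv k p).apply_symm_apply _

variable {p k}

/-- In a flat algebra over `W₂(k)`, the annihilator of `p` is generated by `p`. -/
theorem exists_of_flat_w2 [PerfectRing k p] {A : Type*} [CommRing A] {b : W2 p k →+* A}
    (hb : b.Flat) {a : A} (ha : (p : A) * a = 0) : ∃ a', a = p * a' := by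
  let := b.toAlgebra
  have : Module.Flat (W2 p k) A := hb
  obtain ⟨l, c, y, hy, hc⟩ := Module.Flat.isTrivialRelation_of_sum_smul_eq_zero (R := W2 p k)
    (M := A) (ι := Unit) (f := fun _ => (p : W2 p k)) (x := fun _ => a) (by
      rw [Finset.univ_unique, Finset.sum_singleton, Algebra.smul_def, map_natCast, ha])
  have h1 : ∀ j, ∃ d, c () j = p * d := by
    intro j
    have := hc j
    rw [Finset.univ_unique, Finset.sum_singleton] at this
    exact w2_exists_of_proj_eq_zero p k (w2Proj_eq_zero_of_natCast_mul p k this)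
  choose d hd using h1
  refine ⟨∑ j, d j • y j, ?_⟩
  refine (hy ()).trans ?_
  rw [Finset.mul_sum]
  refine Finset.sum_congr rfl fun j _ => ?_
  rw [hd, mul_smul, Algebra.smul_def (p : W2 p k), map_natCast]

theorem baseToSections_flat {R : Type u} [CommRing R] {Y : Scheme.{u}}
    (g : Y ⟶ Spec (CommRingCat.of R)) [Flat g] (N : Y.affineOpens) :
    (baseToSections g N.1).Flat := by
  have h1 := Scheme.Hom.flat_appLE g (isAffineOpen_top _) N.2 (le_top : N.1 ≤ g ⁻¹ᵁ ⊤)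
  have h2 : (Scheme.ΓSpecIso (CommRingCat.of R)).inv.hom.Flat :=
    RingHom.Flat.of_bijective (ConcreteCategory.bijective_of_isIso _)
  have h3 : baseToSections g N.1 = (g.appLE ⊤ N.1 le_top).hom.comp
      (Scheme.ΓSpecIso (CommRingCat.of R)).inv.hom := rfl
  rw [h3]
  exact RingHom.Flat.comp h2 h1

end witt

section thickening

variable {p : ℕ} [Fact p.Prime] {k : Type u} [Field k] [CharP k p]
  {X : Scheme.{u}} {f : X ⟶ Spec (CommRingCat.of k)} {ι : Type*} {D : ι → X.IdealSheafData}
  (L : LogLifting p f D)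

namespace LogLifting

instance : IsClosedImmersion L.incl := by
  have : IsClosedImmersion (Spec.map (CommRingCat.ofHom (w2Proj p k))) :=
    IsClosedImmersion.spec_of_surjective _ (w2Proj_surjective p k)
  exact MorphismProperty.of_isPullback L.isPullback.flip this

theorem natCast_sq_eq_zero (N : L.space.Opens) : (p : Γ(L.space, N)) * p = 0 := by
  have := congrArg (baseToSections L.str N) (w2_natCast_sq p k)
  rwa [map_mul, map_natCast, map_zero] at this

omit [CharP k p] in
theorem incl_app_surjective (N : L.space.affineOpens) :
    Function.Surjective (L.incl.app N.1).hom :=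
  L.incl.app_surjective N.1 N.2

variable [PerfectRing k p]

theorem ker_incl_app (N : L.space.affineOpens) :
    RingHom.ker (L.incl.app N.1).hom = Ideal.span {(p : Γ(L.space, N.1))} := by
  have : IsClosedImmersion (Spec.map (CommRingCat.ofHom (w2Proj p k))) :=
    IsClosedImmersion.spec_of_surjective _ (w2Proj_surjective p k)
  have h1 : L.incl.ker = (Spec.map (CommRingCat.ofHom (w2Proj p k))).ker.comap L.str := by
    rw [← Scheme.IdealSheafData.ker_fst_of_isClosedImmersion,
      ← Scheme.Hom.ker_comp_of_isIso L.isPullback.isoPullback.hom,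
      L.isPullback.isoPullback_hom_fst]
  have h2 : RingHom.ker ((Spec.map (CommRingCat.ofHom (w2Proj p k))).app ⊤).hom =
      Ideal.span {(p : Γ(Spec (CommRingCat.of (W2 p k)), ⊤))} := by
    apply le_antisymm
    · intro s hs
      obtain ⟨r, rfl⟩ := (ConcreteCategory.bijective_of_isIso
        (Scheme.ΓSpecIso (CommRingCat.of (W2 p k))).inv).surjective s
      have h3 := congr(($(Scheme.ΓSpecIso_inv_naturality
        (CommRingCat.ofHom (w2Proj p k)))).hom r)
      have h4 : (Scheme.ΓSpecIso (CommRingCat.of k)).inv.hom (w2Proj p k r) = 0 := h3.trans hs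
      have h5 : w2Proj p k r = 0 := (ConcreteCategory.bijective_of_isIso
        (Scheme.ΓSpecIso (CommRingCat.of k)).inv).injective
          (h4.trans (map_zero (Scheme.ΓSpecIso (CommRingCat.of k)).inv.hom).symm)
      obtain ⟨r', rfl⟩ := w2_exists_of_proj_eq_zero p k h5
      refine Ideal.mem_span_singleton.mpr
        ⟨(Scheme.ΓSpecIso (CommRingCat.of (W2 p k))).inv.hom r', ?_⟩
      rw [← map_natCast (Scheme.ΓSpecIso (CommRingCat.of (W2 p k))).inv.hom, ← map_mul]
    · rw [Ideal.span_singleton_le_iff_mem, RingHom.mem_ker, map_natCast]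
      exact natCast_eq_zero_of_top (natCast_eq_zero_of_over p (𝟙 (Spec (CommRingCat.of k)))) _
  rw [← Scheme.Hom.ker_apply, h1, ideal_comap L.str _ ⟨⊤, isAffineOpen_top _⟩ N le_top,
    Scheme.Hom.ker_apply, h2, Ideal.map_span, Set.image_singleton, map_natCast]

theorem exists_of_incl_app_eq_zero (N : L.space.affineOpens) {a : Γ(L.space, N.1)}
    (ha : (L.incl.app N.1).hom a = 0) : ∃ a', a = p * a' := by
  have h : a ∈ RingHom.ker (L.incl.app N.1).hom := ha
  rw [L.ker_incl_app] at h
  exact Ideal.mem_span_singleton.mp h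

omit [PerfectRing k p] in
theorem incl_app_natCast_mul (N : L.space.Opens) (a : Γ(L.space, N)) :
    (L.incl.app N).hom (p * a) = 0 := by
  have h : ((p : ℕ) : Γ(X, L.incl ⁻¹ᵁ N)) = 0 :=
    natCast_eq_zero_of_top (natCast_eq_zero_of_over p f) _
  rw [map_mul, map_natCast, h, zero_mul]

theorem natCast_mul_eq_zero_iff (N : L.space.affineOpens) (a : Γ(L.space, N.1)) :
    (p : Γ(L.space, N.1)) * a = 0 ↔ (L.incl.app N.1).hom a = 0 := by
  constructor
  · intro h
    have := L.flat
    obtain ⟨a', rfl⟩ := exists_of_flat_w2 (baseToSections_flat L.str N) h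
    exact L.incl_app_natCast_mul _ _
  · intro h
    obtain ⟨a', rfl⟩ := L.exists_of_incl_app_eq_zero N h
    rw [← mul_assoc, L.natCast_sq_eq_zero, zero_mul]

/-- The scheme and its lifting have the same points, as the ideal of the closed immersion is
generated by `p`, and `p ^ 2 = 0`. -/
theorem incl_surjective : Function.Surjective L.incl := by
  intro x
  obtain ⟨N, hxN, -⟩ := exists_affine_le (V := (⊤ : L.space.Opens)) (x := x) trivial
  have h1 : x ∈ L.incl.ker.support := by
    rw [mem_support_iff_not_isUnit (W := N) (t := (p : Γ(L.space, N.1))) ?_ ⟨x, hxN⟩]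
    · intro h
      have h2 : germAt (⟨x, hxN⟩ : N.1) ((p : Γ(L.space, N.1)) * p) = 0 := by
        rw [L.natCast_sq_eq_zero, map_zero]
      rw [map_mul] at h2
      exact (h.mul h).ne_zero h2
    · rw [Scheme.Hom.ker_apply, L.ker_incl_app]
  have h2 : (L.incl.ker.support : Set L.space) = closure (Set.range L.incl) :=
    Scheme.Hom.support_ker L.incl
  have h3 : x ∈ (L.incl.ker.support : Set L.space) := h1
  rw [h2, L.incl.isClosedEmbedding.isClosed_range.closure_eq] at h3
  exact h3

end LogLifting

end thickening

/-! ### The lifted Frobenius on sections and stalks -/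

section germs

theorem exists_affine_germAt_eq {X : Scheme.{u}} {V : X.Opens} (x : V)
    (s : X.presheaf.stalk x.1) :
    ∃ (W : X.affineOpens) (hx : x.1 ∈ W.1) (_ : W.1 ≤ V) (a : Γ(X, W.1)),
      germAt ⟨x.1, hx⟩ a = s := by
  obtain ⟨U, hU, a, rfl⟩ := TopCat.Presheaf.exists_germ_eq X.presheaf s
  obtain ⟨W, hxW, hW⟩ := exists_affine_le (V := U ⊓ V) ⟨hU, x.2⟩
  exact ⟨W, hxW, hW.trans inf_le_right, res (hW.trans inf_le_left) a,
    germAt_res (hW.trans inf_le_left) ⟨x.1, hxW⟩ a⟩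

theorem exists_affine_res_eq_zero {X : Scheme.{u}} {V : X.Opens} (x : V) {a : Γ(X, V)}
    (h : germAt x a = 0) :
    ∃ (W : X.affineOpens) (_ : x.1 ∈ W.1) (hW : W.1 ≤ V), res hW a = 0 := by
  obtain ⟨U, hU, i, j, hij⟩ := X.presheaf.germ_eq x.1 x.2 x.2 a 0
    (h.trans (map_zero (germAt x)).symm)
  obtain ⟨W, hxW, hW⟩ := exists_affine_le (V := U) hU
  refine ⟨W, hxW, hW.trans i.le, ?_⟩
  have h1 : res (hW.trans i.le) a = res hW (res i.le a) := by
    change (X.presheaf.map _).hom a = (X.presheaf.map _).hom ((X.presheaf.map _).hom a)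
    rw [← RingHom.comp_apply, ← CommRingCat.hom_comp, ← X.presheaf.map_comp]
    rfl
  have h2 : res i.le a = 0 := by
    refine Eq.trans hij ?_
    exact map_zero (X.presheaf.map j.op).hom
  rw [h1, h2, map_zero]

end germs

section twist

variable (p : ℕ) [Fact p.Prime] {k : Type u} [Field k] [CharP k p] [PerfectRing k p]
  {X : Scheme.{u}} (f : X ⟶ Spec (CommRingCat.of k))

instance isIso_frobenius : IsIso (CommRingCat.ofHom (frobenius k p)) :=
  (RingEquiv.toCommRingCatIso (frobeniusEquiv k p)).isIso_hom

instance isIso_w2Frob : IsIso (CommRingCat.ofHom (w2Frob p k)) :=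
  (RingEquiv.toCommRingCatIso (RingEquiv.ofBijective _ (w2Frob_bijective p k))).isIso_hom

instance isIso_twist_fst {Y : Scheme.{u}} (g : Y ⟶ Spec (CommRingCat.of (W2 p k))) :
    IsIso (pullback.fst g (Spec.map (CommRingCat.ofHom (w2Frob p k)))) := inferInstance

end twist

namespace FrobeniusLifting

variable {p : ℕ} [Fact p.Prime] {k : Type u} [Field k] [CharP k p] [PerfectRing k p]
  {X : Scheme.{u}} {f : X ⟶ Spec (CommRingCat.of k)} {ι : Type*} [Fintype ι]
  {D : ι → X.IdealSheafData} {L : LogLifting p f D} (Φ : FrobeniusLifting L)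

/-- The lifting of the absolute Frobenius morphism of `X` to the lifting of `X` that corresponds
to the lifting of the relative Frobenius morphism. -/
def absLift : L.space ⟶ L.space := Φ.hom ≫ pullback.fst _ _

omit [PerfectRing k p] in
theorem incl_absLift :
    L.incl ≫ Φ.absLift = absFrobenius p X (natCast_eq_zero_of_over p f) ≫ L.incl := by
  rw [absLift, ← Category.assoc, Φ.incl_hom, Category.assoc, L.inclTwist_fst, ← Category.assoc,
    relFrobenius, pullback.lift_fst]

/-- On points, the lifted Frobenius is the identity. -/
theorem absLift_apply (x : L.space) : Φ.absLift x = x := by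
  obtain ⟨y, rfl⟩ := L.incl_surjective x
  rw [← Scheme.Hom.comp_apply, Φ.incl_absLift]
  rfl

theorem le_absLift_preimage (N : L.space.Opens) : N ≤ Φ.absLift ⁻¹ᵁ N := by
  intro x hx
  change Φ.absLift x ∈ N
  rwa [Φ.absLift_apply]

/-- The action of the lifted Frobenius on functions. -/
def sectionMap (N : L.space.Opens) : Γ(L.space, N) →+* Γ(L.space, N) :=
  (Φ.absLift.appLE N N (Φ.le_absLift_preimage N)).hom

theorem incl_app_sectionMap (N : L.space.Opens) (a : Γ(L.space, N)) :
    (L.incl.app N).hom (Φ.sectionMap N a) = (L.incl.app N).hom a ^ p := by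
  have h1 : (L.incl ≫ Φ.absLift).appLE N (L.incl ⁻¹ᵁ N)
      ((Scheme.Hom.preimage_mono L.incl (Φ.le_absLift_preimage N))) =
      Φ.absLift.appLE N N (Φ.le_absLift_preimage N) ≫ L.incl.app N := by
    rw [← Scheme.Hom.appLE_eq_app, Scheme.Hom.appLE_comp_appLE]
  have h2 := congr($(h1.symm).hom a)
  refine h2.trans ?_
  have h3 : ∀ (g : X ⟶ L.space)
      (hg : g = absFrobenius p X (natCast_eq_zero_of_over p f) ≫ L.incl)
      (e : L.incl ⁻¹ᵁ N ≤ g ⁻¹ᵁ N), (g.appLE N (L.incl ⁻¹ᵁ N) e).hom a =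
        (L.incl.app N).hom a ^ p := by
    rintro _ rfl e
    rw [Scheme.Hom.appLE, Scheme.Hom.comp_app]
    exact congr(($(X.presheaf.map_id (op (L.incl ⁻¹ᵁ N)))).hom ((L.incl.app N).hom a ^ p))
  exact h3 _ Φ.incl_absLift _

theorem isFrobLift_sections (N : L.space.affineOpens) :
    IsFrobLift p (L.incl.app N.1).hom (Φ.sectionMap N.1) where
  sq_zero := L.natCast_sq_eq_zero N.1
  surjective := L.incl_app_surjective N
  natCast_mul_eq_zero_iff := L.natCast_mul_eq_zero_iff N
  exists_of_eq_zero _ := L.exists_of_incl_app_eq_zero N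
  frob := Φ.incl_app_sectionMap N.1

/-- The action of the lifted Frobenius on stalks. -/
def stalkEndo (y : L.space) : L.space.presheaf.stalk y →+* L.space.presheaf.stalk y :=
  (Φ.absLift.stalkMap y).hom.comp
    (L.space.presheaf.stalkSpecializes (specializes_of_eq (Φ.absLift_apply y))).hom

theorem stalkEndo_germAt {N : L.space.Opens} (y : N) (a : Γ(L.space, N)) :
    Φ.stalkEndo y.1 (germAt y a) = germAt y (Φ.sectionMap N a) := by
  rw [sectionMap, germAt_appLE (Φ.le_absLift_preimage N) y a]
  change (Φ.absLift.stalkMap y.1).hom _ = (Φ.absLift.stalkMap y.1).hom _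
  congr 1
  exact L.space.presheaf.germ_stalkSpecializes_apply y.2
    (specializes_of_eq (Φ.absLift_apply y.1)) a

omit [CharP k p] [PerfectRing k p] [Fintype ι] in
theorem stalkMap_germAt {N : L.space.Opens} (y : X) (hy : L.incl y ∈ N)
    (a : Γ(L.space, N)) :
    (L.incl.stalkMap y).hom (germAt (⟨L.incl y, hy⟩ : N) a) =
      germAt (⟨y, hy⟩ : (L.incl ⁻¹ᵁ N : X.Opens)) ((L.incl.app N).hom a) :=
  Scheme.Hom.germ_stalkMap_apply L.incl N y hy a

omit [CharP k p] [PerfectRing k p] [Fintype ι] in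
theorem exists_affine_preimage_le {W : X.Opens} {N : L.space.Opens} {y : X} (hy : y ∈ W)
    (hN : L.incl y ∈ N) : ∃ N' : L.space.affineOpens, L.incl y ∈ N'.1 ∧ N'.1 ≤ N ∧
      L.incl ⁻¹ᵁ N'.1 ≤ W := by
  obtain ⟨O, hO, hW⟩ := L.incl.isClosedEmbedding.isInducing.isOpen_iff.mp W.2
  obtain ⟨N', hy', hN'⟩ := exists_affine_le (V := (⟨O, hO⟩ ⊓ N : L.space.Opens)) (x := L.incl y)
    ⟨by change y ∈ L.incl ⁻¹' O; rw [hW]; exact hy, hN⟩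
  refine ⟨N', hy', hN'.trans inf_le_right, fun z hz => ?_⟩
  have h1 : z ∈ L.incl ⁻¹' O := (hN' hz).1
  rwa [hW] at h1

omit [CharP k p] [PerfectRing k p] [Fintype ι] in
theorem incl_app_res {N N' : L.space.Opens} (h : N' ≤ N) (a : Γ(L.space, N)) :
    (L.incl.app N').hom (res h a) = res (L.incl.preimage_mono h) ((L.incl.app N).hom a) :=
  congr($(L.incl.naturality (homOfLE h).op).hom a)

omit [Fintype ι] in
theorem exists_of_stalkMap_eq_zero {N : L.space.Opens} (y : X) (hy : L.incl y ∈ N)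
    (a : Γ(L.space, N))
    (hs : (L.incl.stalkMap y).hom (germAt (⟨L.incl y, hy⟩ : N) a) = 0) :
    ∃ b, germAt (⟨L.incl y, hy⟩ : N) a = p * b := by
  rw [stalkMap_germAt] at hs
  obtain ⟨W, hyW, hW, h0⟩ := exists_affine_res_eq_zero _ hs
  obtain ⟨N', hyN', hN', hW'⟩ := exists_affine_preimage_le hyW hy
  have h1 : (L.incl.app N'.1).hom (res hN' a) = 0 := by
    rw [incl_app_res]
    have h2 : ∀ c : Γ(X, L.incl ⁻¹ᵁ N), res (L.incl.preimage_mono hN') c = res hW' (res hW c) := by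
      intro c
      change (X.presheaf.map _).hom c = (X.presheaf.map _).hom ((X.presheaf.map _).hom c)
      rw [← RingHom.comp_apply, ← CommRingCat.hom_comp, ← X.presheaf.map_comp]
      rfl
    rw [h2, h0, map_zero]
  obtain ⟨b, hb⟩ := L.exists_of_incl_app_eq_zero N' h1
  refine ⟨germAt (⟨L.incl y, hyN'⟩ : N'.1) b, ?_⟩
  rw [← germAt_res hN' ⟨L.incl y, hyN'⟩ a, hb, map_mul, map_natCast]

theorem isFrobLift_stalk (y : X) :
    IsFrobLift p (L.incl.stalkMap y).hom (Φ.stalkEndo (L.incl y)) where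
  sq_zero := by
    have := congrArg (germAt (⟨L.incl y, trivial⟩ : (⊤ : L.space.Opens)))
      (L.natCast_sq_eq_zero ⊤)
    rwa [map_mul, map_natCast, map_zero] at this
  surjective := L.incl.stalkMap_surjective y
  exists_of_eq_zero s hs := by
    obtain ⟨N, hN, -, a, rfl⟩ := exists_affine_germAt_eq
      (⟨L.incl y, trivial⟩ : (⊤ : L.space.Opens)) s
    exact exists_of_stalkMap_eq_zero y hN a hs
  natCast_mul_eq_zero_iff s := by
    obtain ⟨N, hN, -, a, rfl⟩ := exists_affine_germAt_eq
      (⟨L.incl y, trivial⟩ : (⊤ : L.space.Opens)) s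
    constructor
    · intro h
      replace h : germAt (⟨L.incl y, hN⟩ : N.1) (p * a) = 0 := by
        rw [map_mul, map_natCast]
        exact h
      obtain ⟨W, hyW, hW, h0⟩ := exists_affine_res_eq_zero _ h
      rw [map_mul, map_natCast, L.natCast_mul_eq_zero_iff] at h0
      rw [← germAt_res hW ⟨L.incl y, hyW⟩ a]
      refine (stalkMap_germAt y hyW _).trans ?_
      rw [h0, map_zero]
    · intro h
      obtain ⟨b, hb⟩ := exists_of_stalkMap_eq_zero y hN a h
      have := congrArg (germAt (⟨L.incl y, trivial⟩ : (⊤ : L.space.Opens)))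
        (L.natCast_sq_eq_zero ⊤)
      rw [map_mul, map_natCast, map_zero] at this
      refine (congrArg _ hb).trans ?_
      rw [← mul_assoc]
      refine (congrArg (· * b) this).trans (zero_mul b)
  frob s := by
    obtain ⟨N, hN, -, a, rfl⟩ := exists_affine_germAt_eq
      (⟨L.incl y, trivial⟩ : (⊤ : L.space.Opens)) s
    have h1 := Φ.stalkEndo_germAt ⟨L.incl y, hN⟩ a
    dsimp only at h1 ⊢
    rw [h1, stalkMap_germAt, stalkMap_germAt, Φ.incl_app_sectionMap, map_pow]

end FrobeniusLifting

/-! ### Existence of Frobenius charts -/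

section algebra

variable {p : ℕ} {T A : Type*} [CommRing T] [CommRing A] {r : T →+* A}
  {Ψ : T →+* T}

/-- If the product of the `Ψ τ` is divisible by the `p`-th power of the product of the `τ`, then
each `Ψ τ` is `τ ^ p` times a unit congruent to one modulo `p`. The other factors `Ψ σ` reduce to `σ
^ p`, and these are regular modulo `τ ^ p`. -/
theorem IsFrobLift.exists_eq_pow_mul {κ : Type*} [Fintype κ] (H : IsFrobLift p r Ψ) (τ : κ → T)
    (hreg : ∀ i b, r (τ i) * b = 0 → b = 0)
    (hmod : ∀ i j b, i ≠ j → r (τ i) ^ p ∣ r (τ j) ^ p * b → r (τ i) ^ p ∣ b)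
    (hdvd : (∏ i, τ i) ^ p ∣ ∏ i, Ψ (τ i)) (i : κ) :
    ∃ w, Ψ (τ i) = τ i ^ p * (1 + p * w) := by
  classical
  obtain ⟨u, hu⟩ := H.exists_delta (τ i)
  have hmod' : ∀ (s : Finset κ) (_ : i ∉ s) (b : A),
      r (τ i) ^ p ∣ (∏ j ∈ s, r (τ j) ^ p) * b → r (τ i) ^ p ∣ b := by
    intro s
    induction s using Finset.induction_on with
    | empty => intro _ b hb; simpa using hb
    | insert j s hj ih =>
      intro hi b hb
      rw [Finset.prod_insert hj, mul_assoc] at hb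
      rw [Finset.mem_insert, not_or] at hi
      exact ih hi.2 _ (hmod i j _ hi.1 hb)
  have hregp : ∀ b, r (τ i) ^ p * b = 0 → b = 0 := by
    intro b hb
    have : ∀ m : ℕ, r (τ i) ^ m * b = 0 → b = 0 := by
      intro m
      induction m with
      | zero => intro h; simpa using h
      | succ m ih => intro h; exact ih (hreg i _ (by rw [← h]; ring))
    exact this p hb
  let Q := ∏ j ∈ Finset.univ.erase i, Ψ (τ j)
  have h1 : τ i ^ p ∣ Ψ (τ i) * Q := by
    have h0 := Finset.mul_prod_erase Finset.univ (fun j => Ψ (τ j)) (Finset.mem_univ i)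
    refine Dvd.dvd.trans ?_ h0.symm.dvd
    refine Dvd.dvd.trans (pow_dvd_pow_of_dvd ?_ p) hdvd
    exact Finset.dvd_prod_of_mem τ (Finset.mem_univ i)
  have h2 : τ i ^ p ∣ p * (u * Q) := by
    rw [hu, add_mul, mul_assoc] at h1
    exact (dvd_add_right (dvd_mul_right _ _)).mp h1
  obtain ⟨e, he⟩ := h2
  have hp : ∀ b, r (p * b) = 0 := fun b => (H.natCast_mul_eq_zero_iff _).mp (by
    rw [← mul_assoc, H.sq_zero, zero_mul])
  -- The quotient `e` is divisible by `p` since `τ i` is regular on the reduction, so that the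
  -- divisibility can be divided by `p`.
  obtain ⟨e', rfl⟩ := H.exists_of_eq_zero e (hregp _ (by
    rw [← map_pow, ← map_mul, ← he, hp]))
  have h3 : (p : T) * (u * Q - τ i ^ p * e') = 0 := by rw [mul_sub, he]; ring
  rw [H.natCast_mul_eq_zero_iff, map_sub, map_mul, map_mul, map_pow, sub_eq_zero] at h3
  have h4 : r (τ i) ^ p ∣ r u := by
    refine hmod' (Finset.univ.erase i) (Finset.notMem_erase i _) _ ⟨r e', ?_⟩
    rw [← h3, map_prod, mul_comm]
    congr 1
    exact Finset.prod_congr rfl fun j _ => (H.frob _).symm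
  obtain ⟨w, hw⟩ := h4
  obtain ⟨w, rfl⟩ := H.surjective w
  refine ⟨w, ?_⟩
  have h5 : (p : T) * (u - τ i ^ p * w) = 0 := by
    rw [H.natCast_mul_eq_zero_iff, map_sub, map_mul, map_pow, hw, sub_self]
  rw [mul_sub, sub_eq_zero] at h5
  rw [hu, h5]
  ring

/-- An ideal of `T` with flat quotient and with principal reduction is principal, generated by a
lift of the generator. This is Nakayama's lemma for the nilpotent ideal generated by `p`. -/
theorem IsFrobLift.exists_span_eq (H : IsFrobLift p r Ψ) {I : Ideal T} {a : A}
    (hI : I.map r = Ideal.span {a}) (hflat : ∀ x, (p : T) * x ∈ I → ∃ y, x - p * y ∈ I) :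
    ∃ τ, r τ = a ∧ I = Ideal.span {τ} := by
  have ha : a ∈ I.map r := hI ▸ Ideal.mem_span_singleton_self a
  obtain ⟨τ, hτ, rfl⟩ := (Ideal.mem_map_iff_of_surjective r H.surjective).mp ha
  refine ⟨τ, rfl, le_antisymm (fun x hx => ?_) ?_⟩
  · have key : ∀ x ∈ I, ∃ b c, x = τ * b + p * c := by
      intro x hx
      have h1 := Ideal.mem_map_of_mem r hx
      rw [hI, Ideal.mem_span_singleton] at h1
      obtain ⟨b, hb⟩ := h1
      obtain ⟨b, rfl⟩ := H.surjective b
      obtain ⟨c, hc⟩ := H.exists_of_eq_zero (x - τ * b) (by rw [map_sub, map_mul, hb, sub_self])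
      exact ⟨b, c, by rw [← hc]; ring⟩
    obtain ⟨b, c, rfl⟩ := key x hx
    have h1 : (p : T) * c ∈ I := by
      have := I.sub_mem hx (I.mul_mem_right b hτ)
      rwa [add_sub_cancel_left] at this
    obtain ⟨y, hy⟩ := hflat c h1
    obtain ⟨b', c', h2⟩ := key _ hy
    refine Ideal.mem_span_singleton.mpr ⟨b + p * b', ?_⟩
    have h3 : (p : T) * (c - p * y) = p * (τ * b' + p * c') := by rw [h2]
    rw [mul_sub, mul_add, ← mul_assoc, ← mul_assoc (p : T) (p : T) c', H.sq_zero, zero_mul,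
      zero_mul, sub_zero, add_zero] at h3
    rw [h3]
    ring
  · rwa [Ideal.span_singleton_le_iff_mem]

end algebra

theorem prod_mem_ideal_prod {X : Scheme.{u}} {κ : Type*} (s : Finset κ) (I : κ → X.IdealSheafData)
    (V : X.affineOpens) (a : κ → Γ(X, V.1)) (ha : ∀ i ∈ s, a i ∈ (I i).ideal V) :
    ∏ i ∈ s, a i ∈ (∏ i ∈ s, I i).ideal V := by
  classical
  induction s using Finset.induction_on with
  | empty => exact trivial
  | insert i s hi ih =>
    rw [Finset.prod_insert hi, Finset.prod_insert hi]
    exact Ideal.mul_mem_mul (ha i (Finset.mem_insert_self _ _))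
      (ih fun j hj => ha j (Finset.mem_insert_of_mem hj))

theorem ideal_prod_eq_span {X : Scheme.{u}} {κ : Type*} (s : Finset κ) (I : κ → X.IdealSheafData)
    (V : X.affineOpens) (a : κ → Γ(X, V.1)) (ha : ∀ i ∈ s, (I i).ideal V = Ideal.span {a i}) :
    (∏ i ∈ s, I i).ideal V = Ideal.span {∏ i ∈ s, a i} := by
  classical
  induction s using Finset.induction_on with
  | empty => exact Ideal.span_singleton_one.symm
  | insert i s hi ih =>
    rw [Finset.prod_insert hi, Finset.prod_insert hi, ← Ideal.span_singleton_mul_span_singleton,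
      ← ha i (Finset.mem_insert_self _ _), ← ih fun j hj => ha j (Finset.mem_insert_of_mem hj)]
    rfl

section

variable {p : ℕ} [Fact p.Prime] {k : Type u} [Field k] [CharP k p] [PerfectRing k p]
  {X : Scheme.{u}} {f : X ⟶ Spec (CommRingCat.of k)} {ι : Type*}
  {D : ι → X.IdealSheafData}

namespace LogLifting

variable (L : LogLifting p f D)

/-- The components of the lifted divisor are flat. -/
theorem exists_sub_mem_ideal (i : ι) (N : L.space.affineOpens) {x : Γ(L.space, N.1)}
    (hx : (p : Γ(L.space, N.1)) * x ∈ (L.div i).ideal N) :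
    ∃ y, x - p * y ∈ (L.div i).ideal N := by
  have hflat := L.flat_div i
  let N' : (L.div i).subscheme.affineOpens :=
    ⟨(L.div i).subschemeι ⁻¹ᵁ N.1, N.2.preimage (L.div i).subschemeι⟩
  have hker := (L.div i).ker_subschemeι_app N
  have h1 : ((L.div i).subschemeι.app N.1).hom (p * x) = 0 := by
    rw [← RingHom.mem_ker, hker]
    exact hx
  rw [map_mul, map_natCast] at h1
  obtain ⟨y, hy⟩ := exists_of_flat_w2
    (baseToSections_flat ((L.div i).subschemeι ≫ L.str) N') h1
  obtain ⟨y, rfl⟩ := (L.div i).subschemeι_app_surjective N y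
  refine ⟨y, ?_⟩
  rw [← hker, RingHom.mem_ker, map_sub, map_mul, map_natCast, sub_eq_zero]
  exact hy

omit [CharP k p] [PerfectRing k p] in
theorem map_ideal_div (i : ι) (N : L.space.affineOpens) (W : X.affineOpens)
    (hW : W.1 = L.incl ⁻¹ᵁ N.1) :
    ((L.div i).ideal N).map (L.incl.appLE N.1 W.1 hW.le).hom = (D i).ideal W := by
  rw [← ideal_comap, L.comap_div]

end LogLifting

namespace FrobeniusLifting

variable [Fintype ι] {L : LogLifting p f D} (Φ : FrobeniusLifting L)

/-- The compatibility of the lifted Frobenius with the divisor, in terms of local equations. -/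
theorem prod_sectionMap_dvd (N : L.space.affineOpens) (τ : ι → Γ(L.space, N.1))
    (hτ : ∀ i, (L.div i).ideal N = Ideal.span {τ i}) :
    (∏ i, τ i) ^ p ∣ ∏ i, Φ.sectionMap N.1 (τ i) := by
  let pr := pullback.fst L.str (Spec.map (CommRingCat.ofHom (w2Frob p k)))
  let V : (twist (w2Frob p k) L.str).affineOpens := ⟨pr ⁻¹ᵁ N.1, N.2.preimage pr⟩
  have hV : N.1 ≤ Φ.hom ⁻¹ᵁ V.1 := Φ.le_absLift_preimage N.1
  have h1 : ∀ a, Φ.sectionMap N.1 a =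
      (Φ.hom.appLE V.1 N.1 hV).hom ((pr.appLE N.1 V.1 le_rfl).hom a) :=
    fun a => congr($((Scheme.Hom.appLE_comp_appLE Φ.hom pr N.1 V.1 N.1 le_rfl hV).symm).hom a)
  have h2 : ∏ i, (pr.appLE N.1 V.1 le_rfl).hom (τ i) ∈
      (∏ i, twistDiv (w2Frob p k) L.str L.div i).ideal V := by
    refine prod_mem_ideal_prod _ _ _ _ fun i _ => ?_
    rw [ideal_comap pr (L.div i) N V le_rfl]
    exact Ideal.mem_map_of_mem _ (hτ i ▸ Ideal.mem_span_singleton_self _)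
  have h3 : ((∏ i, L.div i) ^ p).ideal N = Ideal.span {(∏ i, τ i) ^ p} := by
    rw [← Ideal.span_singleton_pow, ← ideal_prod_eq_span _ _ N τ fun i _ => hτ i]
    rfl
  rw [← Ideal.mem_span_singleton, ← h3, ← Φ.compatible, ideal_comap Φ.hom _ V N hV,
    Finset.prod_congr rfl fun i _ => h1 (τ i), ← map_prod]
  exact Ideal.mem_map_of_mem _ h2

/-- The divided Frobenius on the stalks of the algebra of forms. -/
def stalkDivFrob (y : X) : StalkForms f y →+* StalkForms f y :=
  letI := stalkAlgebra f y
  (Φ.isFrobLift_stalk y).divFrob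

/-- Every point has étale coordinates in which the divided Frobenius is `dt / t ↦ dt / t + dw` for
the equations of the divisor and `dt ↦ t ^ (p - 1) dt + dw` for the other coordinates. -/
theorem exists_isFrobChart (hD : IsSNC f D) (x : X) :
    ∃ (W : X.affineOpens) (_ : x ∈ W.1) (n : ℕ) (t w : Fin n → Γ(X, W.1)) (s : Set ι)
      (e : s ↪ Fin n), IsFrobChart f D p Φ.stalkDivFrob W t w e := by
  classical
  obtain ⟨W₀, hxW₀, n, t₀, s, e, h1, h2, h3⟩ := hD x
  obtain ⟨N, hxN, -, hNW⟩ := exists_affine_preimage_le (L := L) (N := ⊤) hxW₀ trivial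
  let W : X.affineOpens := ⟨L.incl ⁻¹ᵁ N.1, N.2.preimage L.incl⟩
  have H : IsLogCoord f D W (fun j => res hNW (t₀ j)) e :=
    IsLogCoord.restrict (W' := W) hNW ⟨h1, h2, h3⟩
  let t : Fin n → Γ(X, W.1) := fun j => res hNW (t₀ j)
  change IsLogCoord f D W t e at H
  let H' := Φ.isFrobLift_sections N
  have hflat := (RingHom.Etale.iff_flat_and_formallyUnramified.mp H.etale).1
  -- The local equations of all components; those that do not meet `W` have the equation `1`.
  let a : ι → Γ(X, W.1) := fun i => if h : i ∈ s then t (e ⟨i, h⟩) else 1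
  have ha : ∀ i, (D i).ideal W = Ideal.span {a i} := by
    intro i
    by_cases h : i ∈ s
    · simpa only [a, dif_pos h] using H.ideal_eq ⟨i, h⟩
    · simpa only [a, dif_neg h, Ideal.span_singleton_one] using H.ideal_eq_top i h
  have hτ : ∀ i, ∃ τ, (L.incl.app N.1).hom τ = a i ∧ (L.div i).ideal N = Ideal.span {τ} := by
    intro i
    refine H'.exists_span_eq ?_ fun y => L.exists_sub_mem_ideal i N
    rw [← ha, ← L.map_ideal_div i N W rfl]
    rw [Scheme.Hom.appLE_eq_app]
  choose τ hτa hτI using hτ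
  have hw : ∀ i, ∃ w, Φ.sectionMap N.1 (τ i) = τ i ^ p * (1 + p * w) := by
    refine H'.exists_eq_pow_mul τ (fun i b hb => ?_) (fun i j b hij hb => ?_)
      (Φ.prod_sectionMap_dvd N τ hτI)
    · rw [hτa] at hb
      by_cases h : i ∈ s
      · simp only [a, dif_pos h] at hb
        exact coord_regular _ t hflat _ hb
      · simpa only [a, dif_neg h, one_mul] using hb
    · rw [hτa] at hb ⊢
      by_cases h : i ∈ s
      · rw [hτa] at hb
        by_cases h' : j ∈ s
        · simp only [a, dif_pos h, dif_pos h'] at hb ⊢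
          refine coord_regular_mod _ t hflat (fun h'' => hij ?_) p hb
          exact congrArg Subtype.val (e.injective h'')
        · simpa only [a, dif_neg h', one_pow, one_mul] using hb
      · simp only [a, dif_neg h, one_pow, isUnit_one, IsUnit.dvd]
  have hall : ∀ j, ∃ w : Γ(L.space, N.1),
      (j ∈ Set.range e → ∃ σ, (L.incl.app N.1).hom σ = t j ∧
        Φ.sectionMap N.1 σ = σ ^ p * (1 + p * w)) ∧
      (j ∉ Set.range e → ∃ σ, (L.incl.app N.1).hom σ = t j ∧
        Φ.sectionMap N.1 σ = σ ^ p + p * w) := by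
    intro j
    by_cases hj : j ∈ Set.range e
    · obtain ⟨i, rfl⟩ := hj
      obtain ⟨w, hw⟩ := hw i.1
      refine ⟨w, fun _ => ⟨τ i.1, ?_, hw⟩, fun h => absurd ⟨i, rfl⟩ h⟩
      rw [hτa]
      simp only [a, dif_pos i.2]
    · obtain ⟨σ, hσ⟩ := H'.surjective (t j)
      obtain ⟨w, hw⟩ := H'.exists_delta σ
      exact ⟨w, fun h => absurd h hj, fun _ => ⟨σ, hσ, hw⟩⟩
  choose w hw1 hw2 using hall
  refine ⟨W, hxN, n, t, fun j => (L.incl.app N.1).hom (w j), s, e, ⟨H, ?_, ?_⟩⟩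
  · intro y hy j hj
    obtain ⟨σ, hσ, hσ'⟩ := hw1 j hj
    let := stalkAlgebra f y.1
    have h4 := Φ.stalkEndo_germAt ⟨L.incl y.1, y.2⟩ σ
    rw [hσ', map_mul, map_pow, map_add, map_one, map_mul, map_natCast] at h4
    have h5 := (stalkMap_germAt (L := L) y.1 y.2 σ).trans (congrArg _ hσ)
    have h6 := stalkMap_germAt (L := L) y.1 y.2 (w j)
    have h7 := (Φ.isFrobLift_stalk y.1).divFrob_dlog (k := k) h4
      (by rw [h5]; exact H.isUnit y hy hj)
    rw [h5, h6] at h7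
    exact h7
  · intro y hy j hj
    obtain ⟨σ, hσ, hσ'⟩ := hw2 j hj
    let := stalkAlgebra f y.1
    have h4 := Φ.stalkEndo_germAt ⟨L.incl y.1, y.2⟩ σ
    rw [hσ', map_add, map_pow, map_mul, map_natCast] at h4
    have h5 := (stalkMap_germAt (L := L) y.1 y.2 σ).trans (congrArg _ hσ)
    have h6 := stalkMap_germAt (L := L) y.1 y.2 (w j)
    have h7 := (Φ.isFrobLift_stalk y.1).divFrob_dOne_eq (k := k) h4
    rw [h5, h6] at h7
    exact h7

end FrobeniusLifting

end

/-! ### Transport of forms and the Frobenius twist -/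

section germs

theorem germAt_appLE_congr {X Y : Scheme.{u}} {g g' : Y ⟶ X} (h : g = g') {V : X.Opens}
    {W W' : Y.Opens} (hW : W ≤ g ⁻¹ᵁ V) (hW' : W' ≤ g' ⁻¹ᵁ V) (y : Y) (hy : y ∈ W)
    (hy' : y ∈ W') (a : Γ(X, V)) :
    germAt (⟨y, hy⟩ : W) ((g.appLE V W hW).hom a) =
      germAt (⟨y, hy'⟩ : W') ((g'.appLE V W' hW').hom a) := by
  subst h
  rw [germAt_appLE, germAt_appLE]

theorem stalkMap_id_apply {X : Scheme.{u}} (x : X) (a : X.presheaf.stalk x) :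
    ((𝟙 X : X ⟶ X).stalkMap x).hom a = a := by
  obtain ⟨V, hV, a, rfl⟩ := TopCat.Presheaf.exists_germ_eq X.presheaf a
  exact Scheme.Hom.germ_stalkMap_apply (𝟙 X) V x hV a

variable {R : Type u} [CommRing R] {X Y : Scheme.{u}} {f : X ⟶ Spec (CommRingCat.of R)}
  {ι : Type*} {D : ι → X.IdealSheafData}

/-- A ring homomorphism on the stalk of the algebra of forms is determined by the images of
functions and of exact one-forms. -/
theorem stalkForms_ringHom_ext {x : X} {E : Type*} [Ring E] {g g' : StalkForms f x →+* E}
    (h : ∀ a, g (algebraMap (X.presheaf.stalk x) _ a) = g' (algebraMap _ _ a))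
    (h' : ∀ a, g (stalkD f x a) = g' (stalkD f x a)) : g = g' :=
  @forms_ringHom_ext R (X.presheaf.stalk x) _ _ (stalkAlgebra f x) E _ g g' h h'

theorem stalkPullback_id {b : R →+* R} (h : 𝟙 X ≫ f = f ≫ Spec.map (CommRingCat.ofHom b)) (x : X)
    (ω : StalkForms f x) : stalkPullback h x ω = ω := by
  have h1 : (stalkPullback h x : StalkForms f x →+* StalkForms f x) = RingHom.id _ := by
    refine stalkForms_ringHom_ext (fun a => ?_) fun a => ?_
    · exact (stalkPullback_algebraMap h x a).trans (congrArg _ (stalkMap_id_apply x a))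
    · exact (stalkPullback_stalkD h x a).trans (congrArg _ (stalkMap_id_apply x a))
  exact congr($h1 ω)

theorem stalkPullback_eq_self {b : R →+* R} {g : X ⟶ X}
    (h : g ≫ f = f ≫ Spec.map (CommRingCat.ofHom b)) (hg : g = 𝟙 X) {V : X.Opens}
    (s : PreSection f D V) (x : X) (hx : x ∈ V) (hgx : g x ∈ V) (hoff : OffDivisor D x)
    (hgoff : OffDivisor D (g x)) :
    stalkPullback h x (s ⟨g x, hgx⟩ ⟨hgoff⟩) = s ⟨x, hx⟩ ⟨hoff⟩ := by
  subst hg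
  exact stalkPullback_id h x _

theorem stalkPullback_stalkPullback {S T : Type u} [CommRing S] [CommRing T] {Z : Scheme.{u}}
    {f' : Y ⟶ Spec (CommRingCat.of S)} {f'' : Z ⟶ Spec (CommRingCat.of T)} {b : R →+* S}
    {c : S →+* T} {d : R →+* T} {g : Y ⟶ X} {g' : Z ⟶ Y}
    (h : g ≫ f = f' ≫ Spec.map (CommRingCat.ofHom b))
    (h' : g' ≫ f' = f'' ≫ Spec.map (CommRingCat.ofHom c))
    (h'' : (g' ≫ g) ≫ f = f'' ≫ Spec.map (CommRingCat.ofHom d)) (z : Z)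
    (ω : StalkForms f (g (g' z))) :
    stalkPullback h' z (stalkPullback h (g' z) ω) = stalkPullback h'' z ω := by
  have hst : ∀ a : X.presheaf.stalk (g (g' z)), ((g' ≫ g).stalkMap z).hom a =
      (g'.stalkMap z).hom ((g.stalkMap (g' z)).hom a) := fun a =>
    congr($(Scheme.Hom.stalkMap_comp g' g z).hom a)
  have h1 : ((stalkPullback h' z).comp (stalkPullback h (g' z)) :
      StalkForms f (g (g' z)) →+* StalkForms f'' z) = stalkPullback h'' z := by
    refine stalkForms_ringHom_ext (fun a => ?_) fun a => ?_
    · refine Eq.trans (congrArg (stalkPullback h' z) (stalkPullback_algebraMap h (g' z) a)) ?_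
      refine Eq.trans (stalkPullback_algebraMap h' z _) ?_
      rw [← hst]
      exact (stalkPullback_algebraMap h'' z a).symm
    · refine Eq.trans (congrArg (stalkPullback h' z) (stalkPullback_stalkD h (g' z) a)) ?_
      refine Eq.trans (stalkPullback_stalkD h' z _) ?_
      rw [← hst]
      exact (stalkPullback_stalkD h'' z a).symm
  exact congr($h1 ω)

/-- Pulling back forms along a section of `g` undoes the pullback along `g`. -/
theorem prePullback_prePullback_of_comp_eq_id {S : Type u} [CommRing S]
    {f' : Y ⟶ Spec (CommRingCat.of S)} {b : R →+* S} {c : S →+* R} {g : Y ⟶ X} {g' : X ⟶ Y}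
    {E : ι → Y.IdealSheafData} (hg : g' ≫ g = 𝟙 X)
    (h : g ≫ f = f' ≫ Spec.map (CommRingCat.ofHom b))
    (h' : g' ≫ f' = f ≫ Spec.map (CommRingCat.ofHom c))
    (hoff : ∀ y, OffDivisor E y → OffDivisor D (g y))
    (hoff' : ∀ x, OffDivisor D x → OffDivisor E (g' x)) {V V' : X.Opens} {W : Y.Opens}
    (hW : W ≤ g ⁻¹ᵁ V) (hV' : V' ≤ g' ⁻¹ᵁ W) (hV : V' ≤ V) (s : PreSection f D V) :
    prePullback h' hoff' hV' (prePullback h hoff hW s) = preRestrict f D hV s := by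
  ext x hx
  have h'' : (g' ≫ g) ≫ f = f ≫ Spec.map (CommRingCat.ofHom (c.comp b)) := by
    rw [Category.assoc, h, ← Category.assoc, h', Category.assoc, ← Spec.map_comp,
      ← CommRingCat.ofHom_comp]
  refine (stalkPullback_stalkPullback h h' h'' x.1 _).trans ?_
  exact stalkPullback_eq_self h'' hg s x.1 (hV x.2) (hW (hV' x.2)) hx.down
    (hoff _ (hoff' _ hx.down))

theorem exists_eq_ι_of_isLogForm_one {V : X.Opens} {s : PreSection f D V}
    (hs : IsLogForm f D 1 s) (x : V) (hx : PLift (OffDivisor D x.1)) :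
    letI := stalkAlgebra f x.1
    ∃ v, s x hx = ExteriorAlgebra.ι (X.presheaf.stalk x.1) v := by
  let := stalkAlgebra f x.1
  obtain ⟨W, hxW, hW, hm⟩ := hs x.1 x.2
  have key : ∀ γ ∈ AddSubgroup.closure (logMonomials f D 1 W),
      ∃ v, γ ⟨x.1, hxW⟩ hx = ExteriorAlgebra.ι (X.presheaf.stalk x.1) v := by
    intro γ hγ
    induction hγ using AddSubgroup.closure_induction with
    | zero => exact ⟨0, (map_zero _).symm⟩
    | add γ γ' _ _ h h' =>
      obtain ⟨v, hv⟩ := h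
      obtain ⟨v', hv'⟩ := h'
      exact ⟨v + v', by rw [map_add, ← hv, ← hv']; rfl⟩
    | neg γ _ h =>
      obtain ⟨v, hv⟩ := h
      exact ⟨-v, by rw [map_neg, ← hv]; rfl⟩
    | mem γ hγ =>
      obtain ⟨a, γ, hγ, rfl⟩ := hγ
      have h1 : ∃ v, γ 0 ⟨x.1, hxW⟩ hx = ExteriorAlgebra.ι (X.presheaf.stalk x.1) v := by
        rcases (hγ 0).cases ⟨x.1, hxW⟩ hx with ⟨c, hc⟩ | ⟨c, hc⟩
        · exact ⟨_, hc⟩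
        · exact ⟨_, hc.trans (dlog_eq_ι (A := X.presheaf.stalk x.1) R c)⟩
      obtain ⟨v, hv⟩ := h1
      refine ⟨germAt ⟨x.1, hxW⟩ a • v, ?_⟩
      have h2 : (List.ofFn fun j => γ j ⟨x.1, hxW⟩ hx).prod = γ 0 ⟨x.1, hxW⟩ hx := by
        rw [List.ofFn_succ, List.ofFn_zero, List.prod_cons, List.prod_nil, mul_one]
      rw [map_smul, ← hv]
      exact congrArg (germAt (⟨x.1, hxW⟩ : W.1) a • ·) h2
  exact key _ hm

/-- Transport of forms along an equality of points. -/
theorem exists_transport {V : X.Opens} (s : PreSection f D V) (x y : V) (h : x.1 = y.1)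
    (hx : OffDivisor D x.1) (hy : OffDivisor D y.1) :
    ∃ ρ : StalkForms f x.1 →+* StalkForms f y.1,
      (∀ (U : X.Opens) (hxU : x.1 ∈ U) (hyU : y.1 ∈ U) (a : Γ(X, U)),
        ρ (algebraMap _ _ (germAt (⟨x.1, hxU⟩ : U) a)) =
          algebraMap _ _ (germAt (⟨y.1, hyU⟩ : U) a) ∧
        ρ (stalkD f x.1 (germAt (⟨x.1, hxU⟩ : U) a)) = stalkD f y.1 (germAt (⟨y.1, hyU⟩ : U) a)) ∧
      ρ (s x ⟨hx⟩) = s y ⟨hy⟩ := by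
  obtain ⟨x, hxV⟩ := x
  obtain ⟨y, hyV⟩ := y
  obtain rfl : x = y := h
  exact ⟨RingHom.id _, fun _ _ _ _ => ⟨rfl, rfl⟩, rfl⟩

end germs

section twist

variable (p : ℕ) [Fact p.Prime] {k : Type u} [Field k] [CharP k p] [PerfectRing k p]
  {X : Scheme.{u}} (f : X ⟶ Spec (CommRingCat.of k)) {ι : Type*} (D : ι → X.IdealSheafData)

instance isIso_frobTwist_fst :
    IsIso (pullback.fst f (Spec.map (CommRingCat.ofHom (frobenius k p)))) := inferInstance

/-- The isomorphism of schemes `X ⟶ X'`, inverse to the projection `X' ⟶ X`; it is not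
`k`-linear. -/
def toTwist : X ⟶ twist (frobenius k p) f :=
  inv (pullback.fst f (Spec.map (CommRingCat.ofHom (frobenius k p))))

theorem toTwist_fst : toTwist p f ≫ pullback.fst _ _ = 𝟙 X := IsIso.inv_hom_id _

theorem fst_toTwist :
    pullback.fst f (Spec.map (CommRingCat.ofHom (frobenius k p))) ≫ toTwist p f = 𝟙 _ :=
  IsIso.hom_inv_id _

theorem relFrobenius_eq :
    relFrobenius p f = absFrobenius p X (natCast_eq_zero_of_over p f) ≫ toTwist p f := by
  rw [toTwist, IsIso.eq_comp_inv, relFrobenius, pullback.lift_fst]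

theorem relFrobenius_apply (x : X) : relFrobenius p f x = toTwist p f x := by
  rw [relFrobenius_eq]
  rfl

theorem relFrobenius_preimage_le (V : (twist (frobenius k p) f).Opens) :
    relFrobenius p f ⁻¹ᵁ V ≤ toTwist p f ⁻¹ᵁ V := by
  intro x hx
  change toTwist p f x ∈ V
  rw [← relFrobenius_apply]
  exact hx

/-- The inverse of the Frobenius endomorphism of `k`. -/
def frobInv : k →+* k := (frobeniusEquiv k p).symm

theorem toTwist_comp : toTwist p f ≫ twistStr (frobenius k p) f =
    f ≫ Spec.map (CommRingCat.ofHom (frobInv p)) := by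
  have h : (frobInv p : k →+* k).comp (frobenius k p) = RingHom.id k := by
    ext x
    exact (frobeniusEquiv k p).symm_apply_apply x
  have h1 : (toTwist p f ≫ pullback.fst _ _) ≫ f = (toTwist p f ≫ twistStr (frobenius k p) f) ≫
      Spec.map (CommRingCat.ofHom (frobenius k p)) := by
    rw [Category.assoc, Category.assoc, pullback.condition]
  rw [toTwist_fst, Category.id_comp] at h1
  have h2 : (frobenius k p).comp (frobInv p : k →+* k) = RingHom.id k := by
    ext x
    exact (frobeniusEquiv k p).apply_symm_apply x
  have h3 : Spec.map (CommRingCat.ofHom (frobenius k p)) ≫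
      Spec.map (CommRingCat.ofHom (frobInv p)) = 𝟙 (Spec (CommRingCat.of k)) := by
    rw [← Spec.map_comp, ← CommRingCat.ofHom_comp, h2, CommRingCat.ofHom_id, Spec.map_id]
  conv_rhs => rw [h1]
  rw [Category.assoc _ _ (Spec.map (CommRingCat.ofHom (frobInv p))), h3, Category.comp_id]

theorem twistDiv_comap_toTwist (i : ι) :
    D i = (twistDiv (frobenius k p) f D i).comap (toTwist p f) := by
  rw [← Scheme.IdealSheafData.comap_comp, toTwist_fst, Scheme.IdealSheafData.comap_id]

theorem offDivisor_toTwist (x : X) (hx : OffDivisor D x) :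
    OffDivisor (twistDiv (frobenius k p) f D) (toTwist p f x) := by
  rw [← offDivisor_comap, ← funext (twistDiv_comap_toTwist p f D)]
  exact hx

omit [PerfectRing k p] in
theorem offDivisor_twist_fst (x : twist (frobenius k p) f)
    (hx : OffDivisor (twistDiv (frobenius k p) f D) x) :
    OffDivisor D (pullback.fst f (Spec.map (CommRingCat.ofHom (frobenius k p))) x) :=
  (offDivisor_comap x).mp hx

theorem germAt_relFrobenius_app (V : (twist (frobenius k p) f).Opens)
    (c : Γ(twist (frobenius k p) f, V)) (x : ↥(relFrobenius p f ⁻¹ᵁ V)) :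
    germAt x (((relFrobenius p f).app V).hom c) =
      ((toTwist p f).stalkMap x.1).hom
        (germAt (⟨toTwist p f x.1, relFrobenius_preimage_le p f V x.2⟩ : V) c) ^ p := by
  have key : ∀ (F : X ⟶ twist (frobenius k p) f)
      (_ : F = absFrobenius p X (natCast_eq_zero_of_over p f) ≫ toTwist p f)
      (x : X) (hx : x ∈ F ⁻¹ᵁ V) (hx' : toTwist p f x ∈ V),
      germAt (⟨x, hx⟩ : (F ⁻¹ᵁ V : X.Opens)) ((F.app V).hom c) =
        ((toTwist p f).stalkMap x).hom (germAt (⟨toTwist p f x, hx'⟩ : V) c) ^ p := by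
    rintro _ rfl x hx hx'
    have h1 := Scheme.Hom.germ_stalkMap_apply (toTwist p f) V x hx' c
    refine Eq.trans ?_ (congrArg (· ^ p) h1.symm)
    exact map_pow (X.presheaf.germ (toTwist p f ⁻¹ᵁ V) x hx').hom (((toTwist p f).app V).hom c) p
  exact key _ (relFrobenius_eq p f) x.1 x.2 _

end twist

/-! ### The divided Frobenius on logarithmic forms -/

namespace FrobeniusLifting

variable {p : ℕ} [Fact p.Prime] {k : Type u} [Field k] [CharP k p] [PerfectRing k p]
  {X : Scheme.{u}} {f : X ⟶ Spec (CommRingCat.of k)} {ι : Type*} [Fintype ι]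
  {D : ι → X.IdealSheafData} {L : LogLifting p f D} (Φ : FrobeniusLifting L)

theorem stalkDivFrob_smul (x : X) (c : X.presheaf.stalk x) (ω : StalkForms f x) :
    Φ.stalkDivFrob x (c • ω) = c ^ p • Φ.stalkDivFrob x ω := by
  let := stalkAlgebra f x
  exact (Φ.isFrobLift_stalk x).divFrob_smul c ω

theorem stalkDivFrob_algebraMap (x : X) (c : X.presheaf.stalk x) :
    Φ.stalkDivFrob x (algebraMap _ _ c) = algebraMap _ _ (c ^ p) := by
  let := stalkAlgebra f x
  exact (Φ.isFrobLift_stalk x).divFrob_algebraMap c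

theorem stalkExtD_stalkDivFrob (x : X) (ω : StalkForms f x) :
    stalkExtD f x (Φ.stalkDivFrob x ω) = 0 := by
  let := stalkAlgebra f x
  exact (Φ.isFrobLift_stalk x).divFrob_closed ω

/-- The divided Frobenius, from families of germs of forms on `X'` to those on `X`. -/
def preDivFrob (V : (twist (frobenius k p) f).Opens) :
    PreSection (twistStr (frobenius k p) f) (twistDiv (frobenius k p) f D) V →+
      PreSection f D (relFrobenius p f ⁻¹ᵁ V) :=
  (preMap f D Φ.stalkDivFrob).comp
    (prePullback (toTwist_comp p f) (offDivisor_toTwist p f D) (relFrobenius_preimage_le p f V))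

theorem preDivFrob_apply (V : (twist (frobenius k p) f).Opens)
    (s : PreSection (twistStr (frobenius k p) f) (twistDiv (frobenius k p) f D) V)
    (x : ↥(relFrobenius p f ⁻¹ᵁ V)) (hx : PLift (OffDivisor D x.1)) :
    Φ.preDivFrob V s x hx = Φ.stalkDivFrob x.1 (stalkPullback (toTwist_comp p f) x.1
      (s ⟨toTwist p f x.1, relFrobenius_preimage_le p f V x.2⟩
        ⟨offDivisor_toTwist p f D x.1 hx.down⟩)) := rfl

omit [Fintype ι] in
theorem isLogForm_toTwist {n : ℕ} {V : (twist (frobenius k p) f).Opens}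
    {s : PreSection (twistStr (frobenius k p) f) (twistDiv (frobenius k p) f D) V}
    (hs : IsLogForm _ _ n s) :
    IsLogForm f D n (prePullback (toTwist_comp p f) (offDivisor_toTwist p f D)
      (relFrobenius_preimage_le p f V) s) :=
  hs.pullback (toTwist_comp p f) (offDivisor_toTwist p f D) (twistDiv_comap_toTwist p f D)
    (relFrobenius_preimage_le p f V)

/-- The divided Frobenius `Γ(V, Ωⁿ_{X'}(log D')) → Γ(F⁻¹ V, Ωⁿ_X(log D))`. -/
def divFrob (hD : IsSNC f D) (n : ℕ) (V : (twist (frobenius k p) f).Opens) :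
    LogForms (twistStr (frobenius k p) f) (twistDiv (frobenius k p) f D) n V →+
      LogForms f D n (relFrobenius p f ⁻¹ᵁ V) :=
  ((Φ.preDivFrob V).comp (AddSubgroup.subtype _)).codRestrict _ fun s =>
    (isLogForm_toTwist s.2).preMap Φ.stalkDivFrob_smul (Φ.exists_isFrobChart hD)

variable (hD : IsSNC f D)

theorem divFrob_val (n : ℕ) (V : (twist (frobenius k p) f).Opens)
    (s : LogForms (twistStr (frobenius k p) f) (twistDiv (frobenius k p) f D) n V) :
    (Φ.divFrob hD n V s).1 = Φ.preDivFrob V s.1 := rfl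

theorem divFrob_smul (n : ℕ) (V : (twist (frobenius k p) f).Opens)
    (c : Γ(twist (frobenius k p) f, V))
    (s : LogForms (twistStr (frobenius k p) f) (twistDiv (frobenius k p) f D) n V) :
    Φ.divFrob hD n V (c • s) = ((relFrobenius p f).app V).hom c • Φ.divFrob hD n V s := by
  apply Subtype.ext
  ext x hx
  rw [LogForms.smul_val, preSmul_apply, divFrob_val, divFrob_val, preDivFrob_apply,
    preDivFrob_apply, LogForms.smul_val, preSmul_apply, germAt_relFrobenius_app]
  refine Eq.trans (congrArg _ (stalkPullback_smul (toTwist_comp p f) x.1 _ _)) ?_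
  exact Φ.stalkDivFrob_smul x.1 _ _

theorem logD_divFrob (n : ℕ) (V : (twist (frobenius k p) f).Opens)
    (s : LogForms (twistStr (frobenius k p) f) (twistDiv (frobenius k p) f D) n V) :
    logD f D n _ (Φ.divFrob hD n V s) = 0 := by
  apply Subtype.ext
  ext x hx
  exact Φ.stalkExtD_stalkDivFrob x.1 _

theorem divFrob_functionForm (V : (twist (frobenius k p) f).Opens)
    (c : Γ(twist (frobenius k p) f, V)) :
    Φ.divFrob hD 0 V (functionForm _ _ c) =
      functionForm f D (((relFrobenius p f).app V).hom c) := by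
  apply Subtype.ext
  ext x hx
  refine (congrArg _ (stalkPullback_algebraMap (toTwist_comp p f) x.1 _)).trans ?_
  refine (Φ.stalkDivFrob_algebraMap x.1 _).trans ?_
  exact congrArg (algebraMap _ _) (germAt_relFrobenius_app p f V c x).symm

theorem divFrob_wedge (V : (twist (frobenius k p) f).Opens) (m n : ℕ)
    (α : LogForms (twistStr (frobenius k p) f) (twistDiv (frobenius k p) f D) m V)
    (β : LogForms (twistStr (frobenius k p) f) (twistDiv (frobenius k p) f D) n V) :
    Φ.divFrob hD (m + n) V (LogForms.wedge α β) =
      LogForms.wedge (Φ.divFrob hD m V α) (Φ.divFrob hD n V β) := by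
  apply Subtype.ext
  ext x hx
  refine (congrArg _ (map_mul (stalkPullback (toTwist_comp p f) x.1) _ _)).trans ?_
  exact map_mul (Φ.stalkDivFrob x.1) _ _

/-- A germ `a` on the twist of the lifting comes from a germ `z` on the lifting, under the
projection of the twist: the lifted relative Frobenius takes `a` to the image of `z` under the
lifted absolute Frobenius, and `z` reduces to the reduction of `a`. -/
theorem exists_stalkMap_hom_eq (x : X) (V : (twist (w2Frob p k) L.str).Opens)
    (hV : Φ.hom (L.incl x) ∈ V) (hV' : L.inclTwist (toTwist p f x) ∈ V)
    (a : Γ(twist (w2Frob p k) L.str, V)) :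
    ∃ z, (Φ.hom.stalkMap (L.incl x)).hom (germAt (⟨Φ.hom (L.incl x), hV⟩ : V) a) =
        Φ.stalkEndo (L.incl x) z ∧
      (L.incl.stalkMap x).hom z = ((toTwist p f).stalkMap x).hom
        ((L.inclTwist.stalkMap (toTwist p f x)).hom
          (germAt (⟨L.inclTwist (toTwist p f x), hV'⟩ : V) a)) := by
  let pr := pullback.fst L.str (Spec.map (CommRingCat.ofHom (w2Frob p k)))
  let j := inv pr
  have h1 : Φ.absLift ≫ j = Φ.hom := by
    rw [absLift, Category.assoc]
    exact (congrArg (Φ.hom ≫ ·) (IsIso.hom_inv_id pr)).trans (Category.comp_id _)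
  have h2 : toTwist p f ≫ L.inclTwist = L.incl ≫ j := by
    rw [IsIso.eq_comp_inv, Category.assoc, L.inclTwist_fst, ← Category.assoc, toTwist_fst,
      Category.id_comp]
  have hj : j (L.incl x) ∈ V := by
    have := congr($h2 x)
    rw [Scheme.Hom.comp_apply, Scheme.Hom.comp_apply] at this
    rwa [← this]
  let N : L.space.Opens := j ⁻¹ᵁ V
  let b : Γ(L.space, N) := (j.appLE V N le_rfl).hom a
  refine ⟨germAt (⟨L.incl x, hj⟩ : N) b, ?_, ?_⟩
  · have h3 := Φ.stalkEndo_germAt (N := N) ⟨L.incl x, hj⟩ b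
    dsimp only at h3
    rw [h3]
    have h4 : Φ.sectionMap N b = ((Φ.absLift ≫ j).appLE V N (Φ.le_absLift_preimage N)).hom a :=
      congr($(Scheme.Hom.appLE_comp_appLE Φ.absLift j V N N le_rfl (Φ.le_absLift_preimage N)).hom a)
    rw [h4]
    refine (germAt_appLE (g := Φ.hom) (W := Φ.hom ⁻¹ᵁ V) le_rfl ⟨L.incl x, hV⟩ a).symm.trans ?_
    exact germAt_appLE_congr h1.symm _ _ _ _ _ a
  · refine (germAt_appLE (g := L.incl) (W := L.incl ⁻¹ᵁ N) le_rfl ⟨x, hj⟩ b).symm.trans ?_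
    have h5 : (L.incl.appLE N (L.incl ⁻¹ᵁ N) le_rfl).hom b =
        ((L.incl ≫ j).appLE V (L.incl ⁻¹ᵁ N) le_rfl).hom a :=
      congr($(Scheme.Hom.appLE_comp_appLE L.incl j V N (L.incl ⁻¹ᵁ N) le_rfl le_rfl).hom a)
    refine (congrArg _ h5).trans ?_
    refine (germAt_appLE_congr h2.symm le_rfl (W' := (toTwist p f ≫ L.inclTwist) ⁻¹ᵁ V) le_rfl x hj
      hV' a).trans ?_
    refine (germAt_appLE (g := toTwist p f ≫ L.inclTwist)
      (W := (toTwist p f ≫ L.inclTwist) ⁻¹ᵁ V) le_rfl ⟨x, hV'⟩ a).trans ?_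
    exact congr($(Scheme.Hom.stalkMap_comp (toTwist p f) L.inclTwist x).hom _)

/-- In degree one, the divided Frobenius is `p⁻¹` times the pullback of a lifting. Two one-forms on
the lifting with the same reduction agree after multiplication by `p`, so the choice of the lifting
of the image does not matter. -/
theorem isPullbackForm_divFrob (V : (twist (w2Frob p k) L.str).Opens)
    (ω' : LogForms (twistStr (w2Frob p k) L.str) (twistDiv (w2Frob p k) L.str L.div) 1 V)
    (ω : LogForms (twistStr (frobenius k p) f) (twistDiv (frobenius k p) f D) 1
      (L.inclTwist ⁻¹ᵁ V))
    (hω : IsPullbackForm L.inclTwist_comp L.offDivisor_inclTwist le_rfl ω' ω)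
    (W : L.space.Opens) (hW : W ≤ Φ.hom ⁻¹ᵁ V) (η' : LogForms L.str L.div 1 W)
    (hη : IsPullbackForm L.isPullback.w L.offDivisor_incl le_rfl η'
      (logRes f D 1 (Φ.preimage_le hW) (Φ.divFrob hD 1 _ ω))) :
    IsPullbackForm Φ.hom_over Φ.offDivisor hW ω' ((p : ℤ) • η') := by
  rintro ⟨y, hyW⟩ hy
  obtain ⟨x, rfl⟩ := L.incl_surjective y
  have hx : OffDivisor D x := by
    rw [← funext L.comap_div]
    exact (offDivisor_comap x).mpr hy
  have hx' := offDivisor_toTwist p f D x hx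
  have hxF : relFrobenius p f x ∈ L.inclTwist ⁻¹ᵁ V := Φ.preimage_le hW hyW
  have hxV : L.inclTwist (toTwist p f x) ∈ V := by
    rw [relFrobenius_apply] at hxF
    exact hxF
  have hpt : Φ.hom (L.incl x) = L.inclTwist (toTwist p f x) := by
    have := congr($(Φ.incl_hom) x)
    rw [Scheme.Hom.comp_apply, Scheme.Hom.comp_apply, relFrobenius_apply] at this
    exact this
  have h1 := hω ⟨toTwist p f x, hxV⟩ hx'
  have h2 := hη ⟨x, hyW⟩ hx
  obtain ⟨ρ, hρ, hρω⟩ := exists_transport ω'.1 ⟨Φ.hom (L.incl x), hW hyW⟩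
    ⟨L.inclTwist (toTwist p f x), hxV⟩ hpt (Φ.offDivisor _ hy)
    (L.offDivisor_inclTwist _ hx')
  let := stalkAlgebra L.str (L.incl x)
  let := stalkAlgebra f x
  let := stalkAlgebra (twistStr (w2Frob p k) L.str) (Φ.hom (L.incl x))
  obtain ⟨w, hw⟩ := exists_eq_ι_of_isLogForm_one ω'.2 ⟨Φ.hom (L.incl x), hW hyW⟩
    ⟨Φ.offDivisor _ hy⟩
  obtain ⟨v', hv'⟩ := exists_eq_ι_of_isLogForm_one η'.2 ⟨L.incl x, hyW⟩ ⟨hy⟩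
  let sp := (twist (w2Frob p k) L.str).presheaf.stalkSpecializes (specializes_of_eq hpt.symm)
  have hsp : ∀ (U : (twist (w2Frob p k) L.str).Opens) (hU : Φ.hom (L.incl x) ∈ U)
      (hU' : L.inclTwist (toTwist p f x) ∈ U) (a : Γ(twist (w2Frob p k) L.str, U)),
      sp.hom (germAt (⟨Φ.hom (L.incl x), hU⟩ : U) a) =
        germAt (⟨L.inclTwist (toTwist p f x), hU'⟩ : U) a := fun U hU hU' a =>
    (twist (w2Frob p k) L.str).presheaf.germ_stalkSpecializes_apply _ _ a
  have hmap := fun U hU hU' a => congrArg ((toTwist p f).stalkMap x).hom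
    (congrArg (L.inclTwist.stalkMap (toTwist p f x)).hom (hsp U hU hU' a).symm)
  have hex : ∀ a : (twist (w2Frob p k) L.str).presheaf.stalk (Φ.hom (L.incl x)),
      ∃ (U : (twist (w2Frob p k) L.str).Opens) (hU : Φ.hom (L.incl x) ∈ U)
        (_ : L.inclTwist (toTwist p f x) ∈ U) (b : Γ(twist (w2Frob p k) L.str, U)),
        germAt (⟨Φ.hom (L.incl x), hU⟩ : U) b = a := by
    intro a
    obtain ⟨U, hU, b, hb⟩ := TopCat.Presheaf.exists_germ_eq _ a
    exact ⟨U, hU, by rw [← hpt]; exact hU, b, hb⟩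
  have key := (Φ.isFrobLift_stalk x).exists_divided (k := k)
    (R := W2 p k) (R' := W2 p k)
    (T' := (twist (w2Frob p k) L.str).presheaf.stalk (Φ.hom (L.incl x)))
    (w2Proj p k) (baseToStalk_comp L.isPullback.w x) (RingHom.id _)
    (Φ.hom.stalkMap (L.incl x)).hom (baseToStalk_comp Φ.hom_over (L.incl x))
    (((toTwist p f).stalkMap x).hom.comp
      ((L.inclTwist.stalkMap (toTwist p f x)).hom.comp sp.hom))
    ((stalkPullback (toTwist_comp p f) x).comp
      ((stalkPullback L.inclTwist_comp (toTwist p f x)).comp ρ))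
    (fun a => by
      obtain ⟨U, hU, hU', a, rfl⟩ := hex a
      refine (congrArg _ (congrArg _ (hρ U hU hU' a).1)).trans ?_
      refine (congrArg _ (stalkPullback_algebraMap L.inclTwist_comp (toTwist p f x) _)).trans ?_
      refine (stalkPullback_algebraMap (toTwist_comp p f) x _).trans ?_
      exact congrArg (algebraMap _ _) (hmap U hU hU' a))
    (fun a => by
      obtain ⟨U, hU, hU', a, rfl⟩ := hex a
      refine (congrArg _ (congrArg _ (hρ U hU hU' a).2)).trans ?_
      refine (congrArg _ (stalkPullback_stalkD L.inclTwist_comp (toTwist p f x) _)).trans ?_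
      refine (stalkPullback_stalkD (toTwist_comp p f) x _).trans ?_
      exact congrArg (stalkD f x) (hmap U hU hU' a))
    (fun a => by
      obtain ⟨U, hU, hU', a, rfl⟩ := hex a
      obtain ⟨z, hz, hz'⟩ := Φ.exists_stalkMap_hom_eq x U hU hU' a
      exact ⟨z, hz, hz'.trans (hmap U hU hU' a)⟩) w
  obtain ⟨v, hv1, hv2⟩ := key
  have h3 : formsMap (w2Proj p k) (L.incl.stalkMap x).hom (baseToStalk_comp L.isPullback.w x)
      (ExteriorAlgebra.ι _ v') = formsMap (w2Proj p k) (L.incl.stalkMap x).hom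
        (baseToStalk_comp L.isPullback.w x) (ExteriorAlgebra.ι _ v) := by
    rw [← hv2, ← hv', ← hw]
    refine Eq.trans h2.symm ?_
    refine congrArg (Φ.stalkDivFrob x) (congrArg (stalkPullback (toTwist_comp p f) x) ?_)
    exact h1.trans (congrArg _ hρω.symm)
  have h4 := (Φ.isFrobLift_stalk x).nsmul_ι_eq_of_map_eq (k := k) (R := W2 p k) (w2Proj p k)
    (baseToStalk_comp L.isPullback.w x) v' v h3
  refine Eq.trans ?_ ((congrArg (stalkPullback Φ.hom_over (L.incl x)) hw).trans hv1).symm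
  refine Eq.trans ?_ h4
  rw [← hv']
  exact natCast_zsmul (η'.1 ⟨L.incl x, hyW⟩ ⟨hy⟩) p

end FrobeniusLifting

/-! ### Cohomology sheaves and the quasi-isomorphism -/

section modules

variable {X : Scheme.{u}}

theorem Modules.app_injective {M N : X.Modules} (φ : M ⟶ N) [Mono φ] (V : X.Opens) :
    Function.Injective (φ.app V).hom := by
  have h1 : Mono ((Scheme.Modules.toPresheaf X).map φ) := inferInstance
  have h2 := (NatTrans.mono_iff_mono_app ((Scheme.Modules.toPresheaf X).map φ)).mp h1 (op V)
  exact (AddCommGrpCat.mono_iff_injective _).mp h2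

theorem Modules.app_naturality {M N : X.Modules} (φ : M ⟶ N) {V W : X.Opens} (i : W ⟶ V)
    (s : Γ(M, V)) :
    (φ.app W).hom ((M.presheaf.map i.op).hom s) = (N.presheaf.map i.op).hom ((φ.app V).hom s) :=
  congr($(φ.mapPresheaf.naturality i.op).hom s)

theorem Modules.eq_zero_of_locally {M : X.Modules} {V : X.Opens} (s : Γ(M, V))
    (h : ∀ x ∈ V, ∃ (W : X.Opens) (_ : x ∈ W) (i : W ⟶ V), (M.presheaf.map i.op).hom s = 0) :
    s = 0 := by
  refine TopCat.Presheaf.section_ext ⟨M.presheaf, M.isSheaf⟩ V s 0 fun x hx => ?_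
  obtain ⟨W, hxW, i, hi⟩ := h x hx
  have h1 := TopCat.Presheaf.germ_res_apply M.presheaf i x hxW s
  have h2 : (M.presheaf.map i.op) s = 0 := hi
  refine h1.symm.trans ?_
  rw [h2, map_zero]
  exact (map_zero (M.presheaf.germ V x hx).hom).symm

/-- A morphism of complexes of sheaves of modules, the source of which has zero differential, is
surjective on cohomology sheaves as soon as every closed section of the target is locally the sum
of a section from the source and of an exact section. -/
theorem epi_homologyMap_of_locally {K L : CochainComplex X.Modules ℕ} (φ : K ⟶ L) (i j k : ℕ)
    (hk : (ComplexShape.up ℕ).next j = k) (hK : K.d j k = 0)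
    (h : ∀ (V : X.Opens) (s : Γ(L.X j, V)), ((L.d j k).app V).hom s = 0 → ∀ x ∈ V,
      ∃ (W : X.Opens) (_ : x ∈ W) (a : W ⟶ V) (y : Γ(K.X j, W)) (z : Γ(L.X i, W)),
        ((L.X j).presheaf.map a.op).hom s = ((φ.f j).app W).hom y + ((L.d i j).app W).hom z) :
    Epi (HomologicalComplex.homologyMap φ j) := by
  refine Preadditive.epi_of_cancel_zero _ fun {C} g hg => ?_
  rw [← cancel_epi (L.homologyπ j), comp_zero]
  let G := L.homologyπ j ≫ g
  have h1 : L.toCycles i j ≫ G = 0 := by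
    rw [← Category.assoc, HomologicalComplex.toCycles_comp_homologyπ, zero_comp]
  let σ : K.X j ⟶ K.cycles j := K.liftCycles (𝟙 _) k hk (by rw [hK, comp_zero])
  have h2 : σ ≫ HomologicalComplex.cyclesMap φ j ≫ G = 0 := by
    change σ ≫ HomologicalComplex.cyclesMap φ j ≫ L.homologyπ j ≫ g = 0
    rw [← HomologicalComplex.homologyπ_naturality_assoc, hg, comp_zero, comp_zero]
  have h3 : (σ ≫ HomologicalComplex.cyclesMap φ j) ≫ L.iCycles j = φ.f j := by
    rw [Category.assoc, HomologicalComplex.cyclesMap_i, HomologicalComplex.liftCycles_i_assoc,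
      Category.id_comp]
  have h4 : L.toCycles i j ≫ L.iCycles j = L.d i j := L.toCycles_i i j
  change G = 0
  refine Scheme.Modules.hom_ext _ _ fun V => ?_
  ext c
  refine Modules.eq_zero_of_locally _ fun x hx => ?_
  obtain ⟨W, hxW, a, y, z, hyz⟩ := h V (((L.iCycles j).app V).hom c)
    (congr($(congrArg (fun ψ : L.cycles j ⟶ L.X k => (ψ.app V).hom) (L.iCycles_d j k)) c)) x hx
  refine ⟨W, hxW, a, ?_⟩
  have h5 : ((L.cycles j).presheaf.map a.op).hom c =
      ((σ ≫ HomologicalComplex.cyclesMap φ j).app W).hom y + ((L.toCycles i j).app W).hom z := by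
    refine Modules.app_injective (L.iCycles j) W ?_
    rw [Modules.app_naturality, hyz, map_add, ← h3, ← h4]
    rfl
  refine (Modules.app_naturality G a c).symm.trans ?_
  rw [h5, map_add]
  have h6 := congr($(congrArg (fun ψ : K.X j ⟶ C => (ψ.app W).hom) h2) y)
  have h7 := congr($(congrArg (fun ψ : L.X i ⟶ C => (ψ.app W).hom) h1) z)
  exact (congrArg₂ (· + ·) h6 h7).trans (add_zero 0)

/-- A morphism of complexes of sheaves of modules, the source of which has zero differential, is
injective on cohomology sheaves as soon as only the zero section of the source becomes exact in
the target. -/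
theorem mono_homologyMap_of_sections {K L : CochainComplex X.Modules ℕ} (φ : K ⟶ L) (i j : ℕ)
    (hi : (ComplexShape.up ℕ).prev j = i)
    (h : ∀ (V : X.Opens) (s : Γ(K.X j, V)) (z : Γ(L.X i, V)),
      ((φ.f j).app V).hom s = ((L.d i j).app V).hom z → s = 0) :
    Mono (HomologicalComplex.homologyMap φ j) := by
  rw [HomologicalComplex.mono_homologyMap_iff_up_to_refinements φ i j _ hi rfl]
  intro A x₂ _ y₁ hy
  refine ⟨A, 𝟙 A, inferInstance, 0, ?_⟩
  rw [Category.id_comp, zero_comp]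
  refine Scheme.Modules.hom_ext _ _ fun V => ?_
  ext a
  refine h V ((x₂.app V).hom a) ((y₁.app V).hom a) ?_
  exact congr($(congrArg (fun ψ : A ⟶ L.X j => (ψ.app V).hom) hy) a)

end modules

namespace FrobeniusLifting

variable {p : ℕ} [Fact p.Prime] {k : Type u} [Field k] [CharP k p] [PerfectRing k p]
  {X : Scheme.{u}} {f : X ⟶ Spec (CommRingCat.of k)} {ι : Type*} [Fintype ι]
  {D : ι → X.IdealSheafData} {L : LogLifting p f D} (Φ : FrobeniusLifting L) (hD : IsSNC f D)

/-- The divided Frobenius as a morphism of sheaves of modules. -/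
def divFrobSheaf (n : ℕ) : logSheaf (twistStr (frobenius k p) f) (twistDiv (frobenius k p) f D) n ⟶
    (Scheme.Modules.pushforward (relFrobenius p f)).obj (logSheaf f D n) where
  val := PresheafOfModules.homMk
    { app := fun V => AddCommGrpCat.ofHom (Φ.divFrob hD n V.unop)
      naturality := fun _ _ _ => rfl }
    (fun V c s => Φ.divFrob_smul hD n V.unop c s)

omit [Fintype ι] in
theorem targetComplex_d (n : ℕ) : (targetComplex p f D).d n (n + 1) =
    pushforwardD (relFrobenius p f) (relFrobenius_closed p f) n :=
  CochainComplex.of_d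
    (fun n => (Scheme.Modules.pushforward (relFrobenius p f)).obj (logSheaf f D n))
    (pushforwardD (relFrobenius p f) (relFrobenius_closed p f)) n

/-- The divided Frobenius as a morphism of complexes. -/
def divFrobComplex : sourceComplex p f D ⟶ targetComplex p f D where
  f n := Φ.divFrobSheaf hD n
  comm' i j hij := by
    obtain rfl : i + 1 = j := hij
    rw [targetComplex_d]
    refine Eq.trans ?_ (zero_comp (f := Φ.divFrobSheaf hD (i + 1))).symm
    refine Scheme.Modules.hom_ext _ _ fun V => ?_
    ext s
    exact Φ.logD_divFrob hD i V s

theorem isDivFrobenius_divFrobComplex : IsDivFrobenius Φ (Φ.divFrobComplex hD) where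
  degree_zero V c := Φ.divFrob_functionForm hD V c
  degree_one V ω' ω hω W hW η' hη := Φ.isPullbackForm_divFrob hD V ω' ω hω W hW η' hη
  wedge V m n α β := Φ.divFrob_wedge hD V m n α β

omit [Fintype ι] in
theorem eq_zero_of_prePullback_toTwist_eq_zero {V : (twist (frobenius k p) f).Opens}
    {s : PreSection (twistStr (frobenius k p) f) (twistDiv (frobenius k p) f D) V}
    (h : prePullback (toTwist_comp p f) (offDivisor_toTwist p f D) (relFrobenius_preimage_le p f V)
      s = 0) : s = 0 := by
  let pr := pullback.fst f (Spec.map (CommRingCat.ofHom (frobenius k p)))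
  have h1 : V ≤ pr ⁻¹ᵁ (relFrobenius p f ⁻¹ᵁ V) := by
    intro x hx
    change relFrobenius p f (pr x) ∈ V
    have := congr($(fst_toTwist p f) x)
    rw [Scheme.Hom.comp_apply, ← relFrobenius_apply] at this
    exact this ▸ hx
  have h2 := prePullback_prePullback_of_comp_eq_id (fst_toTwist p f) (toTwist_comp p f)
    pullback.condition (offDivisor_toTwist p f D) (offDivisor_twist_fst p f D)
    (relFrobenius_preimage_le p f V) h1 le_rfl s
  rw [h, map_zero] at h2
  exact h2.symm

omit [Fintype ι] in
theorem exists_prePullback_toTwist_eq {n : ℕ} {W : X.Opens} {s : PreSection f D W}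
    (hs : IsLogForm f D n s) {V : (twist (frobenius k p) f).Opens}
    (hV : V = pullback.fst f (Spec.map (CommRingCat.ofHom (frobenius k p))) ⁻¹ᵁ W)
    (hW : relFrobenius p f ⁻¹ᵁ V ≤ W) :
    ∃ s' : LogForms (twistStr (frobenius k p) f) (twistDiv (frobenius k p) f D) n V,
      prePullback (toTwist_comp p f) (offDivisor_toTwist p f D)
        (relFrobenius_preimage_le p f V) s'.1 = preRestrict f D hW s :=
  ⟨⟨prePullback pullback.condition (offDivisor_twist_fst p f D) hV.le s,
    hs.pullback pullback.condition _ (fun _ => rfl) _⟩,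
    prePullback_prePullback_of_comp_eq_id (toTwist_fst p f) pullback.condition (toTwist_comp p f)
      (offDivisor_twist_fst p f D) (offDivisor_toTwist p f D) hV.le _ hW s⟩

theorem eq_zero_of_divFrob_zero_eq_zero {V : (twist (frobenius k p) f).Opens}
    (s : LogForms (twistStr (frobenius k p) f) (twistDiv (frobenius k p) f D) 0 V)
    (h : Φ.divFrob hD 0 V s = 0) : s = 0 := by
  apply Subtype.ext
  refine eq_zero_of_prePullback_toTwist_eq_zero ?_
  exact eq_zero_of_preMap_eq_zero Φ.stalkDivFrob_smul (Φ.exists_isFrobChart hD)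
    (isLogForm_toTwist s.2) (congrArg Subtype.val h)

/-- A form with exact image under the divided Frobenius vanishes. -/
theorem eq_zero_of_divFrob_eq_logD {n : ℕ} {V : (twist (frobenius k p) f).Opens}
    (s : LogForms (twistStr (frobenius k p) f) (twistDiv (frobenius k p) f D) (n + 1) V)
    (z : LogForms f D n (relFrobenius p f ⁻¹ᵁ V))
    (h : Φ.divFrob hD (n + 1) V s = logD f D n _ z) : s = 0 := by
  apply Subtype.ext
  refine eq_zero_of_prePullback_toTwist_eq_zero ?_
  exact eq_zero_of_preMap_eq_preD Φ.stalkDivFrob_smul (Φ.exists_isFrobChart hD)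
    (isLogForm_toTwist s.2) z.2 (congrArg Subtype.val h).symm

/-- Every closed logarithmic form is locally the sum of a divided Frobenius pullback and an exact
form. The primitive is given on an affine open, as an element of `prevLog`, which covers degree zero
as well. -/
theorem exists_local_divFrob_add {n : ℕ} {V : (twist (frobenius k p) f).Opens}
    (s : LogForms f D n (relFrobenius p f ⁻¹ᵁ V)) (hs : logD f D n _ s = 0)
    (x : twist (frobenius k p) f) (hx : x ∈ V) :
    ∃ (W : (twist (frobenius k p) f).Opens) (_ : x ∈ W) (_ : W ≤ V)
      (hW' : relFrobenius p f ⁻¹ᵁ W ≤ relFrobenius p f ⁻¹ᵁ V)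
      (y : LogForms (twistStr (frobenius k p) f) (twistDiv (frobenius k p) f D) n W)
      (U : X.affineOpens) (hU : relFrobenius p f ⁻¹ᵁ W ≤ U.1) (z : PreSection f D U.1),
      z ∈ prevLog f D U n ∧ (logRes f D n hW' s).1 =
        (Φ.divFrob hD n W y).1 + preD f D (preRestrict f D hU z) := by
  let pr := pullback.fst f (Spec.map (CommRingCat.ofHom (frobenius k p)))
  have hpt : ∀ x, relFrobenius p f (pr x) = x := by
    intro x
    have := congr($(fst_toTwist p f) x)
    rw [Scheme.Hom.comp_apply, ← relFrobenius_apply] at this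
    exact this
  have hpt' : ∀ x, pr (relFrobenius p f x) = x := by
    intro x
    have := congr($(toTwist_fst p f) x)
    rw [Scheme.Hom.comp_apply, ← relFrobenius_apply] at this
    exact this
  obtain ⟨U, hxU, hU, y, z, hy, hz, h⟩ := exists_local_preMap_add Φ.stalkDivFrob_smul
    (Φ.exists_isFrobChart hD) s.2 (congrArg Subtype.val hs)
    ⟨pr x, by change relFrobenius p f (pr x) ∈ V; rwa [hpt]⟩
  have hW : pr ⁻¹ᵁ U.1 ≤ V := by
    intro x hx
    have : relFrobenius p f (pr x) ∈ V := hU hx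
    rwa [hpt] at this
  have hU' : relFrobenius p f ⁻¹ᵁ (pr ⁻¹ᵁ U.1) ≤ U.1 := by
    intro x hx
    have : pr (relFrobenius p f x) ∈ U.1 := hx
    rwa [hpt'] at this
  obtain ⟨y', hy'⟩ := exists_prePullback_toTwist_eq hy (V := pr ⁻¹ᵁ U.1) rfl hU'
  refine ⟨pr ⁻¹ᵁ U.1, hxU, hW, fun x hx => hW hx, y', U, hU', z, hz, ?_⟩
  have h1 : (Φ.divFrob hD n (pr ⁻¹ᵁ U.1) y').1 =
      preMap f D Φ.stalkDivFrob (preRestrict f D hU' y) := by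
    rw [← hy']
    rfl
  rw [h1]
  exact congrArg (preRestrict f D hU') h

theorem quasiIso_divFrobComplex : QuasiIso (Φ.divFrobComplex hD) := by
  rw [quasiIso_iff]
  intro n
  rw [quasiIsoAt_iff_isIso_homologyMap]
  have hmono : Mono (HomologicalComplex.homologyMap (Φ.divFrobComplex hD) n) := by
    cases n with
    | zero =>
      refine mono_homologyMap_of_sections _ 0 0 (by simp) fun V s z h => ?_
      -- In degree zero the incoming differential is by convention `d 0 0`, which is zero.
      have h0 : (targetComplex p f D).d 0 0 = 0 :=
        (targetComplex p f D).shape 0 0 (by simp)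
      rw [h0] at h
      exact Φ.eq_zero_of_divFrob_zero_eq_zero hD s h
    | succ n =>
      refine mono_homologyMap_of_sections _ n (n + 1) (by simp) fun V s z h => ?_
      rw [targetComplex_d] at h
      exact Φ.eq_zero_of_divFrob_eq_logD hD s z h
  have hepi : Epi (HomologicalComplex.homologyMap (Φ.divFrobComplex hD) n) := by
    cases n with
    | zero =>
      refine epi_homologyMap_of_locally _ 0 0 1 (by simp) rfl fun V s hs x hx => ?_
      rw [targetComplex_d] at hs
      obtain ⟨W, hxW, hW, hW', y, U, hU, z, hz, h⟩ := Φ.exists_local_divFrob_add hD s hs x hx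
      refine ⟨W, hxW, homOfLE hW, y, 0, ?_⟩
      rw [map_zero, add_zero]
      apply Subtype.ext
      obtain rfl : z = 0 := hz
      rw [map_zero, map_zero, add_zero] at h
      exact h
    | succ n =>
      refine epi_homologyMap_of_locally _ n (n + 1) (n + 2) (by simp) rfl fun V s hs x hx => ?_
      rw [targetComplex_d] at hs
      obtain ⟨W, hxW, hW, hW', y, U, hU, z, hz, h⟩ := Φ.exists_local_divFrob_add hD s hs x hx
      have hz' : IsLogForm f D n (preRestrict f D hU z) :=
        IsLogForm.restrict hU fun x hx => ⟨U, hx, le_rfl, hz⟩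
      refine ⟨W, hxW, homOfLE hW, y, (⟨_, hz'⟩ : LogForms f D n _), ?_⟩
      rw [targetComplex_d]
      exact Subtype.ext h
  exact isIso_of_mono_of_epi _

end FrobeniusLifting

end LogDR

end

open LogDR AlgebraicGeometry CategoryTheory

theorem theorem2p4 (p : ℕ) [Fact p.Prime] (k : Type u) [Field k] [CharP k p] [PerfectRing k p]
    (X : Scheme.{u}) (f : X ⟶ Spec (CommRingCat.of k)) [Smooth f]
    {ι : Type*} [Fintype ι] (D : ι → X.IdealSheafData) (hD : IsSNC f D)
    (L : LogLifting p f D) (Φ : FrobeniusLifting L) :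
    ∃ φ : sourceComplex p f D ⟶ targetComplex p f D, IsDivFrobenius Φ φ ∧ QuasiIso φ :=
  ⟨Φ.divFrobComplex hD, Φ.isDivFrobenius_divFrobComplex hD, Φ.quasiIso_divFrobComplex hD⟩
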